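/- **Lemma 2.2.** Let $\Omega\subset\mathbb{R}^2$ be a bounded domain and let $w\in H_0^2(\Omega)\cap H^4(\Omega)$. For $h>0$ let $\mathcal{T}_h$ denote a regular uniform triangulation of $\Omega$ into axis-parallel squares with mesh size $h$: a finite set of closed squares $K=c_K+[-h,h]^2$ whose interiors lie in $\Omega$ and whose union is $\overline{\Omega}$, such that any two distinct squares are disjoint or meet in exactly a common vertex or a common edge. For $K\in\mathcal{T}_h$ put $P_T(K)=P_2(K)+\mathrm{span}\{x_1^3,x_2^3\}$, where $P_2(K)$ is the space of polynomials of degree at most $2$, and let $\Pi_K w\in P_T(K)$ be the rectangular Morley interpolant of $w$, determined by $$(\Pi_K w)(P)=w(P)\quad\text{and}\quad \int_F\frac{\partial\,\Pi_K w}{\partial\nu_F}\,ds=\int_F\frac{\partial w}{\partial\nu_F}\,ds$$ for every vertex $P$ and every edge $F$ of $K$, with $\nu_F$ the outer unit normal on $F$ (on $K$, $w$ is identified with its $C^1(K)$ representative). Let $\Pi_h$ be given by $\Pi_h w|_K=\Pi_K w$ for all $K\in\mathcal{T}_h$, and let $\nabla_h^2$ be the Hessian taken element by element. Then the interpolants $\Pi_K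 w$ exist and are unique, and there is a function $h\mapsto\alpha_h$, depending only on $\Omega$ and $w$, with $\lim_{h\to0^+}\alpha_h=0$, such that for every $h>0$ and every such triangulation $\mathcal{T}_h$ $$\left|\left(\nabla_h^2(w-\Pi_h w),\nabla_h^2\Pi_h w\right)_{L^2(\Omega)}\right|\le\alpha_h h^2 .$$ In particular $(\nabla_h^2(w-\Pi_h w),\nabla_h^2\Pi_h w)_{L^2(\Omega)}\le\alpha_h h^2$, and this term is of higher order than $h^2$. -/

import Mathlib

open MeasureTheory Filter Topology
open scoped ContDiff

/- The plane is `Fin 2 → ℝ`, with coordinates `x 0`, `x 1` and Lebesgue measure `volume`.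
Only its topology, its smooth structure and its measure are used below, not its norm. -/

/-- `φ` is a test function on `U`: smooth, with compact support contained in `U`. -/
def IsTestFunction (U : Set (Fin 2 → ℝ)) (φ : (Fin 2 → ℝ) → ℝ) : Prop :=
  ContDiff ℝ ∞ φ ∧ HasCompactSupport φ ∧ tsupport φ ⊆ U

/-- `g` is a weak partial derivative of `u` with respect to the coordinate `i` on the open
set `U`. -/
def HasWeakPartial (U : Set (Fin 2 → ℝ)) (i : Fin 2) (u g : (Fin 2 → ℝ) → ℝ) : Prop :=
  LocallyIntegrableOn u U ∧ LocallyIntegrableOn g U ∧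
    ∀ φ : (Fin 2 → ℝ) → ℝ, IsTestFunction U φ →
      ∫ x in U, u x * fderiv ℝ φ x (Pi.single i 1) = -∫ x in U, g x * φ x

open Classical in
/-- The weak partial derivative of `u` on `U` (unique up to null sets if it exists). -/
noncomputable def weakPartial (U : Set (Fin 2 → ℝ)) (i : Fin 2) (u : (Fin 2 → ℝ) → ℝ) :
    (Fin 2 → ℝ) → ℝ :=
  if hu : ∃ g, HasWeakPartial U i u g then hu.choose else 0

/-- Iterated weak partial derivative: `weakDeriv U [i₁, …, iₖ] u = ∂_{i₁} ⋯ ∂_{iₖ} u` on `U`. -/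
noncomputable def weakDeriv (U : Set (Fin 2 → ℝ)) :
    List (Fin 2) → ((Fin 2 → ℝ) → ℝ) → (Fin 2 → ℝ) → ℝ
  | [], u => u
  | i :: l, u => weakPartial U i (weakDeriv U l u)

/-- `u ∈ H^m(U)`: all weak derivatives of order at most `m` exist and belong to `L²(U)`. -/
def MemSobolev (m : ℕ) (U : Set (Fin 2 → ℝ)) (u : (Fin 2 → ℝ) → ℝ) : Prop :=
  (∀ l : List (Fin 2), l.length ≤ m → MemLp (weakDeriv U l u) 2 (volume.restrict U)) ∧
    ∀ (l : List (Fin 2)) (i : Fin 2), l.length < m →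
      HasWeakPartial U i (weakDeriv U l u) (weakDeriv U (i :: l) u)

/-- `u ∈ H₀^m(U)`: `u` belongs to the closure of the test functions on `U` in `H^m(U)`. -/
def MemSobolevZero (m : ℕ) (U : Set (Fin 2 → ℝ)) (u : (Fin 2 → ℝ) → ℝ) : Prop :=
  MemSobolev m U u ∧
    ∃ φ : ℕ → (Fin 2 → ℝ) → ℝ, (∀ n, IsTestFunction U (φ n)) ∧
      ∀ l : List (Fin 2), l.length ≤ m →
        Tendsto (fun n => eLpNorm (weakDeriv U l (u - φ n)) 2 (volume.restrict U)) atTop (𝓝 0)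

/-- The closed square element with centre `c`, which the affine map `ξ = (x - c) / h` sends
onto `[-1, 1]²`. -/
def cell (h : ℝ) (c : Fin 2 → ℝ) : Set (Fin 2 → ℝ) :=
  {x | ∀ i, c i - h ≤ x i ∧ x i ≤ c i + h}

/-- The four vertices of `cell h c`. -/
def cellVertices (h : ℝ) (c : Fin 2 → ℝ) : Set (Fin 2 → ℝ) :=
  {x | ∀ i, x i = c i - h ∨ x i = c i + h}

/-- `T` is the set of centres of the elements of a regular uniform triangulation of `Ω` into
squares `K` with mesh size `h`: the elements lie inside `Ω` up to their boundaries, they cover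
the closure of `Ω`, and two distinct elements are disjoint or meet in a common vertex
(`P = Q`) or a common edge. -/
structure IsUniformMesh (Ω : Set (Fin 2 → ℝ)) (h : ℝ) (T : Finset (Fin 2 → ℝ)) : Prop where
  pos : 0 < h
  interior_subset : ∀ c ∈ T, interior (cell h c) ⊆ Ω
  closure_eq : closure Ω = ⋃ c ∈ T, cell h c
  conforming : ∀ c ∈ T, ∀ c' ∈ T, c ≠ c' →
    cell h c ∩ cell h c' = ∅ ∨
      ∃ P ∈ cellVertices h c ∩ cellVertices h c', ∃ Q ∈ cellVertices h c ∩ cellVertices h c',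
        cell h c ∩ cell h c' = segment ℝ P Q

/-- The shape function space `P₂ + span {x₁³, x₂³}` of the rectangular Morley element. -/
noncomputable def morleySpace : Submodule ℝ (MvPolynomial (Fin 2) ℝ) :=
  MvPolynomial.restrictTotalDegree (Fin 2) ℝ 2 ⊔
    Submodule.span ℝ {MvPolynomial.X 0 ^ 3, MvPolynomial.X 1 ^ 3}

/-- The point with tangential parameter `t ∈ [-h, h]` on the edge of `cell h c` whose outer unit
normal is `s` times the `i`-th coordinate vector, where `s = 1` or `s = -1`. -/
def edgePoint (h : ℝ) (c : Fin 2 → ℝ) (i : Fin 2) (s t : ℝ) : Fin 2 → ℝ :=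
  fun k => if k = i then c k + s * h else c k + t

/-- The integral of the outer normal derivative of `f`, a `C¹` function on the closed square
`cell h c`, over the edge with outer unit normal `s e_i`. -/
noncomputable def edgeNormalIntegral (h : ℝ) (c : Fin 2 → ℝ) (i : Fin 2) (s : ℝ)
    (f : (Fin 2 → ℝ) → ℝ) : ℝ :=
  ∫ t in (-h)..h, fderivWithin ℝ f (cell h c) (edgePoint h c i s t) (Pi.single i s)

/-- `p = Π_K v` on `K = cell h c`: `p` lies in the shape function space, has the vertex values of
`v`, and has the same integrals of the normal derivative over the four edges as `v`. Vertex values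
and normal derivatives of the Sobolev function `v` are those of its representative in `C¹(K)`. -/
def IsMorleyInterpolant (h : ℝ) (c : Fin 2 → ℝ) (v : (Fin 2 → ℝ) → ℝ)
    (p : MvPolynomial (Fin 2) ℝ) : Prop :=
  p ∈ morleySpace ∧
    ∃ f : (Fin 2 → ℝ) → ℝ, ContDiffOn ℝ 1 f (cell h c) ∧
      f =ᵐ[volume.restrict (cell h c)] v ∧
      (∀ P ∈ cellVertices h c, MvPolynomial.eval P p = f P) ∧
      ∀ (i : Fin 2) (s : ℝ), s = 1 ∨ s = -1 →
        edgeNormalIntegral h c i s (fun x => MvPolynomial.eval x p) =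
          edgeNormalIntegral h c i s f

open Classical in
/-- The local interpolation operator `Π_K` for `K = cell h c`. -/
noncomputable def localInterpolant (h : ℝ) (c : Fin 2 → ℝ) (v : (Fin 2 → ℝ) → ℝ) :
    MvPolynomial (Fin 2) ℝ :=
  if hv : ∃ p, IsMorleyInterpolant h c v p then hv.choose else 0

/-- The global interpolation operator `Π_h`, equal to `Π_K v` inside each element `K` (the element
boundaries are a null set). -/
noncomputable def globalInterpolant (h : ℝ) (T : Finset (Fin 2 → ℝ)) (v : (Fin 2 → ℝ) → ℝ) :
    (Fin 2 → ℝ) → ℝ :=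
  fun x => ∑ c ∈ T, (interior (cell h c)).indicator
    (fun y => MvPolynomial.eval y (localInterpolant h c v)) x

/-- `(∇_h² u, ∇_h² v)_{L²(Ω)}`, with the Hessians taken element by element and contracted by the
Frobenius product. -/
noncomputable def brokenHessianInner (h : ℝ) (T : Finset (Fin 2 → ℝ))
    (u v : (Fin 2 → ℝ) → ℝ) : ℝ :=
  ∑ c ∈ T, ∫ x in interior (cell h c), ∑ i : Fin 2, ∑ j : Fin 2,
    weakDeriv (interior (cell h c)) [i, j] u x * weakDeriv (interior (cell h c)) [i, j] v x

/-! On one cell everything can be computed. Write f_k for ∫_K b_k f, where b_k = (h² − (x_k −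
c_k)²)/2 is the bubble in direction k. The mixed derivative of Π_K w is a constant, fixed by the
vertex values to be the mean of ∂₁∂₂w, so mixed terms contribute nothing. The polynomial ∂_i²Π_K w
is affine in x_i. Its mean is that of ∂_i²w, but its first moment is not, because the edge means of
w are not interpolated. With j the other direction, A = (∂_i³w)_i and B = (∂_j²∂_i w)_j, the cubic
coefficient is (A − B)/(8h⁴), and the consistency term on K is the sum over i of 3/(4h⁴)·B(A − B)
(`IsCellRep.integral_consistency`).

Summed over the mesh, these products are bilinear forms in third derivatives of w. Such a form is
bounded by h² times the product of the L² norms, and for continuous arguments a bubble integral is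
nearly 4h⁴/3 times a point value. By density the form is (h²/3)(f, g)_{L²(Ω)} + o(h²)
(`exists_meanForm_close`). This alone gives only O(h²). The leading coefficient is one third of the
sum over i of ∫ (∂_j²∂_i w ∂_i³w − (∂_j²∂_i w)²).

This sum is zero, since ∫ ∂_j²∂_i w ∂_i³w = ∫ (∂_i²∂_j w)²: both sides equal −∫ ∂_i³∂_j w ∂_i∂_j w
after one integration by parts (`IsUniformMesh.integral_third_derivatives`). Boundary terms are
absent because ∂₁∂₂w vanishes on axis-parallel edges when w ∈ H₀². No traces are used for this:
cutoffs vanishing on the grid lines remove the edges, approximation of w by test functions in H²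
treats strips along the edges, and what remains lives in squares of side O(ε) at the grid points and
tends to zero with ε (`IsUniformMesh.integral_mixed_parts`).

The interpolation conditions need a C¹ representative on the closed cell. It is built from absolute
continuity on almost every line: an integrable mixed second derivative turns u into functions of one
variable plus a quadrant integral, which is continuous. -/

/-! ### Test functions and the du Bois-Reymond lemma on an interval. -/

section Interval

open Set

/-- A test function on `(-h, h)`. -/
structure IsIntervalTest (h : ℝ) (a : ℝ → ℝ) : Prop where
  contDiff : ContDiff ℝ ∞ a
  bound : ∃ M < h, ∀ s, M ≤ |s| → a s = 0

theorem IsIntervalTest.of_tsupport {h : ℝ} (hh : 0 < h) {a : ℝ → ℝ} (ha : ContDiff ℝ ∞ a)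
    (hc : HasCompactSupport a) (hs : tsupport a ⊆ Ioo (-h) h) : IsIntervalTest h a := by
  refine ⟨ha, ?_⟩
  rcases (tsupport a).eq_empty_or_nonempty with he | hne
  · refine ⟨0, hh, fun s _ => ?_⟩
    rw [tsupport_eq_empty_iff] at he
    simp [he]
  · obtain ⟨x, hx, hmax⟩ := IsCompact.exists_isMaxOn hc hne continuous_abs.continuousOn
    have hxh : |x| < h := abs_lt.2 (hs hx)
    refine ⟨(|x| + h) / 2, by linarith, fun s hsM => ?_⟩
    by_contra hne0
    have h1 : |s| ≤ |x| := hmax (subset_tsupport _ hne0)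
    linarith

theorem IsIntervalTest.tsupport_subset {h : ℝ} {a : ℝ → ℝ} (ha : IsIntervalTest h a) :
    tsupport a ⊆ Ioo (-h) h ∧ HasCompactSupport a := by
  obtain ⟨M, hM, hz⟩ := ha.bound
  have hsub : Function.support a ⊆ Icc (-M) M := by
    intro s hs
    by_contra hn
    apply hs
    apply hz
    by_contra hlt
    exact hn (abs_le.1 (not_le.1 hlt).le)
  constructor
  · refine (closure_minimal hsub isClosed_Icc).trans fun s hs => ?_
    exact ⟨by linarith [hs.1], by linarith [hs.2]⟩
  · exact HasCompactSupport.of_support_subset_isCompact isCompact_Icc hsub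

theorem IsIntervalTest.eq_zero {h : ℝ} {a : ℝ → ℝ} (ha : IsIntervalTest h a) {s : ℝ}
    (hs : s ∉ Ioo (-h) h) : a s = 0 :=
  image_eq_zero_of_notMem_tsupport fun hm => hs (ha.tsupport_subset.1 hm)

/-- Zero mean makes the primitive started at −h vanish again to the right of the support, so the
same bound M serves for it. -/
theorem IsIntervalTest.exists_primitive {h : ℝ} {b : ℝ → ℝ} (hb : IsIntervalTest h b)
    (h0 : ∫ s in Ioo (-h) h, b s = 0) :
    ∃ a, IsIntervalTest h a ∧ deriv a = b := by
  obtain ⟨M, hM, hz⟩ := hb.bound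
  have hcont : Continuous b := hb.contDiff.continuous
  have hder : ∀ s, HasDerivAt (fun s => ∫ r in (-h)..s, b r) (b s) s := fun s =>
    intervalIntegral.integral_hasDerivAt_right (hcont.intervalIntegrable _ _)
      hcont.stronglyMeasurable.stronglyMeasurableAtFilter hcont.continuousAt
  have hd : deriv (fun s => ∫ r in (-h)..s, b r) = b := funext fun s => (hder s).deriv
  refine ⟨fun s => ∫ r in (-h)..s, b r, ⟨?_, M, hM, ?_⟩, hd⟩
  · rw [contDiff_infty_iff_deriv]
    exact ⟨fun s => (hder s).differentiableAt, by rw [hd]; exact hb.contDiff⟩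
  · intro s hs
    rcases le_abs.1 hs with hs | hs
    · rcases le_or_gt (-h) h with hhh | hhh
      · have e1 : ∫ r in (-h)..h, b r = 0 := by
          rw [intervalIntegral.integral_of_le hhh, integral_Ioc_eq_integral_Ioo, h0]
        have e2 : ∫ r in h..s, b r = 0 := by
          rw [intervalIntegral.integral_congr (g := fun _ => 0)]
          · simp
          · intro r hr
            apply hz
            have : M ≤ r := by
              rcases mem_uIcc.1 hr with h1 | h1 <;> linarith [h1.1, h1.2]
            exact this.trans (le_abs_self r)
        change ∫ r in (-h)..s, b r = 0
        rw [← intervalIntegral.integral_add_adjacent_intervals (hcont.intervalIntegrable (-h) h)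
          (hcont.intervalIntegrable h s), e1, e2, add_zero]
      -- Here h < 0, hence M < 0 ≤ |r| and b is identically zero.
      · rw [intervalIntegral.integral_congr (g := fun _ => 0)]
        · simp
        · intro r hr
          apply hz
          linarith [abs_nonneg r]
    · rw [intervalIntegral.integral_congr (g := fun _ => 0)]
      · simp
      · intro r hr
        apply hz
        have : M ≤ -r := by
          rcases mem_uIcc.1 hr with h1 | h1 <;> linarith [h1.1, h1.2]
        exact this.trans (neg_le_abs r)

theorem exists_isIntervalTest_integral_eq_one {h : ℝ} (hh : 0 < h) :
    ∃ a, IsIntervalTest h a ∧ ∫ s in Ioo (-h) h, a s = 1 := by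
  let f : ContDiffBump (0 : ℝ) := ⟨h / 4, h / 2, by positivity, by linarith⟩
  have hf : IsIntervalTest h (f.normed volume) := by
    refine ⟨f.contDiff_normed, h / 2, by linarith, fun s hs => ?_⟩
    have : s ∉ Function.support (f.normed volume) := by
      rw [f.support_normed_eq]
      simpa [f] using hs
    simpa using this
  refine ⟨_, hf, ?_⟩
  rw [setIntegral_eq_integral_of_forall_compl_eq_zero fun s hs => hf.eq_zero hs]
  exact f.integral_normed

theorem IsIntervalTest.integrable_mul {h : ℝ} {a v : ℝ → ℝ} (ha : IsIntervalTest h a)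
    (hv : IntegrableOn v (Ioo (-h) h)) : IntegrableOn (fun s => v s * a s) (Ioo (-h) h) := by
  obtain ⟨C, hC⟩ := ha.tsupport_subset.2.exists_bound_of_continuous ha.contDiff.continuous
  exact Integrable.mul_bdd (c := C) hv ha.contDiff.continuous.aestronglyMeasurable
    (ae_of_all _ hC)

theorem IsIntervalTest.integrable {h : ℝ} {a : ℝ → ℝ} (ha : IsIntervalTest h a) :
    IntegrableOn a (Ioo (-h) h) :=
  (ha.contDiff.continuous.integrable_of_hasCompactSupport ha.tsupport_subset.2).integrableOn

theorem ae_eq_zero_of_integral_isIntervalTest {h : ℝ} (hh : 0 < h) {v : ℝ → ℝ}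
    (hv : IntegrableOn v (Ioo (-h) h))
    (H : ∀ a, IsIntervalTest h a → ∫ s in Ioo (-h) h, v s * a s = 0) :
    ∀ᵐ s ∂volume.restrict (Ioo (-h) h), v s = 0 := by
  rw [ae_restrict_iff' measurableSet_Ioo]
  refine isOpen_Ioo.ae_eq_zero_of_integral_contDiff_smul_eq_zero hv.locallyIntegrableOn ?_
  intro g hg hgc hgs
  have ht := IsIntervalTest.of_tsupport hh hg hgc hgs
  rw [← H g ht, setIntegral_eq_integral_of_forall_compl_eq_zero]
  · simp [mul_comm]
  · intro s hs
    rw [ht.eq_zero hs, mul_zero]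

/-- Fix a test function a of integral one. Every test function b equals (∫ b)·a plus the derivative
of a test function, so v acts on b as the constant ∫ v a does. -/
theorem exists_ae_eq_const_of_integral_deriv_eq_zero {h : ℝ} (hh : 0 < h) {v : ℝ → ℝ}
    (hv : IntegrableOn v (Ioo (-h) h))
    (H : ∀ a, IsIntervalTest h a → ∫ s in Ioo (-h) h, v s * deriv a s = 0) :
    ∃ k, ∀ᵐ s ∂volume.restrict (Ioo (-h) h), v s = k := by
  obtain ⟨a, ha, ha1⟩ := exists_isIntervalTest_integral_eq_one hh
  refine ⟨∫ s in Ioo (-h) h, v s * a s, ?_⟩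
  set k := ∫ s in Ioo (-h) h, v s * a s with hk
  suffices hs : ∀ᵐ s ∂volume.restrict (Ioo (-h) h), v s - k = 0 by
    filter_upwards [hs] with s hs using by linarith
  have hkint : IntegrableOn (fun _ : ℝ => k) (Ioo (-h) h) := by simp
  refine ae_eq_zero_of_integral_isIntervalTest hh (hv.sub hkint) fun b hb => ?_
  set m := ∫ s in Ioo (-h) h, b s with hm
  have hc : IsIntervalTest h (fun s => b s - m * a s) := by
    obtain ⟨M, hM, hz⟩ := ha.bound
    obtain ⟨M', hM', hz'⟩ := hb.bound
    refine ⟨hb.contDiff.sub (contDiff_const.mul ha.contDiff), max M M', max_lt hM hM', ?_⟩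
    intro s hs
    rw [hz s ((le_max_left _ _).trans hs), hz' s ((le_max_right _ _).trans hs)]
    simp
  obtain ⟨c, hct, hcd⟩ := hc.exists_primitive (by
    rw [integral_sub hb.integrable (ha.integrable.const_mul m), integral_const_mul, ha1]
    simp [hm])
  have h1 := H c hct
  rw [hcd] at h1
  have e1 : ∫ s in Ioo (-h) h, v s * (b s - m * a s) =
      (∫ s in Ioo (-h) h, v s * b s) - m * k := by
    rw [hk, ← integral_const_mul, ← integral_sub (hb.integrable_mul hv)
      ((ha.integrable_mul hv).const_mul m)]
    congr 1; ext s; ring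
  have e2 : ∫ s in Ioo (-h) h, (v s - k) * b s =
      (∫ s in Ioo (-h) h, v s * b s) - k * m := by
    rw [hm, ← integral_const_mul, ← integral_sub (hb.integrable_mul hv)
      (hb.integrable.const_mul k)]
    congr 1; ext s; ring
  rw [e2]; rw [e1] at h1; linarith

end Interval

/-! ### Absolutely continuous functions on an interval. -/

section Slice

open Set

/-- `U` is absolutely continuous on `[-h, h]` with derivative `g` almost everywhere. -/
structure HasACDeriv (h : ℝ) (U g : ℝ → ℝ) : Prop where
  integrableOn : IntegrableOn g (Ioo (-h) h)
  eq_add : ∀ s ∈ Icc (-h) h, U s = U (-h) + ∫ r in (-h)..s, g r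

theorem MeasureTheory.IntegrableOn.intervalIntegrable_of_Ioo {h : ℝ} {g : ℝ → ℝ}
    (hg : IntegrableOn g (Ioo (-h) h)) {s t : ℝ} (hs : s ∈ Icc (-h) h) (ht : t ∈ Icc (-h) h) :
    IntervalIntegrable g volume s t := by
  rw [intervalIntegrable_iff]
  rw [← integrableOn_Ioc_iff_integrableOn_Ioo] at hg
  refine hg.mono_set fun r hr => ?_
  rw [uIoc, mem_Ioc] at hr
  exact ⟨(le_min hs.1 ht.1).trans_lt hr.1, hr.2.trans (max_le hs.2 ht.2)⟩

theorem HasACDeriv.of_integrableOn {h : ℝ} {g : ℝ → ℝ} (hg : IntegrableOn g (Ioo (-h) h))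
    (v : ℝ) : HasACDeriv h (fun s => v + ∫ r in (-h)..s, g r) g :=
  ⟨hg, fun s _ => by simp⟩

theorem HasACDeriv.of_hasDerivAt {h : ℝ} {U g : ℝ → ℝ}
    (hU : ∀ s, HasDerivAt U (g s) s) (hg : Continuous g) : HasACDeriv h U g := by
  refine ⟨(hg.integrableOn_Icc).mono_set Ioo_subset_Icc_self, fun s _ => ?_⟩
  rw [intervalIntegral.integral_eq_sub_of_hasDerivAt (fun r _ => hU r)
    (hg.intervalIntegrable _ _)]
  ring

theorem HasACDeriv.integral_eq {h : ℝ} (hh : 0 < h) {U g : ℝ → ℝ} (hU : HasACDeriv h U g) :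
    ∫ s in Ioo (-h) h, g s = U h - U (-h) := by
  rw [hU.eq_add h ⟨by linarith, le_rfl⟩, intervalIntegral.integral_of_le (by linarith),
    integral_Ioc_eq_integral_Ioo]
  ring

theorem HasACDeriv.congr {h : ℝ} (hh : 0 < h) {U U' g g' : ℝ → ℝ} (hU : HasACDeriv h U g)
    (e : ∀ s ∈ Icc (-h) h, U s = U' s) (e' : ∀ᵐ s ∂volume.restrict (Ioo (-h) h), g s = g' s) :
    HasACDeriv h U' g' := by
  refine ⟨(integrable_congr e').1 hU.integrableOn, fun s hs => ?_⟩
  have hm : -h ∈ Icc (-h) h := ⟨le_rfl, by linarith⟩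
  rw [← e s hs, ← e (-h) hm, hU.eq_add s hs, intervalIntegral.integral_congr_ae]
  rw [restrict_Ioo_eq_restrict_Ioc, ae_restrict_iff' measurableSet_Ioc] at e'
  filter_upwards [e'] with r hr hrs
  rw [uIoc_of_le hs.1] at hrs
  exact hr ⟨hrs.1, hrs.2.trans hs.2⟩

theorem HasACDeriv.continuousOn {h : ℝ} (hh : 0 < h) {U g : ℝ → ℝ} (hU : HasACDeriv h U g) :
    ContinuousOn U (Icc (-h) h) := by
  have hm : -h ∈ Icc (-h) h := ⟨le_rfl, by linarith⟩
  have hM : h ∈ Icc (-h) h := ⟨by linarith, le_rfl⟩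
  have := (IntervalIntegrable.absolutelyContinuousOnInterval_intervalIntegral
    (IntegrableOn.intervalIntegrable_of_Ioo hU.integrableOn hm hM) (c := -h)
      left_mem_uIcc).continuousOn
  rw [uIcc_of_le (by linarith)] at this
  exact (continuousOn_const.add this).congr hU.eq_add

theorem HasACDeriv.mul {h : ℝ} (hh : 0 < h) {U g W k : ℝ → ℝ} (hU : HasACDeriv h U g)
    (hW : HasACDeriv h W k) :
    HasACDeriv h (fun s => U s * W s) (fun s => g s * W s + U s * k s) := by
  have hm : -h ∈ Icc (-h) h := ⟨le_rfl, by linarith⟩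
  have hM : h ∈ Icc (-h) h := ⟨by linarith, le_rfl⟩
  -- Nothing is known about U outside [−h, h]; absolute continuity and the derivative are therefore
  -- obtained for the primitive that agrees with U there.
  have key : ∀ {U g : ℝ → ℝ}, HasACDeriv h U g → ∀ s ∈ Icc (-h) h,
      AbsolutelyContinuousOnInterval (fun s => U (-h) + ∫ r in (-h)..s, g r) (-h) s ∧
      ∀ᵐ r, r ∈ uIcc (-h) s → deriv (fun s => U (-h) + ∫ r in (-h)..s, g r) r = g r := by
    intro U g hU s hs
    have hi := IntegrableOn.intervalIntegrable_of_Ioo hU.integrableOn hm hs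
    constructor
    · have hc : AbsolutelyContinuousOnInterval (fun _ : ℝ => U (-h)) (-h) s :=
        (contDiff_const (n := 1)).contDiffOn.absolutelyContinuousOnInterval
      exact hc.fun_add (hi.absolutelyContinuousOnInterval_intervalIntegral left_mem_uIcc)
    · filter_upwards [hi.ae_hasDerivAt_integral] with r hr hrs
      exact ((hr hrs (-h) left_mem_uIcc).const_add (U (-h))).deriv
  have hco : ∀ {W g : ℝ → ℝ}, ContinuousOn W (Icc (-h) h) → IntegrableOn g (Ioo (-h) h) →
      IntegrableOn (fun s => g s * W s) (Ioo (-h) h) := by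
    intro W g hW hg
    rw [← integrableOn_Icc_iff_integrableOn_Ioo] at hg ⊢
    exact hg.mul_continuousOn hW isCompact_Icc
  refine ⟨(hco (hW.continuousOn hh) hU.integrableOn).add ?_, fun s hs => ?_⟩
  · simpa only [mul_comm] using hco (hU.continuousOn hh) hW.integrableOn
  · obtain ⟨aU, dU⟩ := key hU s hs
    obtain ⟨aW, dW⟩ := key hW s hs
    have := aU.integral_deriv_mul_eq_sub aW
    have e : ∫ r in (-h)..s, (g r * W r + U r * k r) = U s * W s - U (-h) * W (-h) := by
      rw [hU.eq_add s hs, hW.eq_add s hs]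
      simp only [intervalIntegral.integral_same, add_zero] at this
      rw [← this]
      apply intervalIntegral.integral_congr_ae
      filter_upwards [dU, dW] with r h1 h2 hr
      have hr' := uIoc_subset_uIcc hr
      rw [h1 hr', h2 hr']
      rw [uIcc_of_le hs.1] at hr'
      have hrI : r ∈ Icc (-h) h := ⟨hr'.1, hr'.2.trans hs.2⟩
      rw [← hU.eq_add r hrI, ← hW.eq_add r hrI]
    rw [e]; ring

/-- Rectangles are a π-system generating the product σ-algebra, and the sets with vanishing integral
are stable under complements and disjoint unions. -/
theorem ae_eq_zero_of_setIntegral_prod_eq_zero {α β : Type*} [MeasurableSpace α]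
    [MeasurableSpace β] {ρ : Measure (α × β)} {z : α × β → ℝ}
    (hz : Integrable z ρ)
    (H : ∀ A B, MeasurableSet A → MeasurableSet B → ∫ p in A ×ˢ B, z p ∂ρ = 0) :
    ∀ᵐ p ∂ρ, z p = 0 := by
  refine hz.ae_eq_zero_of_forall_setIntegral_eq_zero fun s hs hfin => ?_
  clear hfin
  induction s, hs using MeasurableSpace.induction_on_inter generateFrom_prod.symm isPiSystem_prod with
  | empty => simp
  | basic t ht =>
    obtain ⟨A, hA, B, hB, rfl⟩ := ht
    exact H A B hA hB
  | compl t ht ih =>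
    have h1 := integral_add_compl ht hz
    have h2 := H univ univ .univ .univ
    simp only [univ_prod_univ, Measure.restrict_univ] at h2
    linarith
  | iUnion f hd hm ih =>
    rw [integral_iUnion hm hd hz.integrableOn]
    simp [ih]

end Slice

/-! ### Absolute continuity on almost every line of a square. -/

section SliceLemma

open Set

/-- The primitive is a partial integral of the function G(r, t)·1_{r ≤ s} of three variables, which
is integrable on the cube, so Fubini applies. -/
theorem integrable_primitive {h : ℝ} {G : ℝ × ℝ → ℝ}
    (hG : IntegrableOn G (Ioo (-h) h ×ˢ Ioo (-h) h)) :
    IntegrableOn (fun p : ℝ × ℝ => ∫ r in (-h)..p.1, G (r, p.2)) (Ioo (-h) h ×ˢ Ioo (-h) h) := by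
  set μ := (volume : Measure ℝ).restrict (Ioo (-h) h) with hμ
  have hprod : (volume : Measure (ℝ × ℝ)).restrict (Ioo (-h) h ×ˢ Ioo (-h) h) = μ.prod μ := by
    rw [hμ, Measure.prod_restrict]; rfl
  rw [IntegrableOn, hprod] at hG ⊢
  have h1 : Integrable (fun q : ℝ × (ℝ × ℝ) => G q.2.swap) (μ.prod (μ.prod μ)) :=
    hG.swap.comp_snd μ
  have h2 : Integrable (fun q : (ℝ × ℝ) × ℝ => G (q.2, q.1.2)) ((μ.prod μ).prod μ) :=
    (measurePreserving_prodAssoc μ μ μ).integrable_comp_of_integrable h1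
  have h3 : Integrable ({q : (ℝ × ℝ) × ℝ | q.2 ≤ q.1.1}.indicator
      fun q : (ℝ × ℝ) × ℝ => G (q.2, q.1.2)) ((μ.prod μ).prod μ) :=
    h2.indicator (measurableSet_le (by fun_prop) (by fun_prop))
  refine h3.integral_prod_left.congr ?_
  rw [← hprod]
  filter_upwards [ae_restrict_mem (measurableSet_Ioo.prod measurableSet_Ioo)] with p hp
  have hp1 := hp.1
  rw [intervalIntegral.integral_of_le hp1.1.le]
  have : (fun y => {q : (ℝ × ℝ) × ℝ | q.2 ≤ q.1.1}.indicator
      (fun q : (ℝ × ℝ) × ℝ => G (q.2, q.1.2)) (p, y)) =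
      (Iic p.1).indicator fun y => G (y, p.2) := by
    ext y; simp [indicator]
  rw [this, integral_indicator measurableSet_Iic, hμ, Measure.restrict_restrict measurableSet_Iic]
  congr 2
  ext y
  simp only [mem_inter_iff, mem_Iic, mem_Ioo, mem_Ioc]
  constructor
  · rintro ⟨h1, h2, h3⟩; exact ⟨h2, h1⟩
  · rintro ⟨h1, h2⟩; exact ⟨h2, h1, h2.trans_lt hp1.2⟩

theorem setIntegral_square {h : ℝ} {F : ℝ × ℝ → ℝ}
    (hF : IntegrableOn F (Ioo (-h) h ×ˢ Ioo (-h) h)) :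
    ∫ p in Ioo (-h) h ×ˢ Ioo (-h) h, F p = ∫ t in Ioo (-h) h, ∫ s in Ioo (-h) h, F (s, t) := by
  have hprod : (volume : Measure (ℝ × ℝ)).restrict (Ioo (-h) h ×ˢ Ioo (-h) h) =
      (volume.restrict (Ioo (-h) h)).prod (volume.restrict (Ioo (-h) h)) := by
    rw [Measure.prod_restrict]; rfl
  rw [IntegrableOn, hprod] at hF
  rw [hprod]
  exact integral_prod_symm F hF

theorem MeasureTheory.IntegrableOn.slice_ae {h : ℝ} {F : ℝ × ℝ → ℝ}
    (hF : IntegrableOn F (Ioo (-h) h ×ˢ Ioo (-h) h)) :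
    ∀ᵐ t ∂volume.restrict (Ioo (-h) h), IntegrableOn (fun s => F (s, t)) (Ioo (-h) h) := by
  have hprod : (volume : Measure (ℝ × ℝ)).restrict (Ioo (-h) h ×ˢ Ioo (-h) h) =
      (volume.restrict (Ioo (-h) h)).prod (volume.restrict (Ioo (-h) h)) := by
    rw [Measure.prod_restrict]; rfl
  rw [IntegrableOn, hprod] at hF
  exact hF.prod_left_ae

theorem ae_slice {h : ℝ} {p : ℝ × ℝ → Prop}
    (hp : ∀ᵐ x ∂volume.restrict (Ioo (-h) h ×ˢ Ioo (-h) h), p x) :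
    ∀ᵐ t ∂volume.restrict (Ioo (-h) h), ∀ᵐ s ∂volume.restrict (Ioo (-h) h), p (s, t) := by
  have hprod : (volume : Measure (ℝ × ℝ)).restrict (Ioo (-h) h ×ˢ Ioo (-h) h) =
      (volume.restrict (Ioo (-h) h)).prod (volume.restrict (Ioo (-h) h)) := by
    rw [Measure.prod_restrict]; rfl
  rw [hprod] at hp
  exact Measure.ae_ae_of_ae_prod (Measure.measurePreserving_swap.quasiMeasurePreserving.ae hp)

theorem integrableOn_mul_tests {h : ℝ} {F : ℝ × ℝ → ℝ} {a b : ℝ → ℝ}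
    (hF : IntegrableOn F (Ioo (-h) h ×ˢ Ioo (-h) h)) (ha : Continuous a) (hb : Continuous b) :
    IntegrableOn (fun p => F p * (a p.1 * b p.2)) (Ioo (-h) h ×ˢ Ioo (-h) h) := by
  have hc : Continuous fun p : ℝ × ℝ => a p.1 * b p.2 := by fun_prop
  obtain ⟨C, hC⟩ := (isCompact_Icc.prod isCompact_Icc :
    IsCompact (Icc (-h) h ×ˢ Icc (-h) h)).exists_bound_of_continuousOn hc.continuousOn
  refine Integrable.mul_bdd (c := C) hF hc.aestronglyMeasurable ?_
  filter_upwards [ae_restrict_mem (measurableSet_Ioo.prod measurableSet_Ioo)] with p hp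
  exact hC p ⟨Ioo_subset_Icc_self hp.1, Ioo_subset_Icc_self hp.2⟩

/-- A function on a square with an integrable weak derivative in the first variable is absolutely
continuous on almost every line. -/
theorem exists_slice_representation {h : ℝ} (hh : 0 < h) {U G : ℝ × ℝ → ℝ}
    (hU : IntegrableOn U (Ioo (-h) h ×ˢ Ioo (-h) h))
    (hG : IntegrableOn G (Ioo (-h) h ×ˢ Ioo (-h) h))
    (H : ∀ a b, IsIntervalTest h a → IsIntervalTest h b →
      ∫ p in Ioo (-h) h ×ˢ Ioo (-h) h, U p * (deriv a p.1 * b p.2) =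
        -∫ p in Ioo (-h) h ×ˢ Ioo (-h) h, G p * (a p.1 * b p.2)) :
    ∃ V : ℝ → ℝ, ∀ᵐ p ∂volume.restrict (Ioo (-h) h ×ˢ Ioo (-h) h),
      U p = V p.2 + ∫ r in (-h)..p.1, G (r, p.2) := by
  have hprod : (volume : Measure (ℝ × ℝ)).restrict (Ioo (-h) h ×ˢ Ioo (-h) h) =
      (volume.restrict (Ioo (-h) h)).prod (volume.restrict (Ioo (-h) h)) := by
    rw [Measure.prod_restrict]; rfl
  set Gp : ℝ × ℝ → ℝ := fun p => ∫ r in (-h)..p.1, G (r, p.2) with hGp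
  have hGpi : IntegrableOn Gp (Ioo (-h) h ×ˢ Ioo (-h) h) := integrable_primitive hG
  set Z : ℝ × ℝ → ℝ := fun p => U p - Gp p with hZ
  have hZi : IntegrableOn Z (Ioo (-h) h ×ˢ Ioo (-h) h) := hU.sub hGpi
  have hd : ∀ {a}, IsIntervalTest h a → Continuous (deriv a) := fun ha =>
    ha.contDiff.continuous_deriv (by simp)
  -- The primitive `Gp` has weak derivative G, by the product rule on lines; hence Z = U − Gp has
  -- weak derivative zero in the first variable, and it remains to see that Z depends on t only.
  have hZ0 : ∀ a b, IsIntervalTest h a → IsIntervalTest h b →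
      ∫ p in Ioo (-h) h ×ˢ Ioo (-h) h, Z p * (deriv a p.1 * b p.2) = 0 := by
    intro a b ha hb
    have e1 : ∫ p in Ioo (-h) h ×ˢ Ioo (-h) h, Gp p * (deriv a p.1 * b p.2) =
        -∫ p in Ioo (-h) h ×ˢ Ioo (-h) h, G p * (a p.1 * b p.2) := by
      rw [setIntegral_square (integrableOn_mul_tests hGpi (hd ha) hb.contDiff.continuous),
        setIntegral_square (integrableOn_mul_tests hG ha.contDiff.continuous
          hb.contDiff.continuous), ← integral_neg]
      refine integral_congr_ae ?_
      filter_upwards [IntegrableOn.slice_ae hG] with t ht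
      have hA : HasACDeriv h a (deriv a) := HasACDeriv.of_hasDerivAt
        (fun s => (ha.contDiff.differentiable (by simp) s).hasDerivAt) (hd ha)
      have hB := HasACDeriv.of_integrableOn ht 0
      have := (hA.mul hh hB).integral_eq hh
      rw [ha.eq_zero (s := h) (by simp), ha.eq_zero (s := -h) (by simp)] at this
      have i1 : IntegrableOn (fun s => G (s, t) * a s) (Ioo (-h) h) := ha.integrable_mul ht
      have i2 := (hA.mul hh hB).integrableOn.sub i1
      rw [← sub_eq_zero, sub_neg_eq_add]
      have e2 : ∫ s in Ioo (-h) h, Gp (s, t) * (deriv a s * b t) =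
          (∫ s in Ioo (-h) h, deriv a s * (0 + ∫ r in (-h)..s, G (r, t))) * b t := by
        rw [← integral_mul_const]
        congr 1; ext s; simp [hGp]; ring
      have e3 : ∫ s in Ioo (-h) h, G (s, t) * (a s * b t) =
          (∫ s in Ioo (-h) h, a s * G (s, t)) * b t := by
        rw [← integral_mul_const]
        congr 1; ext s; ring
      rw [integral_add (i2.congr (ae_of_all _ fun s => by simp; ring))
        (i1.congr (ae_of_all _ fun s => mul_comm _ _))] at this
      rw [e2, e3, ← add_mul, this]
      simp
    have e4 : ∀ p : ℝ × ℝ, Z p * (deriv a p.1 * b p.2) =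
        U p * (deriv a p.1 * b p.2) - Gp p * (deriv a p.1 * b p.2) := fun p => by
      simp only [hZ]; ring
    simp only [e4]
    rw [integral_sub (integrableOn_mul_tests hU (hd ha) hb.contDiff.continuous)
      (integrableOn_mul_tests hGpi (hd ha) hb.contDiff.continuous), H a b ha hb, e1, sub_self]
  -- The mean of Z over s is the only possible value of a function of t equal to Z.
  set V : ℝ → ℝ := fun t => (2 * h)⁻¹ * ∫ s in Ioo (-h) h, Z (s, t) with hV
  refine ⟨V, ?_⟩
  have hZi' : Integrable Z ((volume.restrict (Ioo (-h) h)).prod (volume.restrict (Ioo (-h) h))) := by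
    rwa [← hprod]
  have hVi : IntegrableOn V (Ioo (-h) h) := hZi'.integral_prod_right.const_mul _
  have hVp : Integrable (fun p : ℝ × ℝ => V p.2)
      ((volume.restrict (Ioo (-h) h)).prod (volume.restrict (Ioo (-h) h))) :=
    Integrable.comp_snd hVi _
  have hDi : Integrable (fun p : ℝ × ℝ => Z p - V p.2)
      ((volume.restrict (Ioo (-h) h)).prod (volume.restrict (Ioo (-h) h))) := hZi'.sub hVp
  -- By du Bois-Reymond, s ↦ ∫ Z(s, t) b(t) dt is almost everywhere a constant, and averaging over s
  -- identifies it as ∫ V b.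
  have hbb : ∀ b, IsIntervalTest h b → ∀ᵐ s ∂volume.restrict (Ioo (-h) h),
      ∫ t in Ioo (-h) h, (Z (s, t) - V t) * b t = 0 := by
    intro b hb
    have hZb : Integrable (fun p : ℝ × ℝ => Z p * b p.2)
        ((volume.restrict (Ioo (-h) h)).prod (volume.restrict (Ioo (-h) h))) := by
      have := integrableOn_mul_tests hZi continuous_one hb.contDiff.continuous
      rw [IntegrableOn, hprod] at this
      simpa using this
    obtain ⟨k, hk⟩ := exists_ae_eq_const_of_integral_deriv_eq_zero hh
      (v := fun s => ∫ t in Ioo (-h) h, Z (s, t) * b t) hZb.integral_prod_left (by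
        intro a ha
        have := hZ0 a b ha hb
        have hi := integrableOn_mul_tests hZi (hd ha) hb.contDiff.continuous
        rw [IntegrableOn, hprod] at hi
        rw [hprod, integral_prod _ hi] at this
        rw [← this]
        congr 1; ext s
        rw [← integral_mul_const]
        congr 1; ext t; ring)
    have hVb : ∫ t in Ioo (-h) h, V t * b t = k := by
      have e1 : ∫ t in Ioo (-h) h, V t * b t =
          (2 * h)⁻¹ * ∫ t in Ioo (-h) h, ∫ s in Ioo (-h) h, Z (s, t) * b t := by
        rw [← integral_const_mul]
        congr 1; ext t
        rw [integral_mul_const]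
        simp only [hV]; ring
      rw [e1, ← integral_prod_symm _ hZb, integral_prod _ hZb, integral_congr_ae hk]
      simp
      rw [max_eq_left (by linarith)]
      field_simp
      ring
    filter_upwards [hk, hZi'.prod_right_ae] with s hs hsi
    simp only [sub_mul]
    rw [integral_sub (hb.integrable_mul hsi) (hb.integrable_mul hVi), hs, hVb, sub_self]
  have hz : ∀ᵐ p ∂((volume.restrict (Ioo (-h) h)).prod (volume.restrict (Ioo (-h) h))),
      Z p - V p.2 = 0 := by
    -- The null set of s in `hbb` depends on b. Integrating over s ∈ A first removes it, after which
    -- the fundamental lemma applies in t.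
    refine ae_eq_zero_of_setIntegral_prod_eq_zero hDi fun A B hA hB => ?_
    have hA0 : ∀ᵐ t ∂volume.restrict (Ioo (-h) h),
        ∫ s in A, (Z (s, t) - V t) ∂volume.restrict (Ioo (-h) h) = 0 := by
      have hDA : Integrable (fun p : ℝ × ℝ => Z p - V p.2)
          (((volume.restrict (Ioo (-h) h)).restrict A).prod (volume.restrict (Ioo (-h) h))) := by
        have := hDi.integrableOn (s := A ×ˢ univ)
        rwa [IntegrableOn, ← Measure.prod_restrict, Measure.restrict_univ] at this
      refine ae_eq_zero_of_integral_isIntervalTest hh hDA.integral_prod_right fun b hb => ?_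
      have hDb : Integrable (fun p : ℝ × ℝ => (Z p - V p.2) * b p.2)
          (((volume.restrict (Ioo (-h) h)).restrict A).prod (volume.restrict (Ioo (-h) h))) := by
        obtain ⟨C, hC⟩ := hb.tsupport_subset.2.exists_bound_of_continuous hb.contDiff.continuous
        exact hDA.mul_bdd (c := C)
          (hb.contDiff.continuous.comp continuous_snd).aestronglyMeasurable
          (ae_of_all _ fun p => hC p.2)
      simp only [← integral_mul_const]
      rw [← integral_prod_symm _ hDb, integral_prod _ hDb]
      rw [integral_congr_ae (ae_restrict_of_ae (hbb b hb))]
      simp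
    have hDAB : Integrable (fun p : ℝ × ℝ => Z p - V p.2)
        (((volume.restrict (Ioo (-h) h)).restrict A).prod
          ((volume.restrict (Ioo (-h) h)).restrict B)) := by
      have := hDi.integrableOn (s := A ×ˢ B)
      rwa [IntegrableOn, ← Measure.prod_restrict] at this
    rw [← Measure.prod_restrict, integral_prod_symm _ hDAB,
      integral_congr_ae (ae_restrict_of_ae hA0)]
    simp
  rw [hprod]
  filter_upwards [hz] with p hp
  simp only [hZ] at hp
  change U p = V p.2 + Gp p
  linarith

end SliceLemma

/-! ### Calculus of weak partial derivatives. -/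

section WeakPartial

open Set

variable {U V : Set (Fin 2 → ℝ)} {i j : Fin 2} {u u' g g' : (Fin 2 → ℝ) → ℝ}

theorem IsTestFunction.mono {φ : (Fin 2 → ℝ) → ℝ} (hφ : IsTestFunction U φ) (h : U ⊆ V) :
    IsTestFunction V φ := ⟨hφ.1, hφ.2.1, hφ.2.2.trans h⟩

theorem IsTestFunction.eq_zero {φ : (Fin 2 → ℝ) → ℝ} (hφ : IsTestFunction U φ) {x : Fin 2 → ℝ}
    (hx : x ∉ U) : φ x = 0 :=
  image_eq_zero_of_notMem_tsupport fun hm => hx (hφ.2.2 hm)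

theorem IsTestFunction.partial {φ : (Fin 2 → ℝ) → ℝ} (hφ : IsTestFunction U φ) (v : Fin 2 → ℝ) :
    IsTestFunction U (fun x => fderiv ℝ φ x v) := by
  refine ⟨?_, hφ.2.1.fderiv_apply ℝ v, (tsupport_fderiv_apply_subset ℝ v).trans hφ.2.2⟩
  exact (hφ.1.fderiv_right (m := ∞) (by simp)).clm_apply contDiff_const

theorem IsTestFunction.smooth_mul {φ η : (Fin 2 → ℝ) → ℝ} (hφ : IsTestFunction U φ)
    (hη : ContDiff ℝ ∞ η) : IsTestFunction U (fun x => η x * φ x) :=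
  ⟨hη.mul hφ.1, hφ.2.1.mul_left, (tsupport_mul_subset_right (f := η)).trans hφ.2.2⟩

theorem MeasureTheory.LocallyIntegrableOn.integrable_mul_test {φ : (Fin 2 → ℝ) → ℝ}
    (hu : LocallyIntegrableOn u U) (hφ : IsTestFunction U φ) :
    IntegrableOn (fun x => u x * φ x) U := by
  have h1 : IntegrableOn u (tsupport φ) := hu.integrableOn_compact_subset hφ.2.2 hφ.2.1
  have h2 : IntegrableOn (fun x => u x * φ x) (tsupport φ) :=
    h1.mul_continuousOn hφ.1.continuous.continuousOn hφ.2.1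
  have h3 : Integrable (fun x => u x * φ x) := by
    rw [← integrableOn_univ]
    refine h2.of_forall_sdiff_eq_zero MeasurableSet.univ fun x hx => ?_
    rw [image_eq_zero_of_notMem_tsupport hx.2, mul_zero]
  exact h3.integrableOn

theorem setIntegral_mul_test_of_subset {φ : (Fin 2 → ℝ) → ℝ} (h : U ⊆ V)
    (hφ : IsTestFunction U φ) (u : (Fin 2 → ℝ) → ℝ) :
    ∫ x in V, u x * φ x = ∫ x in U, u x * φ x := by
  rw [setIntegral_eq_integral_of_forall_compl_eq_zero,
    setIntegral_eq_integral_of_forall_compl_eq_zero]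
  · intro x hx; rw [hφ.eq_zero hx, mul_zero]
  · intro x hx; rw [hφ.eq_zero fun hm => hx (h hm), mul_zero]

theorem HasWeakPartial.mono (hV : HasWeakPartial V i u g) (h : U ⊆ V) :
    HasWeakPartial U i u g := by
  refine ⟨hV.1.mono_set h, hV.2.1.mono_set h, fun φ hφ => ?_⟩
  have := hV.2.2 φ (hφ.mono h)
  rwa [setIntegral_mul_test_of_subset h (hφ.partial _),
    setIntegral_mul_test_of_subset h hφ] at this

theorem MeasureTheory.LocallyIntegrableOn.congr_ae_restrict (hU : IsOpen U) (hu : LocallyIntegrableOn u U)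
    (h : u =ᵐ[volume.restrict U] u') : LocallyIntegrableOn u' U := by
  rw [locallyIntegrableOn_iff hU.isLocallyClosed] at hu ⊢
  intro k hk hc
  exact (hu k hk hc).congr (ae_restrict_of_ae_restrict_of_subset hk h)

theorem HasWeakPartial.congr (hU : IsOpen U) (hw : HasWeakPartial U i u g)
    (h : u =ᵐ[volume.restrict U] u') (h' : g =ᵐ[volume.restrict U] g') :
    HasWeakPartial U i u' g' := by
  refine ⟨LocallyIntegrableOn.congr_ae_restrict hU hw.1 h,
    LocallyIntegrableOn.congr_ae_restrict hU hw.2.1 h', fun φ hφ => ?_⟩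
  have e1 : ∫ x in U, u' x * fderiv ℝ φ x (Pi.single i 1) =
      ∫ x in U, u x * fderiv ℝ φ x (Pi.single i 1) := by
    refine integral_congr_ae ?_
    filter_upwards [h] with x hx
    rw [hx]
  have e2 : ∫ x in U, g' x * φ x = ∫ x in U, g x * φ x := by
    refine integral_congr_ae ?_
    filter_upwards [h'] with x hx
    rw [hx]
  rw [e1, e2, hw.2.2 φ hφ]

theorem HasWeakPartial.unique (hU : IsOpen U) (hg : HasWeakPartial U i u g)
    (hg' : HasWeakPartial U i u g') : g =ᵐ[volume.restrict U] g' := by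
  have hz : ∀ᵐ x, x ∈ U → g x - g' x = 0 := by
    refine hU.ae_eq_zero_of_integral_contDiff_smul_eq_zero (hg.2.1.sub hg'.2.1) ?_
    intro φ h1 h2 h3
    have hφ : IsTestFunction U φ := ⟨h1, h2, h3⟩
    have e := (hg.2.2 φ hφ).symm.trans (hg'.2.2 φ hφ)
    rw [neg_inj] at e
    rw [← setIntegral_eq_integral_of_forall_compl_eq_zero (s := U)]
    · have e1 : ∀ x, φ x • (g x - g' x) = g x * φ x - g' x * φ x := fun x => by
        simp only [smul_eq_mul]; ring
      simp only [e1]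
      rw [integral_sub (LocallyIntegrableOn.integrable_mul_test hg.2.1 hφ)
        (LocallyIntegrableOn.integrable_mul_test hg'.2.1 hφ), e, sub_self]
    · intro x hx; rw [hφ.eq_zero hx, zero_smul]
  filter_upwards [(ae_restrict_iff' hU.measurableSet).2 hz] with x hx using by linarith

theorem HasWeakPartial.sub (h : HasWeakPartial U i u g)
    (h' : HasWeakPartial U i u' g') : HasWeakPartial U i (u - u') (g - g') := by
  refine ⟨h.1.sub h'.1, h.2.1.sub h'.2.1, fun φ hφ => ?_⟩
  simp only [Pi.sub_apply, sub_mul]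
  rw [integral_sub (LocallyIntegrableOn.integrable_mul_test h.1 (hφ.partial _))
    (LocallyIntegrableOn.integrable_mul_test h'.1 (hφ.partial _)),
    integral_sub (LocallyIntegrableOn.integrable_mul_test h.2.1 hφ)
    (LocallyIntegrableOn.integrable_mul_test h'.2.1 hφ), h.2.2 φ hφ, h'.2.2 φ hφ]
  ring

theorem hasWeakPartial_of_contDiff (hu : ContDiff ℝ ∞ u) (i : Fin 2) :
    HasWeakPartial U i u (fun x => fderiv ℝ u x (Pi.single i 1)) := by
  have hd : ContDiff ℝ ∞ fun x => fderiv ℝ u x (Pi.single i 1) :=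
    (hu.fderiv_right (m := ∞) (by simp)).clm_apply contDiff_const
  refine ⟨hu.continuous.locallyIntegrable.locallyIntegrableOn _,
    hd.continuous.locallyIntegrable.locallyIntegrableOn _, fun φ hφ => ?_⟩
  rw [setIntegral_eq_integral_of_forall_compl_eq_zero,
    setIntegral_eq_integral_of_forall_compl_eq_zero]
  · have hI : ∀ {f ψ : (Fin 2 → ℝ) → ℝ}, ContDiff ℝ ∞ f → IsTestFunction U ψ →
        Integrable (fun x => f x * ψ x) := fun hf hψ =>
      (hψ.smooth_mul hf).1.continuous.integrable_of_hasCompactSupport (hψ.smooth_mul hf).2.1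
    exact integral_mul_fderiv_eq_neg_fderiv_mul_of_integrable (hI hd hφ)
      (hI hu (hφ.partial _)) (hI hu hφ) (fun x _ => hu.differentiable (by simp) x)
      (fun x _ => hφ.1.differentiable (by simp) x)
  · intro x hx; rw [hφ.eq_zero hx, mul_zero]
  · intro x hx; rw [(hφ.partial _).eq_zero hx, mul_zero]

theorem hasWeakPartial_weakPartial (h : HasWeakPartial U i u g) :
    HasWeakPartial U i u (weakPartial U i u) := by
  have hex : ∃ g, HasWeakPartial U i u g := ⟨g, h⟩
  rw [weakPartial, dif_pos hex]
  exact hex.choose_spec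

/-- The chosen inner derivative agrees with g only almost everywhere; this suffices to transfer its
outer derivative. It allows the chosen broken Hessians to be computed from explicit ones. -/
theorem weakDeriv_pair_ae_eq (hU : IsOpen U) {k : (Fin 2 → ℝ) → ℝ} (h : HasWeakPartial U j u g)
    (h' : HasWeakPartial U i g k) : weakDeriv U [i, j] u =ᵐ[volume.restrict U] k := by
  have h1 := hasWeakPartial_weakPartial h
  have h2 : HasWeakPartial U i (weakPartial U j u) k :=
    h'.congr hU (h.unique hU h1) (ae_eq_refl _)
  exact (hasWeakPartial_weakPartial h2).unique hU h2

theorem fderiv_fderiv_comm {φ : (Fin 2 → ℝ) → ℝ} (hφ : ContDiff ℝ ∞ φ) (v w x : Fin 2 → ℝ) :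
    fderiv ℝ (fun y => fderiv ℝ φ y v) x w = fderiv ℝ (fun y => fderiv ℝ φ y w) x v := by
  have hd : DifferentiableAt ℝ (fderiv ℝ φ) x :=
    (hφ.fderiv_right (m := ∞) (by simp)).differentiable (by simp) x
  have e : ∀ v w, fderiv ℝ (fun y => fderiv ℝ φ y v) x w = fderiv ℝ (fderiv ℝ φ) x w v := by
    intro v w
    rw [fderiv_clm_apply hd (differentiableAt_const v)]
    simp
  rw [e, e]
  exact (hφ.contDiffAt.isSymmSndFDerivAt (by simp; exact WithTop.coe_le_coe.2 (le_top : (2 : ℕ∞) ≤ ⊤))).eq w v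

/-- Derivatives of test functions commute, so one order of the mixed weak derivative provides the
other. -/
theorem HasWeakPartial.symm_mixed {a b k : (Fin 2 → ℝ) → ℝ}
    (h1 : HasWeakPartial U i u a) (h2 : HasWeakPartial U j a k) (h3 : HasWeakPartial U j u b)
    (hb : LocallyIntegrableOn b U) : HasWeakPartial U i b k := by
  refine ⟨hb, h2.2.1, fun φ hφ => ?_⟩
  have e1 := h3.2.2 _ (hφ.partial (Pi.single i 1))
  have e2 := h1.2.2 _ (hφ.partial (Pi.single j 1))
  have e3 := h2.2.2 φ hφ
  simp only [fderiv_fderiv_comm hφ.1 (Pi.single i 1) (Pi.single j 1)] at e1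
  linarith

end WeakPartial

/-! ### Local coordinates on a cell. -/

section Cell

open Set

/-- The point of the plane with offsets `p.1` in direction `i` and `p.2` in the other direction
from `c`. -/
def cellPoint (c : Fin 2 → ℝ) (i : Fin 2) (p : ℝ × ℝ) : Fin 2 → ℝ :=
  fun k => if k = i then c k + p.1 else c k + p.2

variable {h : ℝ} {c : Fin 2 → ℝ} {i j : Fin 2}

theorem cellPoint_swap (hij : i ≠ j) (p : ℝ × ℝ) :
    cellPoint c j p.swap = cellPoint c i p := by
  ext k; fin_cases i <;> fin_cases j <;> fin_cases k <;> simp_all [cellPoint]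

theorem cellPoint_self (p : ℝ × ℝ) : cellPoint c i p i = c i + p.1 := by simp [cellPoint]

theorem cellPoint_other (hij : i ≠ j) (p : ℝ × ℝ) : cellPoint c i p j = c j + p.2 := by
  simp [cellPoint, hij.symm]

theorem forall_fin_two_iff_of_ne (hij : i ≠ j) {P : Fin 2 → Prop} :
    (∀ k, P k) ↔ P i ∧ P j := by
  rw [Fin.forall_fin_two]
  fin_cases i <;> fin_cases j <;> simp_all [and_comm]

theorem exists_other (i : Fin 2) : ∃ j, i ≠ j := by
  fin_cases i
  · exact ⟨1, by simp⟩
  · exact ⟨0, by simp⟩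

theorem cell_eq_pi (h : ℝ) (c : Fin 2 → ℝ) :
    cell h c = univ.pi fun i => Icc (c i - h) (c i + h) := by
  ext x
  simp only [cell, mem_ofPred_eq, Set.mem_pi, mem_univ, true_imp_iff, mem_Icc]

theorem interior_cell (h : ℝ) (c : Fin 2 → ℝ) :
    interior (cell h c) = univ.pi fun i => Ioo (c i - h) (c i + h) := by
  rw [cell_eq_pi, interior_pi_set finite_univ]
  simp

theorem mem_interior_cell {x : Fin 2 → ℝ} :
    x ∈ interior (cell h c) ↔ ∀ i, c i - h < x i ∧ x i < c i + h := by
  rw [interior_cell]; simp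

theorem interior_cell_ae_eq (h : ℝ) (c : Fin 2 → ℝ) :
    (interior (cell h c) : Set (Fin 2 → ℝ)) =ᵐ[volume] cell h c := by
  rw [interior_cell, cell_eq_pi, pi_univ_Icc]
  exact Measure.univ_pi_Ioo_ae_eq_Icc

theorem isCompact_cell (h : ℝ) (c : Fin 2 → ℝ) : IsCompact (cell h c) := by
  rw [cell_eq_pi]; exact isCompact_univ_pi fun _ => isCompact_Icc

theorem volume_interior_cell (hh : 0 < h) (c : Fin 2 → ℝ) :
    volume (interior (cell h c)) = ENNReal.ofReal (4 * h ^ 2) := by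
  rw [interior_cell, Real.volume_pi_Ioo, Fin.prod_univ_two, ← ENNReal.ofReal_mul (by linarith)]
  congr 1; ring

theorem measurePreserving_cellPoint (c : Fin 2 → ℝ) (i : Fin 2) :
    MeasurePreserving (cellPoint c i) ∧ MeasurableEmbedding (cellPoint c i) := by
  have key : ∀ e : (ℝ × ℝ) ≃ᵐ (ℝ × ℝ), MeasurePreserving e →
      MeasurePreserving (fun p => c + MeasurableEquiv.finTwoArrow.symm (e p)) ∧
      MeasurableEmbedding (fun p => c + MeasurableEquiv.finTwoArrow.symm (e p)) := by
    intro e he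
    constructor
    · exact (measurePreserving_add_left volume c).comp
        (((volume_preserving_finTwoArrow ℝ).symm _).comp he)
    · exact ((e.trans MeasurableEquiv.finTwoArrow.symm).trans
        (MeasurableEquiv.addLeft c)).measurableEmbedding
  fin_cases i
  · have e : cellPoint c 0 = fun p => c + MeasurableEquiv.finTwoArrow.symm
        (MeasurableEquiv.refl (ℝ × ℝ) p) := by
      ext p k
      fin_cases k <;> simp [cellPoint, MeasurableEquiv.finTwoArrow]
    exact e ▸ key _ (MeasurePreserving.id _)
  · have e : cellPoint c 1 = fun p => c + MeasurableEquiv.finTwoArrow.symm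
        (MeasurableEquiv.prodComm p) := by
      ext p k
      fin_cases k <;> simp [cellPoint, MeasurableEquiv.finTwoArrow] <;> rfl
    exact e ▸ key _ Measure.measurePreserving_swap

theorem preimage_cellPoint (h : ℝ) (c : Fin 2 → ℝ) (i : Fin 2) :
    cellPoint c i ⁻¹' interior (cell h c) = Ioo (-h) h ×ˢ Ioo (-h) h := by
  obtain ⟨j, hij⟩ := exists_other i
  ext p
  rw [mem_preimage, mem_interior_cell, forall_fin_two_iff_of_ne hij, cellPoint_self,
    cellPoint_other hij]
  simp only [mem_prod, mem_Ioo]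
  constructor
  · rintro ⟨⟨_, _⟩, _, _⟩; refine ⟨⟨?_, ?_⟩, ?_, ?_⟩ <;> linarith
  · rintro ⟨⟨_, _⟩, _, _⟩; refine ⟨⟨?_, ?_⟩, ?_, ?_⟩ <;> linarith

theorem setIntegral_interior_cell (F : (Fin 2 → ℝ) → ℝ) (i : Fin 2) :
    ∫ x in interior (cell h c), F x =
      ∫ p in Ioo (-h) h ×ˢ Ioo (-h) h, F (cellPoint c i p) := by
  obtain ⟨h1, h2⟩ := measurePreserving_cellPoint c i
  rw [← preimage_cellPoint h c i, h1.setIntegral_preimage_emb h2]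

theorem measurePreserving_cellPoint_restrict (h : ℝ) (c : Fin 2 → ℝ) (i : Fin 2) :
    MeasurePreserving (cellPoint c i) (volume.restrict (Ioo (-h) h ×ˢ Ioo (-h) h))
      (volume.restrict (interior (cell h c))) := by
  rw [← preimage_cellPoint h c i]
  exact (measurePreserving_cellPoint c i).1.restrict_preimage_emb
    (measurePreserving_cellPoint c i).2 _

theorem MeasureTheory.IntegrableOn.comp_cellPoint {F : (Fin 2 → ℝ) → ℝ}
    (hF : IntegrableOn F (interior (cell h c))) (i : Fin 2) :
    IntegrableOn (fun p => F (cellPoint c i p)) (Ioo (-h) h ×ˢ Ioo (-h) h) :=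
  (measurePreserving_cellPoint_restrict h c i).integrable_comp_of_integrable hF

theorem ae_interior_cell_iff {P : (Fin 2 → ℝ) → Prop} (i : Fin 2) :
    (∀ᵐ x ∂volume.restrict (interior (cell h c)), P x) ↔
      ∀ᵐ p ∂volume.restrict (Ioo (-h) h ×ˢ Ioo (-h) h), P (cellPoint c i p) := by
  rw [← (measurePreserving_cellPoint_restrict h c i).map_eq,
    (measurePreserving_cellPoint c i).2.ae_map_iff]

theorem hasDerivAt_comp_cellPoint {η : (Fin 2 → ℝ) → ℝ} (i : Fin 2) {s t : ℝ}
    (hη : DifferentiableAt ℝ η (cellPoint c i (s, t))) :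
    HasDerivAt (fun s => η (cellPoint c i (s, t)))
      (fderiv ℝ η (cellPoint c i (s, t)) (Pi.single i 1)) s := by
  refine hη.hasFDerivAt.comp_hasDerivAt s ?_
  rw [hasDerivAt_pi]
  intro k
  by_cases hk : k = i
  · subst hk; simpa [cellPoint] using (hasDerivAt_id s).const_add (c k)
  · simpa [cellPoint, hk] using hasDerivAt_const s (c k + t)

theorem continuous_cellPoint : Continuous (cellPoint c i) := by
  refine continuous_pi fun k => ?_
  by_cases hk : k = i <;> simp only [cellPoint, hk, if_true, if_false] <;> fun_prop

theorem isTestFunction_mul (hij : i ≠ j) {a b : ℝ → ℝ} (ha : IsIntervalTest h a)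
    (hb : IsIntervalTest h b) :
    IsTestFunction (interior (cell h c)) (fun x => a (x i - c i) * b (x j - c j)) := by
  obtain ⟨M, hM, hz⟩ := ha.bound
  obtain ⟨M', hM', hz'⟩ := hb.bound
  have hsub : Function.support (fun x : Fin 2 → ℝ => a (x i - c i) * b (x j - c j)) ⊆
      cell (max M M') c := by
    intro x hx
    rw [Function.mem_support, mul_ne_zero_iff] at hx
    refine (forall_fin_two_iff_of_ne hij).2 ⟨?_, ?_⟩
    · have : |x i - c i| < M := by
        by_contra hn; exact hx.1 (hz _ (not_lt.1 hn))
      rw [abs_lt] at this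
      constructor <;> linarith [le_max_left M M']
    · have : |x j - c j| < M' := by
        by_contra hn; exact hx.2 (hz' _ (not_lt.1 hn))
      rw [abs_lt] at this
      constructor <;> linarith [le_max_right M M']
  refine ⟨?_, HasCompactSupport.of_support_subset_isCompact (isCompact_cell _ _) hsub,
    (closure_minimal hsub (isCompact_cell _ _).isClosed).trans fun x hx => ?_⟩
  · have := ha.contDiff
    have := hb.contDiff
    fun_prop
  · rw [mem_interior_cell]
    intro k
    have := max_lt hM hM'
    constructor <;> linarith [hx k]

/-- A function with an integrable weak partial derivative on a square is absolutely continuous on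
almost every line in the direction of that derivative. -/
theorem HasWeakPartial.exists_slice_representation (hh : 0 < h) {u g : (Fin 2 → ℝ) → ℝ}
    (hug : HasWeakPartial (interior (cell h c)) i u g)
    (hu : IntegrableOn u (interior (cell h c))) (hg : IntegrableOn g (interior (cell h c))) :
    ∃ V : ℝ → ℝ, ∀ᵐ p ∂volume.restrict (Ioo (-h) h ×ˢ Ioo (-h) h),
      u (cellPoint c i p) = V p.2 + ∫ r in (-h)..p.1, g (cellPoint c i (r, p.2)) := by
  obtain ⟨j, hij⟩ := exists_other i
  refine _root_.exists_slice_representation hh (IntegrableOn.comp_cellPoint hu i)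
    (IntegrableOn.comp_cellPoint hg i) fun a b ha hb => ?_
  have hφ := isTestFunction_mul (c := c) hij ha hb
  have := hug.2.2 _ hφ
  rw [setIntegral_interior_cell _ i, setIntegral_interior_cell _ i] at this
  simp only [cellPoint_self, cellPoint_other hij, add_sub_cancel_left] at this
  rw [← this]
  refine integral_congr_ae (ae_of_all _ fun p => ?_)
  have h1 := (hasDerivAt_comp_cellPoint (c := c) i (s := p.1) (t := p.2)
    (hφ.1.differentiable (by simp) _))
  simp only [cellPoint_self, cellPoint_other hij, add_sub_cancel_left] at h1
  have h2 := ((ha.contDiff.differentiable (by simp) p.1).hasDerivAt).mul_const (b p.2)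
  simp only [h1.unique h2]

end Cell

/-! ### Continuous representatives. -/

section Representative

open Set

/-- For p off the two coordinate lines through q, membership of p in the quadrant is locally
constant in the corner near q. Those lines are null, and |k| dominates. -/
theorem continuous_quadrant_integral {ρ : Measure (ℝ × ℝ)} {k : ℝ × ℝ → ℝ} (hk : Integrable k ρ)
    (h1 : ∀ s, ∀ᵐ p ∂ρ, p.1 ≠ s) (h2 : ∀ t, ∀ᵐ p ∂ρ, p.2 ≠ t) :
    Continuous fun q : ℝ × ℝ => ∫ p, {p : ℝ × ℝ | p.1 ≤ q.1 ∧ p.2 ≤ q.2}.indicator k p ∂ρ := by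
  rw [continuous_iff_continuousAt]
  intro q
  refine continuousAt_of_dominated (bound := fun p => ‖k p‖) (Eventually.of_forall fun q => ?_)
    (Eventually.of_forall fun q => ae_of_all _ fun p => norm_indicator_le_norm_self _ _) hk.norm ?_
  · exact hk.aestronglyMeasurable.indicator
      ((measurableSet_le measurable_fst measurable_const).inter
        (measurableSet_le measurable_snd measurable_const))
  · filter_upwards [h1 q.1, h2 q.2] with p hp1 hp2
    have key : ∀ {f : ℝ × ℝ → ℝ}, Continuous f → ∀ {a : ℝ}, a ≠ f q →
        ∀ᶠ q' in 𝓝 q, (a ≤ f q' ↔ a ≤ f q) := by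
      intro f hf a ha
      rcases lt_or_gt_of_ne ha with hlt | hgt
      · filter_upwards [hf.continuousAt.eventually (lt_mem_nhds hlt)] with q' hq'
        exact ⟨fun _ => hlt.le, fun _ => hq'.le⟩
      · filter_upwards [hf.continuousAt.eventually (gt_mem_nhds hgt)] with q' hq'
        exact ⟨fun h => absurd h (not_le.2 hq'), fun h => absurd h (not_le.2 hgt)⟩
    refine ContinuousAt.congr (f := fun _ => {p : ℝ × ℝ | p.1 ≤ q.1 ∧ p.2 ≤ q.2}.indicator k p)
      continuousAt_const ?_
    filter_upwards [key continuous_fst hp1, key continuous_snd hp2] with q' e1 e2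
    have e : p ∈ {p : ℝ × ℝ | p.1 ≤ q.1 ∧ p.2 ≤ q.2} ↔
        p ∈ {p : ℝ × ℝ | p.1 ≤ q'.1 ∧ p.2 ≤ q'.2} := by
      simp only [mem_ofPred_eq, e1, e2]
    by_cases hm : p ∈ {p : ℝ × ℝ | p.1 ≤ q.1 ∧ p.2 ≤ q.2}
    · rw [indicator_of_mem hm, indicator_of_mem (e.1 hm)]
    · rw [indicator_of_notMem hm, indicator_of_notMem fun h => hm (e.2 h)]

theorem restrict_square (h : ℝ) :
    (volume : Measure (ℝ × ℝ)).restrict (Ioo (-h) h ×ˢ Ioo (-h) h) =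
      (volume.restrict (Ioo (-h) h)).prod (volume.restrict (Ioo (-h) h)) := by
  rw [Measure.prod_restrict]; rfl

theorem ae_fst {h : ℝ} {P : ℝ → Prop} (hP : ∀ᵐ s ∂volume.restrict (Ioo (-h) h), P s) :
    ∀ᵐ p ∂volume.restrict (Ioo (-h) h ×ˢ Ioo (-h) h), P p.1 := by
  rw [restrict_square]; exact Measure.quasiMeasurePreserving_fst.ae hP

theorem ae_snd {h : ℝ} {P : ℝ → Prop} (hP : ∀ᵐ s ∂volume.restrict (Ioo (-h) h), P s) :
    ∀ᵐ p ∂volume.restrict (Ioo (-h) h ×ˢ Ioo (-h) h), P p.2 := by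
  rw [restrict_square]; exact Measure.quasiMeasurePreserving_snd.ae hP

theorem ae_swap_square {h : ℝ} {P : ℝ × ℝ → Prop}
    (hP : ∀ᵐ p ∂volume.restrict (Ioo (-h) h ×ˢ Ioo (-h) h), P p) :
    ∀ᵐ p ∂volume.restrict (Ioo (-h) h ×ˢ Ioo (-h) h), P p.swap := by
  rw [restrict_square] at *
  exact Measure.measurePreserving_swap.quasiMeasurePreserving.ae hP

theorem MeasureTheory.IntegrableOn.swap_square {h : ℝ} {F : ℝ × ℝ → ℝ}
    (hF : IntegrableOn F (Ioo (-h) h ×ˢ Ioo (-h) h)) :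
    IntegrableOn (fun p => F p.swap) (Ioo (-h) h ×ˢ Ioo (-h) h) := by
  rw [IntegrableOn, restrict_square] at *
  exact hF.swap

/-- Extension by zero makes the primitive continuous on all of ℝ, so the representatives built from
it are continuous on the whole plane. -/
theorem continuous_interval_primitive {h : ℝ} {g : ℝ → ℝ} (hg : IntegrableOn g (Ioo (-h) h)) :
    Continuous (fun t => ∫ r in (-h)..t, (Ioo (-h) h).indicator g r) := by
  have : Integrable ((Ioo (-h) h).indicator g) := hg.integrable_indicator measurableSet_Ioo
  exact intervalIntegral.continuous_primitive (fun a b => this.intervalIntegrable) _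

theorem interval_primitive_eq {h : ℝ} {g : ℝ → ℝ} {t : ℝ} (ht : t ∈ Ioo (-h) h) :
    ∫ r in (-h)..t, (Ioo (-h) h).indicator g r = ∫ r in (-h)..t, g r := by
  rw [intervalIntegral.integral_of_le ht.1.le, intervalIntegral.integral_of_le ht.1.le]
  refine setIntegral_congr_fun measurableSet_Ioc fun r hr => ?_
  have hm : r ∈ Ioo (-h) h := ⟨hr.1, hr.2.trans_lt ht.2⟩
  simp only [indicator_of_mem hm]

theorem intervalIntegral_eq_setIntegral_indicator {h : ℝ} {g : ℝ → ℝ} {t : ℝ}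
    (ht : t ∈ Ioo (-h) h) :
    ∫ r in (-h)..t, g r = ∫ r in Ioo (-h) h, (Iic t).indicator g r := by
  rw [integral_indicator measurableSet_Iic, Measure.restrict_restrict measurableSet_Iic,
    intervalIntegral.integral_of_le ht.1.le]
  congr 2
  ext y
  simp only [mem_inter_iff, mem_Iic, mem_Ioo, mem_Ioc]
  constructor
  · rintro ⟨h1, h2⟩; exact ⟨h2, h1, h2.trans_lt ht.2⟩
  · rintro ⟨h1, h2, h3⟩; exact ⟨h2, h1⟩

theorem iterated_integral_eq_quadrant {h : ℝ} {k : ℝ × ℝ → ℝ}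
    (hk : IntegrableOn k (Ioo (-h) h ×ˢ Ioo (-h) h)) {s t : ℝ} (hs : s ∈ Ioo (-h) h)
    (ht : t ∈ Ioo (-h) h) :
    ∫ r in (-h)..s, ∫ q in (-h)..t, k (r, q) =
      ∫ p in Ioo (-h) h ×ˢ Ioo (-h) h, {p : ℝ × ℝ | p.1 ≤ s ∧ p.2 ≤ t}.indicator k p := by
  have hm : MeasurableSet {p : ℝ × ℝ | p.1 ≤ s ∧ p.2 ≤ t} :=
    (measurableSet_le measurable_fst measurable_const).inter
        (measurableSet_le measurable_snd measurable_const)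
  have hi : IntegrableOn ({p : ℝ × ℝ | p.1 ≤ s ∧ p.2 ≤ t}.indicator k)
      (Ioo (-h) h ×ˢ Ioo (-h) h) := Integrable.indicator hk hm
  rw [IntegrableOn, restrict_square] at hi
  rw [restrict_square, integral_prod _ hi, intervalIntegral_eq_setIntegral_indicator hs]
  congr 1; ext r
  by_cases hr : r ≤ s
  · rw [indicator_of_mem (show r ∈ Iic s from hr), intervalIntegral_eq_setIntegral_indicator ht]
    congr 1; ext q
    by_cases hq : q ≤ t <;> simp [indicator, hr, hq]
  · rw [indicator_of_notMem (show r ∉ Iic s from hr)]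
    simp [indicator, hr]

/-- Sobolev embedding on a square: a function whose weak partials of order one and one mixed
second partial are integrable has a continuous representative. -/
theorem exists_continuous_representative {h : ℝ} (hh : 0 < h) {c : Fin 2 → ℝ} {i j : Fin 2}
    (hij : i ≠ j) {u g g' k : (Fin 2 → ℝ) → ℝ}
    (hu : IntegrableOn u (interior (cell h c))) (hg : IntegrableOn g (interior (cell h c)))
    (hg' : IntegrableOn g' (interior (cell h c))) (hk : IntegrableOn k (interior (cell h c)))
    (hug : HasWeakPartial (interior (cell h c)) i u g)
    (hug' : HasWeakPartial (interior (cell h c)) j u g')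
    (hgk : HasWeakPartial (interior (cell h c)) j g k) :
    ∃ f : (Fin 2 → ℝ) → ℝ, Continuous f ∧ f =ᵐ[volume.restrict (interior (cell h c))] u := by
  -- In coordinates (s, t) along (i, j): u is V(t) plus the s-primitive of g, also γ(s) plus the
  -- t-primitive of g', and g is β(s) plus the t-primitive of k. Inserting the third into the first
  -- gives u = V(t) + B(s) + F(s, t).
  obtain ⟨V, hV⟩ := hug.exists_slice_representation hh hu hg
  obtain ⟨γ, hγ⟩ := hug'.exists_slice_representation hh hu hg'
  obtain ⟨β, hβ⟩ := hgk.exists_slice_representation hh hg hk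
  have hγ := ae_swap_square hγ
  have hβ := ae_swap_square hβ
  simp only [cellPoint_swap hij, Prod.fst_swap, Prod.snd_swap] at hγ hβ
  have hsw : ∀ s t, cellPoint c j (t, s) = cellPoint c i (s, t) := fun s t =>
    cellPoint_swap hij (s, t)
  simp only [hsw] at hγ hβ
  set k' : ℝ × ℝ → ℝ := fun p => k (cellPoint c i p) with hk'
  have hk'i : IntegrableOn k' (Ioo (-h) h ×ˢ Ioo (-h) h) := hk.comp_cellPoint i
  have hg2 : IntegrableOn (fun p => g' (cellPoint c i p)) (Ioo (-h) h ×ˢ Ioo (-h) h) :=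
    hg'.comp_cellPoint i
  set F : ℝ × ℝ → ℝ := fun q => ∫ p in Ioo (-h) h ×ˢ Ioo (-h) h,
    {p : ℝ × ℝ | p.1 ≤ q.1 ∧ p.2 ≤ q.2}.indicator k' p with hF
  have hFc : Continuous F := continuous_quadrant_integral hk'i
    (fun s => ae_fst (P := fun r => r ≠ s) (ae_restrict_of_ae (by simp [ae_iff])))
    (fun s => ae_snd (P := fun r => r ≠ s) (ae_restrict_of_ae (by simp [ae_iff])))
  have hkp : IntegrableOn (fun p : ℝ × ℝ => ∫ q in (-h)..p.2, k' (p.1, q))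
      (Ioo (-h) h ×ˢ Ioo (-h) h) := (integrable_primitive hk'i.swap_square).swap_square
  have : NeBot (ae ((volume : Measure ℝ).restrict (Ioo (-h) h))) := by
    rw [ae_neBot, Ne, Measure.restrict_eq_zero]
    simp; linarith
  -- On one generic line t = const, β is a difference of two integrable functions.
  have hβi : IntegrableOn β (Ioo (-h) h) := by
    obtain ⟨t, h1, h2, h3⟩ := ((ae_slice hβ).and ((hg.comp_cellPoint i).slice_ae.and
      hkp.slice_ae)).exists
    refine (h2.sub h3).congr ?_
    filter_upwards [h1] with s hs
    simp only [Pi.sub_apply]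
    rw [hs]; ring
  set B : ℝ → ℝ := fun s => ∫ r in (-h)..s, (Ioo (-h) h).indicator β r with hB
  have hBc : Continuous B := continuous_interval_primitive hβi
  have hprim : ∀ᵐ t ∂volume.restrict (Ioo (-h) h), ∀ s ∈ Ioo (-h) h,
      ∫ r in (-h)..s, g (cellPoint c i (r, t)) = B s + F (s, t) := by
    filter_upwards [ae_slice hβ, hkp.slice_ae, ae_restrict_mem measurableSet_Ioo]
      with t ht hti htI s hs
    have hms : -h ∈ Icc (-h) h := ⟨le_rfl, by linarith⟩
    have hsI := Ioo_subset_Icc_self hs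
    simp only [hB, hF, interval_primitive_eq hs, ← iterated_integral_eq_quadrant hk'i hs htI]
    rw [← intervalIntegral.integral_add (hβi.intervalIntegrable_of_Ioo hms hsI)
      (hti.intervalIntegrable_of_Ioo hms hsI)]
    refine intervalIntegral.integral_congr_ae ?_
    filter_upwards [(ae_restrict_iff' measurableSet_Ioo).1 ht] with r hr hrs
    rw [uIoc_of_le hs.1.le] at hrs
    exact hr ⟨hrs.1, hrs.2.trans_lt hs.2⟩
  -- V is read off on one generic line s = const by equating the two representations of u; every
  -- other term there is continuous in t.
  have hVe : ∃ V' : ℝ → ℝ, Continuous V' ∧ ∀ᵐ t ∂volume.restrict (Ioo (-h) h), V t = V' t := by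
    have hγ' := ae_slice (ae_swap_square hγ)
    have hV' := ae_slice (ae_swap_square hV)
    obtain ⟨s, h1, h2, h3, hs⟩ := (hγ'.and (hV'.and (hg2.swap_square.slice_ae.and
      (ae_restrict_mem measurableSet_Ioo)))).exists
    refine ⟨fun t => γ s + (∫ q in (-h)..t, (Ioo (-h) h).indicator
      (fun q => g' (cellPoint c i (s, q))) q) - (B s + F (s, t)), ?_, ?_⟩
    · have := continuous_interval_primitive h3
      simp only [Prod.swap_prod_mk] at this
      fun_prop
    · filter_upwards [h1, h2, hprim, ae_restrict_mem measurableSet_Ioo] with t e1 e2 e3 ht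
      simp only [Prod.swap_prod_mk] at e1 e2
      rw [interval_primitive_eq ht, ← e3 s hs]
      linarith
  obtain ⟨V', hV'c, hVV'⟩ := hVe
  refine ⟨fun x => V' (x j - c j) + (B (x i - c i) + F (x i - c i, x j - c j)), by fun_prop, ?_⟩
  refine (ae_interior_cell_iff i).2 ?_
  filter_upwards [hV, ae_snd hprim, ae_snd hVV',
    ae_restrict_mem (measurableSet_Ioo.prod measurableSet_Ioo)] with p e1 e2 e3 hp
  simp only [cellPoint_self, cellPoint_other hij, add_sub_cancel_left]
  rw [e1, e2 p.1 hp.1, e3]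

end Representative

/-! ### Differentiability up to the boundary of a cell. -/

section ContinuouslyDifferentiable

open Set

variable {h : ℝ} {c : Fin 2 → ℝ} {i j : Fin 2}

theorem eqOn_Icc_of_ae_Ioo (hh : 0 < h) {f g : ℝ → ℝ}
    (e : ∀ᵐ s ∂volume.restrict (Ioo (-h) h), f s = g s) (hf : ContinuousOn f (Icc (-h) h))
    (hg : ContinuousOn g (Icc (-h) h)) : ∀ s ∈ Icc (-h) h, f s = g s := by
  refine Measure.eqOn_Icc_of_ae_eq (μ := volume) (by linarith) ?_ hf hg
  rw [← restrict_Ioo_eq_restrict_Icc]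
  exact e

theorem HasWeakPartial.ae_exists_hasACDeriv (hh : 0 < h) {u g : (Fin 2 → ℝ) → ℝ}
    (hug : HasWeakPartial (interior (cell h c)) i u g)
    (hu : IntegrableOn u (interior (cell h c))) (hg : IntegrableOn g (interior (cell h c))) :
    ∀ᵐ t ∂volume.restrict (Ioo (-h) h), ∃ W : ℝ → ℝ,
      HasACDeriv h W (fun s => g (cellPoint c i (s, t))) ∧
      ∀ᵐ s ∂volume.restrict (Ioo (-h) h), u (cellPoint c i (s, t)) = W s := by
  obtain ⟨V, hV⟩ := hug.exists_slice_representation hh hu hg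
  filter_upwards [ae_slice hV, (hg.comp_cellPoint i).slice_ae] with t ht hti
  exact ⟨_, HasACDeriv.of_integrableOn hti (V t), ht⟩

theorem HasWeakPartial.ae_hasACDeriv (hh : 0 < h) {u g f : (Fin 2 → ℝ) → ℝ}
    (hug : HasWeakPartial (interior (cell h c)) i u g)
    (hu : IntegrableOn u (interior (cell h c))) (hg : IntegrableOn g (interior (cell h c)))
    (hf : Continuous f) (hfu : f =ᵐ[volume.restrict (interior (cell h c))] u) :
    ∀ᵐ t ∂volume.restrict (Ioo (-h) h),
      HasACDeriv h (fun s => f (cellPoint c i (s, t))) (fun s => g (cellPoint c i (s, t))) := by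
  filter_upwards [hug.ae_exists_hasACDeriv hh hu hg,
    ae_slice ((ae_interior_cell_iff i).1 hfu)] with t ⟨W, hW, e⟩ e'
  refine hW.congr hh ?_ (ae_of_all _ fun _ => rfl)
  refine eqOn_Icc_of_ae_Ioo hh ?_ (hW.continuousOn hh)
    (hf.comp (continuous_cellPoint.comp (by fun_prop : Continuous fun s : ℝ => (s, t)))).continuousOn
  filter_upwards [e, e'] with s h1 h2
  rw [← h1, h2]

/-- Both sides of the fundamental theorem of calculus are continuous in t, so the identity passes
from almost every line to every line, in particular to the edges, where the Morley data live. -/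
theorem hasACDeriv_of_continuous (hh : 0 < h) {f f' : (Fin 2 → ℝ) → ℝ} (hf : Continuous f)
    (hf' : Continuous f')
    (H : ∀ᵐ t ∂volume.restrict (Ioo (-h) h),
      HasACDeriv h (fun s => f (cellPoint c i (s, t))) (fun s => f' (cellPoint c i (s, t)))) :
    ∀ t ∈ Icc (-h) h,
      HasACDeriv h (fun s => f (cellPoint c i (s, t))) (fun s => f' (cellPoint c i (s, t))) := by
  have hc1 : ∀ s, Continuous fun t : ℝ => cellPoint c i (s, t) := fun s =>
    continuous_cellPoint.comp (by fun_prop)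
  have hc2 : ∀ t, Continuous fun s : ℝ => cellPoint c i (s, t) := fun t =>
    continuous_cellPoint.comp (by fun_prop)
  have hc3 : Continuous fun p : ℝ × ℝ => f' (cellPoint c i (p.2, p.1)) :=
    hf'.comp (continuous_cellPoint.comp (by fun_prop))
  intro t ht
  refine ⟨(hf'.comp (hc2 t)).integrableOn_Icc.mono_set Ioo_subset_Icc_self, fun s hs => ?_⟩
  refine eqOn_Icc_of_ae_Ioo hh (f := fun t => f (cellPoint c i (s, t)))
    (g := fun t => f (cellPoint c i (-h, t)) + ∫ r in (-h)..s, f' (cellPoint c i (r, t))) ?_ ?_ ?_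
    t ht
  · filter_upwards [H] with t hH using hH.eq_add s hs
  · exact (hf.comp (hc1 s)).continuousOn
  · exact ((hf.comp (hc1 _)).add
      (intervalIntegral.continuous_parametric_intervalIntegral_of_continuous'
        (f := fun t r => f' (cellPoint c i (r, t))) hc3 _ _)).continuousOn

theorem mem_cell_iff (hij : i ≠ j) {x : Fin 2 → ℝ} :
    x ∈ cell h c ↔ x i - c i ∈ Icc (-h) h ∧ x j - c j ∈ Icc (-h) h := by
  change (∀ k, _ ∧ _) ↔ _
  rw [forall_fin_two_iff_of_ne hij]
  simp only [mem_Icc]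
  constructor
  · rintro ⟨⟨_, _⟩, _, _⟩; refine ⟨⟨?_, ?_⟩, ?_, ?_⟩ <;> linarith
  · rintro ⟨⟨_, _⟩, _, _⟩; refine ⟨⟨?_, ?_⟩, ?_, ?_⟩ <;> linarith

theorem cellPoint_mem_cell {p : ℝ × ℝ} (h1 : p.1 ∈ Icc (-h) h) (h2 : p.2 ∈ Icc (-h) h) :
    cellPoint c i p ∈ cell h c := by
  obtain ⟨j, hij⟩ := exists_other i
  rw [mem_cell_iff hij, cellPoint_self, cellPoint_other hij]
  simpa using ⟨h1, h2⟩

theorem cellPoint_sub (hij : i ≠ j) (x : Fin 2 → ℝ) :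
    cellPoint c i (x i - c i, x j - c j) = x := by
  ext k
  by_cases hk : k = i
  · subst hk; simp [cellPoint]
  · have : k = j := by
      fin_cases i <;> fin_cases j <;> fin_cases k <;> simp_all
    subst this
    simp [cellPoint, hk]

theorem interior_cell_nonempty (hh : 0 < h) (c : Fin 2 → ℝ) : (interior (cell h c)).Nonempty :=
  ⟨c, mem_interior_cell.2 fun i => ⟨by linarith, by linarith⟩⟩

theorem convex_cell (h : ℝ) (c : Fin 2 → ℝ) : Convex ℝ (cell h c) := by
  rw [cell_eq_pi]; exact convex_pi fun _ _ => convex_Icc _ _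

theorem uniqueDiffOn_cell (hh : 0 < h) (c : Fin 2 → ℝ) : UniqueDiffOn ℝ (cell h c) :=
  uniqueDiffOn_convex (convex_cell h c) (interior_cell_nonempty hh c)

theorem HasACDeriv.sub_eq {U g : ℝ → ℝ} (hU : HasACDeriv h U g) {r s : ℝ}
    (hr : r ∈ Icc (-h) h) (hs : s ∈ Icc (-h) h) : U s - U r = ∫ q in r..s, g q := by
  have hm : -h ∈ Icc (-h) h := ⟨le_rfl, hr.1.trans hr.2⟩
  rw [hU.eq_add s hs, hU.eq_add r hr, ← intervalIntegral.integral_interval_sub_left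
    (hU.integrableOn.intervalIntegrable_of_Ioo hm hs)
    (hU.integrableOn.intervalIntegrable_of_Ioo hm hr)]
  ring

/-- A continuous function whose restrictions to lines have continuous derivatives `D i` is
differentiable on the closed square. -/
theorem hasFDerivWithinAt_cell {f : (Fin 2 → ℝ) → ℝ} {D : Fin 2 → (Fin 2 → ℝ) → ℝ}
    (hD : ∀ i, Continuous (D i))
    (H : ∀ i, ∀ t ∈ Icc (-h) h, HasACDeriv h (fun s => f (cellPoint c i (s, t)))
      (fun s => D i (cellPoint c i (s, t)))) {x : Fin 2 → ℝ} (hx : x ∈ cell h c) :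
    HasFDerivWithinAt f (∑ i, D i x • ContinuousLinearMap.proj (R := ℝ) (φ := fun _ : Fin 2 => ℝ) i) (cell h c) x := by
  rw [hasFDerivWithinAt_iff_isLittleO, Asymptotics.isLittleO_iff]
  intro ε hε
  have h01 : (0 : Fin 2) ≠ 1 := by decide
  have hcont : ∀ i, ∃ δ > 0, ∀ y, dist y x < δ → |D i y - D i x| ≤ ε / 2 := by
    intro i
    obtain ⟨δ, hδ, hb⟩ := Metric.continuous_iff.1 (hD i) x (ε / 2) (by positivity)
    exact ⟨δ, hδ, fun y hy => (hb y hy).le⟩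
  obtain ⟨δ₀, hδ₀, hb₀⟩ := hcont 0
  obtain ⟨δ₁, hδ₁, hb₁⟩ := hcont 1
  have key : ∀ i j : Fin 2, i ≠ j → ∀ (δ : ℝ), (∀ y, dist y x < δ → |D i y - D i x| ≤ ε / 2) →
      ∀ y ∈ cell h c, dist y x < δ → ∀ t ∈ Icc (-h) h, |t - (x j - c j)| ≤ ‖y - x‖ →
      |f (cellPoint c i (y i - c i, t)) - f (cellPoint c i (x i - c i, t)) -
        D i x * (y i - x i)| ≤ ε / 2 * ‖y - x‖ := by
    intro i j hij δ hb y hy hyx t ht htx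
    have hx' := (mem_cell_iff hij).1 hx
    have hy' := (mem_cell_iff hij).1 hy
    have hi := norm_le_pi_norm (y - x) i
    rw [Pi.sub_apply, Real.norm_eq_abs] at hi
    have hH := H i t ht
    rw [hH.sub_eq hx'.1 hy'.1]
    have e : D i x * (y i - x i) = ∫ _ in (x i - c i)..(y i - c i), D i x := by
      rw [intervalIntegral.integral_const, smul_eq_mul]; ring
    rw [e, ← intervalIntegral.integral_sub
      (hH.integrableOn.intervalIntegrable_of_Ioo hx'.1 hy'.1) (by simp), ← Real.norm_eq_abs]
    refine (intervalIntegral.norm_integral_le_of_norm_le_const (C := ε / 2) fun q hq => ?_).trans ?_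
    · rw [Real.norm_eq_abs]
      apply hb
      have hq' := uIoc_subset_uIcc hq
      have hqx : |q - (x i - c i)| ≤ ‖y - x‖ := by
        refine le_trans ?_ hi
        have := abs_sub_left_of_mem_uIcc hq'
        rwa [show y i - c i - (x i - c i) = y i - x i by ring] at this
      refine lt_of_le_of_lt ((dist_pi_le_iff (norm_nonneg (y - x))).2 ?_)
        (by rwa [← dist_eq_norm])
      rw [forall_fin_two_iff_of_ne hij, cellPoint_self, cellPoint_other hij, Real.dist_eq,
        Real.dist_eq]
      constructor
      · convert hqx using 2; ring
      · convert htx using 2; ring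
    · rw [show y i - c i - (x i - c i) = y i - x i by ring]
      gcongr
  filter_upwards [self_mem_nhdsWithin, mem_nhdsWithin_of_mem_nhds (Metric.ball_mem_nhds x hδ₀),
    mem_nhdsWithin_of_mem_nhds (Metric.ball_mem_nhds x hδ₁)] with y hy hy0 hy1
  have hx' := (mem_cell_iff h01).1 hx
  have hy' := (mem_cell_iff h01).1 hy
  have hn := norm_le_pi_norm (y - x) 1
  rw [Pi.sub_apply, Real.norm_eq_abs] at hn
  -- The points x and y are joined through (x₀, y₁). Both legs stay in the closed cell and each
  -- costs ε/2 · ‖y − x‖.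
  have k0 := key 0 1 h01 δ₀ hb₀ y hy hy0 (y 1 - c 1) hy'.2 (by convert hn using 2; ring)
  have k1 := key 1 0 h01.symm δ₁ hb₁ y hy hy1 (x 0 - c 0) hx'.1 (by simp)
  rw [cellPoint_sub h01] at k0
  have e1 : cellPoint c 1 (y 1 - c 1, x 0 - c 0) = cellPoint c 0 (x 0 - c 0, y 1 - c 1) :=
    cellPoint_swap h01 (x 0 - c 0, y 1 - c 1)
  rw [cellPoint_sub h01.symm, e1] at k1
  simp only [Fin.sum_univ_two, add_apply, smul_apply,
    ContinuousLinearMap.proj_apply, smul_eq_mul, Pi.sub_apply, Real.norm_eq_abs]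
  rw [abs_le] at *
  constructor <;> linarith [k0.1, k0.2, k1.1, k1.2]

theorem contDiffOn_cell (hh : 0 < h) {f : (Fin 2 → ℝ) → ℝ} {D : Fin 2 → (Fin 2 → ℝ) → ℝ}
    (hD : ∀ i, Continuous (D i))
    (H : ∀ i, ∀ t ∈ Icc (-h) h, HasACDeriv h (fun s => f (cellPoint c i (s, t)))
      (fun s => D i (cellPoint c i (s, t)))) :
    ContDiffOn ℝ 1 f (cell h c) ∧ ∀ x ∈ cell h c, ∀ i s,
      fderivWithin ℝ f (cell h c) x (Pi.single i s) = s * D i x := by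
  constructor
  · rw [show (1 : WithTop ℕ∞) = 0 + 1 from rfl,
      contDiffOn_succ_iff_hasFDerivWithinAt_of_uniqueDiffOn (uniqueDiffOn_cell hh c)]
    refine ⟨by simp, _, contDiffOn_zero.2 (Continuous.continuousOn ?_),
      fun x hx => hasFDerivWithinAt_cell hD H hx⟩
    fun_prop
  · intro x hx i s
    rw [(hasFDerivWithinAt_cell hD H hx).fderivWithin (uniqueDiffOn_cell hh c x hx)]
    fin_cases i <;> simp [mul_comm]

end ContinuouslyDifferentiable

/-! ### Integration by parts on a cell. -/

section CellIntegrals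

open Set

variable {h : ℝ} {c : Fin 2 → ℝ} {i j : Fin 2}

/-- The integral over the edge of direction `i` at offset `s`. -/
noncomputable def edgeIntegral (h : ℝ) (c : Fin 2 → ℝ) (i : Fin 2) (s : ℝ)
    (f : (Fin 2 → ℝ) → ℝ) : ℝ :=
  ∫ t in Ioo (-h) h, f (cellPoint c i (s, t))

theorem integrableOn_comp_line {f : (Fin 2 → ℝ) → ℝ} (hf : Continuous f) (s : ℝ) :
    IntegrableOn (fun t => f (cellPoint c i (s, t))) (Ioo (-h) h) :=
  (hf.comp (continuous_cellPoint.comp (by fun_prop))).integrableOn_Icc.mono_set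
    Ioo_subset_Icc_self

theorem MeasureTheory.IntegrableOn.mul_continuous_cell {u ρ : (Fin 2 → ℝ) → ℝ}
    (hu : IntegrableOn u (interior (cell h c))) (hρ : Continuous ρ) :
    IntegrableOn (fun x => ρ x * u x) (interior (cell h c)) := by
  obtain ⟨C, hC⟩ := (isCompact_cell h c).exists_bound_of_continuousOn hρ.continuousOn
  refine Integrable.bdd_mul (c := C) hu hρ.aestronglyMeasurable ?_
  filter_upwards [ae_restrict_mem isOpen_interior.measurableSet] with x hx
  exact hC x (interior_subset hx)

/-- Fubini reduces this to the product rule on almost every line in direction i. The weight depends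
on that coordinate alone, so it leaves the edge integrals as constants. -/
theorem HasWeakPartial.integral_by_parts (hh : 0 < h) {u g f : (Fin 2 → ℝ) → ℝ}
    (hug : HasWeakPartial (interior (cell h c)) i u g)
    (hu : IntegrableOn u (interior (cell h c))) (hg : IntegrableOn g (interior (cell h c)))
    (hf : Continuous f) (hfu : f =ᵐ[volume.restrict (interior (cell h c))] u)
    {ρ ρ' : ℝ → ℝ} (hρ : ∀ s, HasDerivAt ρ (ρ' s) s) (hρ' : Continuous ρ') :
    ∫ x in interior (cell h c), ρ (x i - c i) * g x =
      ρ h * edgeIntegral h c i h f - ρ (-h) * edgeIntegral h c i (-h) f -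
        ∫ x in interior (cell h c), ρ' (x i - c i) * u x := by
  have hρc : Continuous ρ := continuous_iff_continuousAt.2 fun s => (hρ s).continuousAt
  have i1 : IntegrableOn (fun x => ρ (x i - c i) * g x) (interior (cell h c)) :=
    hg.mul_continuous_cell (ρ := fun x => ρ (x i - c i)) (by fun_prop)
  have i2 : IntegrableOn (fun x => ρ' (x i - c i) * u x) (interior (cell h c)) :=
    hu.mul_continuous_cell (ρ := fun x => ρ' (x i - c i)) (by fun_prop)
  have i12 : IntegrableOn (fun x => ρ' (x i - c i) * u x + ρ (x i - c i) * g x)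
      (interior (cell h c)) := i2.add i1
  rw [eq_sub_iff_add_eq', ← integral_add i2 i1, setIntegral_interior_cell _ i,
    setIntegral_square (i12.comp_cellPoint i)]
  simp only [edgeIntegral]
  rw [← integral_const_mul, ← integral_const_mul, ← integral_sub
    ((integrableOn_comp_line hf h).const_mul _) ((integrableOn_comp_line hf (-h)).const_mul _)]
  refine integral_congr_ae ?_
  filter_upwards [hug.ae_hasACDeriv hh hu hg hf hfu, ae_slice ((ae_interior_cell_iff i).1 hfu)]
    with t ht hfu
  have hm := ((HasACDeriv.of_hasDerivAt hρ hρ').mul hh ht).integral_eq hh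
  rw [← hm]
  refine integral_congr_ae ?_
  filter_upwards [hfu] with s hs
  rw [hs]
  simp [cellPoint_self]

/-- Weak derivatives of order at most four of a function on a square, all of them integrable. -/
structure IsDerivFamily (h : ℝ) (c : Fin 2 → ℝ) (D : List (Fin 2) → (Fin 2 → ℝ) → ℝ) : Prop where
  integrableOn : ∀ l, l.length ≤ 4 → IntegrableOn (D l) (interior (cell h c))
  hasWeakPartial : ∀ l i, l.length < 4 → HasWeakPartial (interior (cell h c)) i (D l) (D (i :: l))

/-- The embedding costs two derivatives, which leaves order at most two out of four. -/
theorem IsDerivFamily.exists_continuous (hh : 0 < h) {D : List (Fin 2) → (Fin 2 → ℝ) → ℝ}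
    (hD : IsDerivFamily h c D) {l : List (Fin 2)} (hl : l.length ≤ 2) :
    ∃ f, Continuous f ∧ f =ᵐ[volume.restrict (interior (cell h c))] D l :=
  exists_continuous_representative hh (show (0 : Fin 2) ≠ 1 by decide)
    (hD.integrableOn _ (by omega)) (hD.integrableOn (0 :: l) (by simp; omega))
    (hD.integrableOn (1 :: l) (by simp; omega)) (hD.integrableOn (1 :: 0 :: l) (by simp; omega))
    (hD.hasWeakPartial _ _ (by omega)) (hD.hasWeakPartial _ _ (by omega))
    (hD.hasWeakPartial _ _ (by simp; omega))

/-- Continuous representatives of a function and of its gradient, together with the integrals of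
the higher derivatives in terms of them. -/
structure IsCellRep (h : ℝ) (c : Fin 2 → ℝ) (D : List (Fin 2) → (Fin 2 → ℝ) → ℝ)
    (f : (Fin 2 → ℝ) → ℝ) (f' : Fin 2 → (Fin 2 → ℝ) → ℝ) : Prop where
  cont : Continuous f
  cont' : ∀ i, Continuous (f' i)
  ae_eq : f =ᵐ[volume.restrict (interior (cell h c))] D []
  ae_eq' : ∀ i, f' i =ᵐ[volume.restrict (interior (cell h c))] D [i]
  slice : ∀ i, ∀ t ∈ Icc (-h) h, HasACDeriv h (fun s => f (cellPoint c i (s, t)))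
      (fun s => f' i (cellPoint c i (s, t)))

theorem IsDerivFamily.exists_isCellRep (hh : 0 < h) {D : List (Fin 2) → (Fin 2 → ℝ) → ℝ}
    (hD : IsDerivFamily h c D) : ∃ f f', IsCellRep h c D f f' := by
  obtain ⟨f, hf, hfD⟩ := hD.exists_continuous hh (l := []) (by simp)
  choose f' hf' hfD' using fun i => hD.exists_continuous hh (l := [i]) (by simp)
  refine ⟨f, f', hf, hf', hfD, hfD', fun i => hasACDeriv_of_continuous hh hf (hf' i) ?_⟩
  have hp : HasWeakPartial (interior (cell h c)) i (D []) (f' i) :=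
    (hD.hasWeakPartial [] i (by simp)).congr isOpen_interior (ae_eq_refl _) (hfD' i).symm
  exact hp.ae_hasACDeriv hh (hD.integrableOn _ (by simp))
    ((integrable_congr (hfD' i)).2 (hD.integrableOn _ (by simp))) hf hfD

variable {D : List (Fin 2) → (Fin 2 → ℝ) → ℝ} {f : (Fin 2 → ℝ) → ℝ}
  {f' : Fin 2 → (Fin 2 → ℝ) → ℝ}

theorem IsCellRep.edgeIntegral_tangential (hh : 0 < h) (H : IsCellRep h c D f f') (hij : i ≠ j)
    {s : ℝ} (hs : s ∈ Icc (-h) h) :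
    edgeIntegral h c j s (f' i) = f (cellPoint c i (h, s)) - f (cellPoint c i (-h, s)) := by
  have := (H.slice i s hs).integral_eq hh
  rw [← this, edgeIntegral]
  congr 1; ext t
  exact congrArg (f' i) (cellPoint_swap hij (t, s))

/-- Only normal derivatives on edges enter, so the interpolant has the same mean of ∂_i². -/
theorem IsCellRep.integral_hessian_diag (hh : 0 < h) (hD : IsDerivFamily h c D)
    (H : IsCellRep h c D f f') (i : Fin 2) :
    ∫ x in interior (cell h c), D [i, i] x =
      edgeIntegral h c i h (f' i) - edgeIntegral h c i (-h) (f' i) := by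
  have := (hD.hasWeakPartial [i] i (by simp)).integral_by_parts hh (hD.integrableOn _ (by simp))
    (hD.integrableOn _ (by simp)) (H.cont' i) (H.ae_eq' i) (ρ := fun _ => 1) (ρ' := fun _ => 0)
    (fun s => hasDerivAt_const s 1) continuous_const
  simpa using this

/-- Only vertex values enter, so the interpolant has the same mean mixed derivative. -/
theorem IsCellRep.integral_hessian_mixed (hh : 0 < h) (hD : IsDerivFamily h c D)
    (H : IsCellRep h c D f f') (hij : i ≠ j) :
    ∫ x in interior (cell h c), D [j, i] x =
      f (cellPoint c i (h, h)) - f (cellPoint c i (-h, h)) -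
        (f (cellPoint c i (h, -h)) - f (cellPoint c i (-h, -h))) := by
  have := (hD.hasWeakPartial [i] j (by simp)).integral_by_parts hh (hD.integrableOn _ (by simp))
    (hD.integrableOn _ (by simp)) (H.cont' i) (H.ae_eq' i) (ρ := fun _ => 1) (ρ' := fun _ => 0)
    (fun s => hasDerivAt_const s 1) continuous_const
  rw [← H.edgeIntegral_tangential hh hij ⟨by linarith, le_rfl⟩,
    ← H.edgeIntegral_tangential hh hij ⟨le_rfl, by linarith⟩]
  simpa using this

theorem IsCellRep.integral_gradient (hh : 0 < h) (hD : IsDerivFamily h c D)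
    (H : IsCellRep h c D f f') (i : Fin 2) :
    ∫ x in interior (cell h c), D [i] x = edgeIntegral h c i h f - edgeIntegral h c i (-h) f := by
  have := (hD.hasWeakPartial [] i (by simp)).integral_by_parts hh (hD.integrableOn _ (by simp))
    (hD.integrableOn _ (by simp)) H.cont H.ae_eq (ρ := fun _ => 1) (ρ' := fun _ => 0)
    (fun s => hasDerivAt_const s 1) continuous_const
  simpa using this

/-- The edge integrals of `f' i` are Morley edge data when k = i and differences of vertex values
when k ≠ i. The last bracket, the edge integrals of f, is not Morley data but is the same for both
k. -/
theorem IsCellRep.integral_linear_mul (hh : 0 < h) (hD : IsDerivFamily h c D)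
    (H : IsCellRep h c D f f') (i k : Fin 2) :
    ∫ x in interior (cell h c), (x k - c k) * D [k, i] x =
      h * (edgeIntegral h c k h (f' i) + edgeIntegral h c k (-h) (f' i)) -
        (edgeIntegral h c i h f - edgeIntegral h c i (-h) f) := by
  have := (hD.hasWeakPartial [i] k (by simp)).integral_by_parts hh (hD.integrableOn _ (by simp))
    (hD.integrableOn _ (by simp)) (H.cont' i) (H.ae_eq' i) (ρ := fun s => s) (ρ' := fun _ => 1)
    (fun s => hasDerivAt_id s) continuous_const
  rw [this, ← H.integral_gradient hh hD i]
  simp only [one_mul]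
  ring

/-- The weight (h² − s²)/2 vanishes on both edges and has derivative −s, so a first moment of a
second derivative becomes a weighted third derivative. -/
theorem IsDerivFamily.integral_bubble_mul (hh : 0 < h) (hD : IsDerivFamily h c D) (i k : Fin 2) :
    ∫ x in interior (cell h c), (h ^ 2 - (x k - c k) ^ 2) / 2 * D [k, k, i] x =
      ∫ x in interior (cell h c), (x k - c k) * D [k, i] x := by
  obtain ⟨g, hg, hgD⟩ := hD.exists_continuous hh (l := [k, i]) (by simp)
  have := (hD.hasWeakPartial [k, i] k (by simp)).integral_by_parts hh (hD.integrableOn _ (by simp))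
    (hD.integrableOn _ (by simp)) hg hgD (ρ := fun s => (h ^ 2 - s ^ 2) / 2) (ρ' := fun s => -s)
    (fun s => (((hasDerivAt_pow 2 s).const_sub (h ^ 2)).div_const 2).congr_deriv
      (by norm_num; ring)) continuous_neg
  rw [this]
  simp only [neg_mul, integral_neg]
  ring

end CellIntegrals

/-! ### The Morley space in centred coordinates. -/

section Morley

open Set MvPolynomial

variable {h : ℝ} {c : Fin 2 → ℝ} {i j : Fin 2}

/-- The general element of the Morley space in coordinates centred at `c`. -/
noncomputable def morleyPoly (c : Fin 2 → ℝ) (a₀ e : ℝ) (a b d : Fin 2 → ℝ) :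
    MvPolynomial (Fin 2) ℝ :=
  C a₀ + C e * ((X 0 - C (c 0)) * (X 1 - C (c 1))) +
    ∑ i, (C (a i) * (X i - C (c i)) + C (b i) * (X i - C (c i)) ^ 2 +
      C (d i) * (X i - C (c i)) ^ 3)

theorem morleyPoly_mem (c : Fin 2 → ℝ) (a₀ e : ℝ) (a b d : Fin 2 → ℝ) :
    morleyPoly c a₀ e a b d ∈ morleySpace := by
  set S := morleySpace
  have hq : ∀ q : MvPolynomial (Fin 2) ℝ, q.totalDegree ≤ 2 → q ∈ S := fun q hq =>
    Submodule.mem_sup_left ((mem_restrictTotalDegree _ _ _).2 hq)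
  have h1 : (1 : MvPolynomial (Fin 2) ℝ) ∈ S := hq _ (by simp)
  have hX : ∀ i, (X i : MvPolynomial (Fin 2) ℝ) ∈ S := fun i => hq _ (by simp [totalDegree_X])
  have hXX : ∀ i j, (X i * X j : MvPolynomial (Fin 2) ℝ) ∈ S := fun i j =>
    hq _ ((totalDegree_mul _ _).trans (by simp [totalDegree_X]))
  have h3 : ∀ i, (X i ^ 3 : MvPolynomial (Fin 2) ℝ) ∈ S := fun i =>
    Submodule.mem_sup_right (Submodule.subset_span (by fin_cases i <;> simp))
  have key : ∀ (r : ℝ) {q : MvPolynomial (Fin 2) ℝ}, q ∈ S → C r * q ∈ S := fun r q hq => by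
    rw [← smul_eq_C_mul]; exact S.smul_mem r hq
  have hY : ∀ i, C (a i) * (X i - C (c i)) + C (b i) * (X i - C (c i)) ^ 2 +
      C (d i) * (X i - C (c i)) ^ 3 ∈ S := by
    intro i
    have e : C (a i) * (X i - C (c i)) + C (b i) * (X i - C (c i)) ^ 2 +
      C (d i) * (X i - C (c i)) ^ 3 = C (-(a i) * c i + b i * c i ^ 2 - d i * c i ^ 3) * 1 +
        C (a i - 2 * b i * c i + 3 * d i * c i ^ 2) * X i +
        C (b i - 3 * d i * c i) * (X i * X i) + C (d i) * X i ^ 3 := by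
      simp only [map_add, map_sub, map_mul, map_neg, map_pow, map_ofNat]
      ring
    rw [e]
    exact S.add_mem (S.add_mem (S.add_mem (key _ h1) (key _ (hX i))) (key _ (hXX i i)))
      (key _ (h3 i))
  have e : (C a₀ + C e * ((X 0 - C (c 0)) * (X 1 - C (c 1))) : MvPolynomial (Fin 2) ℝ) = C (a₀ + e * c 0 * c 1) * 1 +
      C (-e * c 1) * X 0 + C (-e * c 0) * X 1 + C e * (X 0 * X 1) := by
    simp only [map_add, map_mul, map_neg]
    ring
  rw [morleyPoly, e]
  exact S.add_mem (S.add_mem (S.add_mem (S.add_mem (key _ h1) (key _ (hX 0))) (key _ (hX 1)))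
    (key _ (hXX 0 1))) (S.sum_mem fun i _ => hY i)

/-- The centred polynomials form a subspace, and it contains the generators: recentring x_i³ at c
produces only powers of the same variable. -/
theorem exists_morleyPoly_eq (c : Fin 2 → ℝ) {p : MvPolynomial (Fin 2) ℝ} (hp : p ∈ morleySpace) :
    ∃ a₀ e a b d, p = morleyPoly c a₀ e a b d := by
  let S : Submodule ℝ (MvPolynomial (Fin 2) ℝ) :=
    { carrier := {p | ∃ a₀ e a b d, p = morleyPoly c a₀ e a b d}
      zero_mem' := ⟨0, 0, 0, 0, 0, by simp [morleyPoly]⟩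
      add_mem' := by
        rintro _ _ ⟨a₀, e, a, b, d, rfl⟩ ⟨a₀', e', a', b', d', rfl⟩
        refine ⟨a₀ + a₀', e + e', a + a', b + b', d + d', ?_⟩
        simp only [morleyPoly, Fin.sum_univ_two, Pi.add_apply, map_add]
        ring
      smul_mem' := by
        rintro r _ ⟨a₀, e, a, b, d, rfl⟩
        refine ⟨r * a₀, r * e, r • a, r • b, r • d, ?_⟩
        simp only [morleyPoly, Fin.sum_univ_two, Pi.smul_apply, smul_eq_mul, map_mul,
          smul_eq_C_mul]
        ring }
  suffices morleySpace ≤ S from this hp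
  refine sup_le ?_ ?_
  · rw [restrictTotalDegree, restrictSupport_eq_span, Submodule.span_le]
    rintro _ ⟨m, hm, rfl⟩
    have hm' : m 0 + m 1 ≤ 2 := by
      have : (m.sum fun _ e => e) = m 0 + m 1 := by
        rw [Finsupp.sum_fintype _ _ (fun _ => rfl), Fin.sum_univ_two]
      rw [← this]; exact hm
    have e : (monomial m (1 : ℝ)) = X 0 ^ m 0 * X 1 ^ m 1 := by
      rw [monomial_eq, Finsupp.prod_fintype _ _ (fun _ => pow_zero _), Fin.prod_univ_two]
      simp
    change monomial m (1 : ℝ) ∈ S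
    rw [e]
    have h0 : m 0 ≤ 2 := by omega
    have h1 : m 1 ≤ 2 := by omega
    generalize m 0 = k at *
    generalize m 1 = l at *
    have hcases : (k = 0 ∧ l = 0) ∨ (k = 0 ∧ l = 1) ∨ (k = 0 ∧ l = 2) ∨ (k = 1 ∧ l = 0) ∨
        (k = 1 ∧ l = 1) ∨ (k = 2 ∧ l = 0) := by omega
    rcases hcases with ⟨rfl, rfl⟩ | ⟨rfl, rfl⟩ | ⟨rfl, rfl⟩ | ⟨rfl, rfl⟩ | ⟨rfl, rfl⟩ | ⟨rfl, rfl⟩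
    -- The witnesses here and for the cubes are the Taylor coefficients at c.
    · refine ⟨1, 0, 0, 0, 0, ?_⟩
      simp [morleyPoly]
    · refine ⟨c 1, 0, ![0, 1], 0, 0, ?_⟩
      simp [morleyPoly]
    · refine ⟨c 1 ^ 2, 0, ![0, c 1 + c 1], ![0, 1], 0, ?_⟩
      simp [morleyPoly]; ring
    · refine ⟨c 0, 0, ![1, 0], 0, 0, ?_⟩
      simp [morleyPoly]
    · refine ⟨c 0 * c 1, 1, ![c 1, c 0], 0, 0, ?_⟩
      simp [morleyPoly]; ring
    · refine ⟨c 0 ^ 2, 0, ![c 0 + c 0, 0], ![1, 0], 0, ?_⟩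
      simp [morleyPoly]; ring
  · rw [Submodule.span_le]
    rintro q (rfl | rfl)
    · refine ⟨c 0 ^ 3, 0, ![c 0 ^ 2 + c 0 ^ 2 + c 0 ^ 2, 0], ![c 0 + c 0 + c 0, 0], ![1, 0], ?_⟩
      simp [morleyPoly]; ring
    · refine ⟨c 1 ^ 3, 0, ![0, c 1 ^ 2 + c 1 ^ 2 + c 1 ^ 2], ![0, c 1 + c 1 + c 1], ![0, 1], ?_⟩
      simp [morleyPoly]; ring

/-- The gradient of `morleyPoly`. -/
def morleyGrad (c : Fin 2 → ℝ) (e : ℝ) (a b d : Fin 2 → ℝ) (i : Fin 2) (x : Fin 2 → ℝ) : ℝ :=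
  a i + e * (x (1 - i) - c (1 - i)) + 2 * b i * (x i - c i) + 3 * d i * (x i - c i) ^ 2

/-- The Hessian of `morleyPoly`. -/
def morleyHess (c : Fin 2 → ℝ) (e : ℝ) (b d : Fin 2 → ℝ) (i j : Fin 2) (x : Fin 2 → ℝ) : ℝ :=
  if i = j then 2 * b i + 6 * d i * (x i - c i) else e

theorem eval_morleyPoly (hij : i ≠ j) (a₀ e : ℝ) (a b d : Fin 2 → ℝ) (x : Fin 2 → ℝ) :
    eval x (morleyPoly c a₀ e a b d) = a₀ + e * (x i - c i) * (x j - c j) +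
      (a i * (x i - c i) + b i * (x i - c i) ^ 2 + d i * (x i - c i) ^ 3) +
      (a j * (x j - c j) + b j * (x j - c j) ^ 2 + d j * (x j - c j) ^ 3) := by
  simp only [morleyPoly, map_add, map_mul, map_sub, map_pow, eval_C, eval_X, Fin.sum_univ_two]
  fin_cases i <;> fin_cases j <;> first | exact absurd rfl hij | (simp; ring)

theorem one_sub_eq_of_ne (hij : i ≠ j) : 1 - i = j := by
  fin_cases i <;> fin_cases j <;> first | exact absurd rfl hij | rfl

theorem contDiff_eval (p : MvPolynomial (Fin 2) ℝ) : ContDiff ℝ ∞ fun x => eval x p := by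
  induction p using MvPolynomial.induction_on with
  | C a => simpa using contDiff_const
  | add p q hp hq => simpa using hp.add hq
  | mul_X p n hp => simpa using hp.mul (contDiff_apply ℝ ℝ n)

theorem contDiff_morleyGrad (c : Fin 2 → ℝ) (e : ℝ) (a b d : Fin 2 → ℝ) (i : Fin 2) :
    ContDiff ℝ ∞ (morleyGrad c e a b d i) := by
  unfold morleyGrad; fun_prop

theorem continuous_morleyHess (c : Fin 2 → ℝ) (e : ℝ) (b d : Fin 2 → ℝ) (i j : Fin 2) :
    Continuous (morleyHess c e b d i j) := by
  unfold morleyHess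
  split_ifs <;> fun_prop

theorem hasDerivAt_eval_morleyPoly (c : Fin 2 → ℝ) (a₀ e : ℝ) (a b d : Fin 2 → ℝ) (i : Fin 2)
    (s t : ℝ) :
    HasDerivAt (fun s => eval (cellPoint c i (s, t)) (morleyPoly c a₀ e a b d))
      (morleyGrad c e a b d i (cellPoint c i (s, t))) s := by
  obtain ⟨j, hij⟩ := exists_other i
  simp only [eval_morleyPoly hij, morleyGrad, one_sub_eq_of_ne hij, cellPoint_self,
    cellPoint_other hij, add_sub_cancel_left]
  have h1 := hasDerivAt_id s
  have := ((((h1.const_mul e).mul_const t).const_add a₀).add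
    (((h1.const_mul (a i)).add ((hasDerivAt_pow 2 s).const_mul (b i))).add
      ((hasDerivAt_pow 3 s).const_mul (d i)))).add_const (a j * t + b j * t ^ 2 + d j * t ^ 3)
  refine this.congr_deriv ?_
  norm_num
  ring

theorem hasDerivAt_morleyGrad (c : Fin 2 → ℝ) (e : ℝ) (a b d : Fin 2 → ℝ) (i k : Fin 2)
    (s t : ℝ) :
    HasDerivAt (fun s => morleyGrad c e a b d k (cellPoint c i (s, t)))
      (morleyHess c e b d i k (cellPoint c i (s, t))) s := by
  obtain ⟨j, hij⟩ := exists_other i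
  have h1 := hasDerivAt_id s
  by_cases hik : i = k
  · subst hik
    simp only [morleyGrad, morleyHess, if_true, one_sub_eq_of_ne hij, cellPoint_self,
      cellPoint_other hij, add_sub_cancel_left]
    refine (((h1.const_mul (2 * b i)).const_add (a i + e * t)).add
      ((hasDerivAt_pow 2 s).const_mul (3 * d i))).congr_deriv ?_
    norm_num
    ring
  · simp only [morleyGrad, morleyHess, hik, if_false, one_sub_eq_of_ne (Ne.symm hik),
      cellPoint_self, cellPoint_other hik, add_sub_cancel_left]
    refine ((((h1.const_mul e).const_add (a k)).add_const (2 * b k * t)).add_const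
      (3 * d k * t ^ 2)).congr_deriv ?_
    simp

theorem fderiv_single_eq {η D : (Fin 2 → ℝ) → ℝ} (hη : ContDiff ℝ ∞ η)
    (H : ∀ s t, HasDerivAt (fun s => η (cellPoint c i (s, t))) (D (cellPoint c i (s, t))) s) :
    (fun x => fderiv ℝ η x (Pi.single i 1)) = D := by
  obtain ⟨j, hij⟩ := exists_other i
  ext x
  have h1 := H (x i - c i) (x j - c j)
  have h2 := hasDerivAt_comp_cellPoint (c := c) i (s := x i - c i) (t := x j - c j)
    (hη.differentiable (by simp) _)
  rw [cellPoint_sub hij] at h1 h2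
  exact h2.unique h1

theorem hasWeakPartial_eval_morleyPoly (U : Set (Fin 2 → ℝ)) (c : Fin 2 → ℝ) (a₀ e : ℝ)
    (a b d : Fin 2 → ℝ) (i : Fin 2) :
    HasWeakPartial U i (fun x => eval x (morleyPoly c a₀ e a b d)) (morleyGrad c e a b d i) := by
  rw [← fderiv_single_eq (contDiff_eval _) (hasDerivAt_eval_morleyPoly c a₀ e a b d i)]
  exact hasWeakPartial_of_contDiff (contDiff_eval _) i

theorem hasWeakPartial_morleyGrad (U : Set (Fin 2 → ℝ)) (c : Fin 2 → ℝ) (e : ℝ)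
    (a b d : Fin 2 → ℝ) (i k : Fin 2) :
    HasWeakPartial U i (morleyGrad c e a b d k) (morleyHess c e b d i k) := by
  rw [← fderiv_single_eq (contDiff_morleyGrad c e a b d k) (hasDerivAt_morleyGrad c e a b d i k)]
  exact hasWeakPartial_of_contDiff (contDiff_morleyGrad c e a b d k) i

end Morley

/-! ### Existence and uniqueness of the Morley interpolant. -/

section Interpolant

open Set MvPolynomial

variable {h : ℝ} {c : Fin 2 → ℝ} {i j : Fin 2}

theorem edgeNormalIntegral_eq (hh : 0 < h) {f : (Fin 2 → ℝ) → ℝ} {D : Fin 2 → (Fin 2 → ℝ) → ℝ}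
    (hD : ∀ i, Continuous (D i))
    (H : ∀ i, ∀ t ∈ Icc (-h) h, HasACDeriv h (fun s => f (cellPoint c i (s, t)))
      (fun s => D i (cellPoint c i (s, t)))) (i : Fin 2) {s : ℝ} (hs : s = 1 ∨ s = -1) :
    edgeNormalIntegral h c i s f = s * edgeIntegral h c i (s * h) (D i) := by
  rw [edgeNormalIntegral, intervalIntegral.integral_of_le (by linarith),
    integral_Ioc_eq_integral_Ioo, edgeIntegral, ← integral_const_mul]
  refine setIntegral_congr_fun measurableSet_Ioo fun t ht => ?_
  refine (contDiffOn_cell hh hD H).2 _ (cellPoint_mem_cell (i := i) (p := (s * h, t)) ?_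
    (Ioo_subset_Icc_self ht)) i s
  rcases hs with rfl | rfl
  · constructor <;> linarith
  · constructor <;> linarith

theorem hasACDeriv_eval_morleyPoly (h : ℝ) (c : Fin 2 → ℝ) (a₀ e : ℝ) (a b d : Fin 2 → ℝ)
    (i : Fin 2) (t : ℝ) :
    HasACDeriv h (fun s => eval (cellPoint c i (s, t)) (morleyPoly c a₀ e a b d))
      (fun s => morleyGrad c e a b d i (cellPoint c i (s, t))) :=
  HasACDeriv.of_hasDerivAt (fun s => hasDerivAt_eval_morleyPoly c a₀ e a b d i s t)
    ((contDiff_morleyGrad c e a b d i).continuous.comp (continuous_cellPoint.comp (by fun_prop)))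

theorem setIntegral_Ioo_const (hh : 0 < h) (k : ℝ) : ∫ _ in Ioo (-h) h, k = 2 * h * k := by
  simp
  rw [max_eq_left (by linarith)]
  ring_nf
  simp

theorem setIntegral_Ioo_id (hh : 0 < h) : ∫ t in Ioo (-h) h, t = 0 := by
  rw [← integral_Ioc_eq_integral_Ioo, ← intervalIntegral.integral_of_le (by linarith)]
  simp

theorem setIntegral_Ioo_sq (hh : 0 < h) : ∫ t in Ioo (-h) h, t ^ 2 = 2 * h ^ 3 / 3 := by
  rw [← integral_Ioc_eq_integral_Ioo, ← intervalIntegral.integral_of_le (by linarith)]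
  simp
  ring

theorem edgeIntegral_morleyGrad (hh : 0 < h) (e : ℝ) (a b d : Fin 2 → ℝ) (i : Fin 2) (s : ℝ) :
    edgeIntegral h c i s (morleyGrad c e a b d i) =
      2 * h * (a i + 2 * b i * s + 3 * d i * s ^ 2) := by
  obtain ⟨j, hij⟩ := exists_other i
  have e1 : ∀ t, morleyGrad c e a b d i (cellPoint c i (s, t)) =
      (a i + 2 * b i * s + 3 * d i * s ^ 2) + e * t := by
    intro t
    simp only [morleyGrad, one_sub_eq_of_ne hij, cellPoint_self, cellPoint_other hij,
      add_sub_cancel_left]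
    ring
  simp only [edgeIntegral, e1]
  have hi : IntegrableOn (fun t : ℝ => e * t) (Ioo (-h) h) :=
    (by fun_prop : Continuous fun t : ℝ => e * t).integrableOn_Icc.mono_set Ioo_subset_Icc_self
  rw [integral_add (by simp) hi, integral_const_mul, setIntegral_Ioo_const hh,
    setIntegral_Ioo_id hh]
  ring

/-- The equations for the coefficients of the Morley interpolant, for the vertex values `v` and the
edge integrals `N` of the normal derivatives. -/
structure MorleyEquations (h : ℝ) (v : ℝ → ℝ → ℝ) (N : Fin 2 → ℝ → ℝ) (a₀ e : ℝ)
    (a b d : Fin 2 → ℝ) : Prop where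
  vertex : ∀ s t, (s = h ∨ s = -h) → (t = h ∨ t = -h) → a₀ + e * s * t +
    (a 0 * s + b 0 * s ^ 2 + d 0 * s ^ 3) + (a 1 * t + b 1 * t ^ 2 + d 1 * t ^ 3) = v s t
  edge : ∀ i s, (s = h ∨ s = -h) → 2 * h * (a i + 2 * b i * s + 3 * d i * s ^ 2) = N i s

/-- The increment of the vertex values in direction `i`, summed over both edges. -/
def vertexIncrement (h : ℝ) (v : ℝ → ℝ → ℝ) (i : Fin 2) : ℝ :=
  if i = 0 then v h h + v h (-h) - v (-h) h - v (-h) (-h)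
  else v h h + v (-h) h - v h (-h) - v (-h) (-h)

/-- The eight equations for eight unknowns decouple by parity. Edge differences give b i; vertex
increments give 4h(a i + h² d i) and edge sums 4h(a i + 3h² d i), which determine a i and d i; the
alternating and the plain vertex sum give e and a₀. -/
theorem morleyEquations_iff (hh : 0 < h) {v : ℝ → ℝ → ℝ} {N : Fin 2 → ℝ → ℝ} {a₀ e : ℝ}
    {a b d : Fin 2 → ℝ} :
    MorleyEquations h v N a₀ e a b d ↔
      (∀ i, b i = (N i h - N i (-h)) / (8 * h ^ 2)) ∧
      (∀ i, d i = (h * (N i h + N i (-h)) - h * vertexIncrement h v i) / (8 * h ^ 4)) ∧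
      (∀ i, a i = vertexIncrement h v i / (4 * h) - h ^ 2 * d i) ∧
      e = (v h h - v h (-h) - v (-h) h + v (-h) (-h)) / (4 * h ^ 2) ∧
      a₀ = (v h h + v h (-h) + v (-h) h + v (-h) (-h)) / 4 - h ^ 2 * (b 0 + b 1) := by
  have hne : h ≠ 0 := hh.ne'
  constructor
  · rintro ⟨hv, hN⟩
    have v1 := hv h h (by simp) (by simp)
    have v2 := hv h (-h) (by simp) (by simp)
    have v3 := hv (-h) h (by simp) (by simp)
    have v4 := hv (-h) (-h) (by simp) (by simp)
    have hi : ∀ i, vertexIncrement h v i = 4 * h * (a i + h ^ 2 * d i) := by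
      intro i
      fin_cases i <;> simp [vertexIncrement, ← v1, ← v2, ← v3, ← v4] <;> ring
    refine ⟨fun i => ?_, fun i => ?_, fun i => ?_, ?_, ?_⟩
    · rw [← hN i h (by simp), ← hN i (-h) (by simp)]
      field_simp; ring
    · rw [← hN i h (by simp), ← hN i (-h) (by simp), hi]
      field_simp; ring
    · rw [hi]; field_simp; ring
    · rw [← v1, ← v2, ← v3, ← v4]; field_simp; ring
    · rw [← v1, ← v2, ← v3, ← v4]; ring
  · rintro ⟨hb, hd, ha, rfl, rfl⟩
    constructor
    · rintro s t (rfl | rfl) (rfl | rfl) <;>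
      · rw [ha, ha]
        simp only [vertexIncrement, if_true, one_ne_zero, if_false]
        field_simp
        ring
    · rintro i s (rfl | rfl) <;>
      · rw [ha, hb, hd]
        field_simp
        ring

variable {D : List (Fin 2) → (Fin 2 → ℝ) → ℝ} {f : (Fin 2 → ℝ) → ℝ}
  {f' : Fin 2 → (Fin 2 → ℝ) → ℝ}

theorem mem_cellVertices_iff {x : Fin 2 → ℝ} :
    x ∈ cellVertices h c ↔
      ∃ s t, (s = h ∨ s = -h) ∧ (t = h ∨ t = -h) ∧ x = cellPoint c 0 (s, t) := by
  have h01 : (0 : Fin 2) ≠ 1 := by decide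
  constructor
  · intro hx
    refine ⟨x 0 - c 0, x 1 - c 1, ?_, ?_, (cellPoint_sub h01 x).symm⟩
    · rcases hx 0 with h | h <;> [right; left] <;> linarith
    · rcases hx 1 with h | h <;> [right; left] <;> linarith
  · rintro ⟨s, t, hs, ht, rfl⟩
    refine (forall_fin_two_iff_of_ne h01).2 ⟨?_, ?_⟩
    · rw [cellPoint_self]
      rcases hs with rfl | rfl
      · right; rfl
      · left; ring
    · rw [cellPoint_other h01]
      rcases ht with rfl | rfl
      · right; rfl
      · left; ring

theorem cellVertices_subset (hh : 0 < h) : cellVertices h c ⊆ cell h c := by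
  intro x hx k
  rcases hx k with h1 | h1 <;> rw [h1] <;> constructor <;> linarith

theorem morleyPoly_interpolates_iff (hh : 0 < h) (H : IsCellRep h c D f f') (a₀ e : ℝ)
    (a b d : Fin 2 → ℝ) :
    ((∀ P ∈ cellVertices h c, eval P (morleyPoly c a₀ e a b d) = f P) ∧
      ∀ (i : Fin 2) (s : ℝ), s = 1 ∨ s = -1 →
        edgeNormalIntegral h c i s (fun x => eval x (morleyPoly c a₀ e a b d)) =
          edgeNormalIntegral h c i s f) ↔
    MorleyEquations h (fun s t => f (cellPoint c 0 (s, t)))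
      (fun i s => edgeIntegral h c i s (f' i)) a₀ e a b d := by
  have h01 : (0 : Fin 2) ≠ 1 := by decide
  have hv : ∀ s t, eval (cellPoint c 0 (s, t)) (morleyPoly c a₀ e a b d) = a₀ + e * s * t +
      (a 0 * s + b 0 * s ^ 2 + d 0 * s ^ 3) + (a 1 * t + b 1 * t ^ 2 + d 1 * t ^ 3) := by
    intro s t
    simp only [eval_morleyPoly h01, cellPoint_self, cellPoint_other h01, add_sub_cancel_left]
  have hN : ∀ (i : Fin 2) (s : ℝ), s = 1 ∨ s = -1 →
      (edgeNormalIntegral h c i s (fun x => eval x (morleyPoly c a₀ e a b d)) =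
          edgeNormalIntegral h c i s f ↔
        2 * h * (a i + 2 * b i * (s * h) + 3 * d i * (s * h) ^ 2) =
          edgeIntegral h c i (s * h) (f' i)) := by
    intro i s hs
    rw [edgeNormalIntegral_eq hh H.cont' H.slice i hs, edgeNormalIntegral_eq hh
      (fun i => (contDiff_morleyGrad c e a b d i).continuous)
      (fun i t _ => hasACDeriv_eval_morleyPoly h c a₀ e a b d i t) i hs,
      edgeIntegral_morleyGrad hh]
    exact mul_right_inj' (by rcases hs with rfl | rfl <;> norm_num)
  constructor
  · rintro ⟨h1, h2⟩
    refine ⟨fun s t hs ht => ?_, fun i s hs => ?_⟩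
    · rw [← hv]; exact h1 _ (mem_cellVertices_iff.2 ⟨s, t, hs, ht, rfl⟩)
    · rcases hs with rfl | rfl
      · simpa using (hN i 1 (by simp)).1 (h2 i 1 (by simp))
      · simpa using (hN i (-1) (by simp)).1 (h2 i (-1) (by simp))
  · rintro ⟨h1, h2⟩
    refine ⟨fun P hP => ?_, fun i s hs => (hN i s hs).2 (h2 i _ ?_)⟩
    · obtain ⟨s, t, hs, ht, rfl⟩ := mem_cellVertices_iff.1 hP
      rw [hv]; exact h1 s t hs ht
    · rcases hs with rfl | rfl <;> simp

theorem cell_subset_closure_interior (hh : 0 < h) : cell h c ⊆ closure (interior (cell h c)) := by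
  rw [(convex_cell h c).closure_interior_eq_closure_of_nonempty_interior
    (interior_cell_nonempty hh c)]
  exact subset_closure

theorem isMorleyInterpolant_iff (hh : 0 < h) (H : IsCellRep h c D f f')
    {p : MvPolynomial (Fin 2) ℝ} :
    IsMorleyInterpolant h c (D []) p ↔ ∃ a₀ e a b d, p = morleyPoly c a₀ e a b d ∧
      MorleyEquations h (fun s t => f (cellPoint c 0 (s, t)))
        (fun i s => edgeIntegral h c i s (f' i)) a₀ e a b d := by
  have hfae : f =ᵐ[volume.restrict (cell h c)] D [] := by
    rw [← Measure.restrict_congr_set (interior_cell_ae_eq h c)]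
    exact H.ae_eq
  constructor
  · rintro ⟨hp, g, hg, hgD, hv, hN⟩
    obtain ⟨a₀, e, a, b, d, rfl⟩ := exists_morleyPoly_eq c hp
    refine ⟨a₀, e, a, b, d, rfl, (morleyPoly_interpolates_iff hh H a₀ e a b d).1 ?_⟩
    -- The cell is contained in the closure of its interior, so two continuous representatives agree
    -- on it up to the boundary, and with them their derivatives within it. The data do not depend
    -- on the representative.
    have hgf : EqOn g f (cell h c) := Measure.eqOn_of_ae_eq (hgD.trans hfae.symm)
      hg.continuousOn H.cont.continuousOn (cell_subset_closure_interior hh)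
    refine ⟨fun P hP => (hv P hP).trans (hgf (cellVertices_subset hh hP)), fun i s hs =>
      (hN i s hs).trans ?_⟩
    refine intervalIntegral.integral_congr fun t ht => ?_
    rw [uIcc_of_le (by linarith)] at ht
    have hm : edgePoint h c i s t ∈ cell h c := by
      refine cellPoint_mem_cell (i := i) (p := (s * h, t)) ?_ ht
      rcases hs with rfl | rfl
      · constructor <;> linarith
      · constructor <;> linarith
    change fderivWithin ℝ g _ _ _ = fderivWithin ℝ f _ _ _
    rw [fderivWithin_congr hgf (hgf hm)]
  · rintro ⟨a₀, e, a, b, d, rfl, he⟩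
    obtain ⟨h1, h2⟩ := (morleyPoly_interpolates_iff hh H a₀ e a b d).2 he
    exact ⟨morleyPoly_mem c a₀ e a b d, f, (contDiffOn_cell hh H.cont' H.slice).1, hfae, h1, h2⟩

theorem existsUnique_isMorleyInterpolant (hh : 0 < h) (H : IsCellRep h c D f f') :
    ∃! p, IsMorleyInterpolant h c (D []) p := by
  simp only [isMorleyInterpolant_iff hh H, morleyEquations_iff hh]
  refine ⟨_, ⟨_, _, _, _, _, rfl, fun i => rfl, fun i => rfl, fun i => rfl, rfl, rfl⟩, ?_⟩
  rintro p ⟨a₀, e, a, b, d, rfl, hb, hd, ha, rfl, rfl⟩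
  obtain rfl : b = _ := funext hb
  obtain rfl : d = _ := funext hd
  obtain rfl : a = _ := funext ha
  rfl

end Interpolant

/-! ### The consistency term on one cell. -/

section CellFormula

open Set

variable {h : ℝ} {c : Fin 2 → ℝ} {i j : Fin 2}
  {D : List (Fin 2) → (Fin 2 → ℝ) → ℝ} {f : (Fin 2 → ℝ) → ℝ} {f' : Fin 2 → (Fin 2 → ℝ) → ℝ}

/-- The one-dimensional bubble function in direction `k`. -/
noncomputable def bubble (h : ℝ) (c : Fin 2 → ℝ) (k : Fin 2) (x : Fin 2 → ℝ) : ℝ :=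
  (h ^ 2 - (x k - c k) ^ 2) / 2

theorem continuous_bubble (h : ℝ) (c : Fin 2 → ℝ) (k : Fin 2) : Continuous (bubble h c k) := by
  unfold bubble; fun_prop

theorem Continuous.integrableOn_interior_cell {F : (Fin 2 → ℝ) → ℝ} (hF : Continuous F) :
    IntegrableOn F (interior (cell h c)) :=
  (hF.continuousOn.integrableOn_compact (isCompact_cell h c)).mono_set interior_subset

theorem setIntegral_interior_cell_quadratic (hh : 0 < h) (i : Fin 2) (α β γ : ℝ) :
    ∫ x in interior (cell h c), (α + β * (x i - c i) + γ * (x i - c i) ^ 2) =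
      4 * h ^ 2 * α + 4 * h ^ 4 / 3 * γ := by
  have hc : Continuous fun x : Fin 2 → ℝ => α + β * (x i - c i) + γ * (x i - c i) ^ 2 := by
    fun_prop
  have hint : ∀ {F : ℝ → ℝ}, Continuous F → IntegrableOn F (Ioo (-h) h) := fun hF =>
    hF.integrableOn_Icc.mono_set Ioo_subset_Icc_self
  rw [setIntegral_interior_cell _ i,
    setIntegral_square (hc.integrableOn_interior_cell.comp_cellPoint i)]
  simp only [cellPoint_self, add_sub_cancel_left]
  have hin : ∫ s in Ioo (-h) h, (α + β * s + γ * s ^ 2) = 2 * h * α + γ * (2 * h ^ 3 / 3) := by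
    have i1 : IntegrableOn (fun s : ℝ => α + β * s) (Ioo (-h) h) := hint (by fun_prop)
    have i2 : IntegrableOn (fun s : ℝ => β * s) (Ioo (-h) h) := hint (by fun_prop)
    have i3 : IntegrableOn (fun s : ℝ => γ * s ^ 2) (Ioo (-h) h) := hint (by fun_prop)
    rw [integral_add i1 i3, integral_add (by simp) i2, integral_const_mul, integral_const_mul,
      setIntegral_Ioo_const hh, setIntegral_Ioo_id hh, setIntegral_Ioo_sq hh]
    ring
  rw [hin, setIntegral_Ioo_const hh]
  ring

/-- The edge integrals of f, unknown to the interpolant, also occur in `integral_bubble_mixed`. They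
cancel in the difference of the two, which is thus Morley data and equals 8h⁴ d i. -/
theorem IsCellRep.integral_bubble_third (hh : 0 < h) (hD : IsDerivFamily h c D)
    (H : IsCellRep h c D f f') (i : Fin 2) :
    ∫ x in interior (cell h c), bubble h c i x * D [i, i, i] x =
      h * (edgeIntegral h c i h (f' i) + edgeIntegral h c i (-h) (f' i)) -
        (edgeIntegral h c i h f - edgeIntegral h c i (-h) f) := by
  rw [← H.integral_linear_mul hh hD i i, ← hD.integral_bubble_mul hh i i]
  rfl

theorem IsCellRep.integral_bubble_mixed (hh : 0 < h) (hD : IsDerivFamily h c D)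
    (H : IsCellRep h c D f f') (hij : i ≠ j) :
    ∫ x in interior (cell h c), bubble h c j x * D [j, j, i] x =
      h * vertexIncrement h (fun s t => f (cellPoint c 0 (s, t))) i -
        (edgeIntegral h c i h f - edgeIntegral h c i (-h) f) := by
  have e1 : ∫ x in interior (cell h c), bubble h c j x * D [j, j, i] x =
      ∫ x in interior (cell h c), (x j - c j) * D [j, i] x := hD.integral_bubble_mul hh i j
  have e2 : ∀ s t, cellPoint c 1 (s, t) = cellPoint c 0 (t, s) := fun s t =>
    cellPoint_swap (i := 0) (j := 1) (by decide) (t, s)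
  rw [e1, H.integral_linear_mul hh hD i j, H.edgeIntegral_tangential hh hij ⟨by linarith, le_rfl⟩,
    H.edgeIntegral_tangential hh hij ⟨le_rfl, by linarith⟩]
  congr 2
  fin_cases i
  · simp [vertexIncrement]; ring
  · simp [vertexIncrement, e2]; ring

/-- The consistency term of the Morley interpolant on one element, in terms of weighted means of
third derivatives. -/
theorem IsCellRep.integral_consistency (hh : 0 < h) (hD : IsDerivFamily h c D)
    (H : IsCellRep h c D f f') {a₀ e : ℝ} {a b d : Fin 2 → ℝ}
    (hE : MorleyEquations h (fun s t => f (cellPoint c 0 (s, t)))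
      (fun i s => edgeIntegral h c i s (f' i)) a₀ e a b d) :
    ∫ x in interior (cell h c), ∑ i : Fin 2, ∑ j : Fin 2,
      (D [i, j] x - morleyHess c e b d i j x) * morleyHess c e b d i j x =
    ∑ i, 3 / (4 * h ^ 4) *
      ((∫ x in interior (cell h c), bubble h c (1 - i) x * D [1 - i, 1 - i, i] x) *
        ((∫ x in interior (cell h c), bubble h c i x * D [i, i, i] x) -
          ∫ x in interior (cell h c), bubble h c (1 - i) x * D [1 - i, 1 - i, i] x)) := by
  obtain ⟨hb, hd, ha, he, h0⟩ := (morleyEquations_iff hh).1 hE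
  have hne : h ≠ 0 := hh.ne'
  have iD : ∀ i j, IntegrableOn (D [i, j]) (interior (cell h c)) := fun i j =>
    hD.integrableOn _ (by simp)
  have hH := fun i j => continuous_morleyHess c e b d i j
  have iP : ∀ i j, IntegrableOn (fun x => D [i, j] x * morleyHess c e b d i j x)
      (interior (cell h c)) := fun i j => by
    simpa only [mul_comm] using (iD i j).mul_continuous_cell (hH i j)
  have iQ : ∀ i j, IntegrableOn (fun x => morleyHess c e b d i j x * morleyHess c e b d i j x)
      (interior (cell h c)) := fun i j => ((hH i j).mul (hH i j)).integrableOn_interior_cell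
  have iT : ∀ i j, IntegrableOn (fun x => (D [i, j] x - morleyHess c e b d i j x) *
      morleyHess c e b d i j x) (interior (cell h c)) := fun i j => by
    simp only [sub_mul]
    exact (iP i j).sub (iQ i j)
  have hT : ∀ i j, ∫ x in interior (cell h c), (D [i, j] x - morleyHess c e b d i j x) *
      morleyHess c e b d i j x =
      (∫ x in interior (cell h c), D [i, j] x * morleyHess c e b d i j x) -
      ∫ x in interior (cell h c), morleyHess c e b d i j x * morleyHess c e b d i j x := by
    intro i j
    simp only [sub_mul]
    exact integral_sub (iP i j) (iQ i j)
  have hconst : ∀ k : ℝ, ∫ x in interior (cell h c), k = 4 * h ^ 2 * k := fun k => by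
    simpa using setIntegral_interior_cell_quadratic (c := c) hh 0 k 0 0
  have e2 : ∀ s t, cellPoint c 1 (s, t) = cellPoint c 0 (t, s) := fun s t =>
    cellPoint_swap (i := 0) (j := 1) (by decide) (t, s)
  have hmix : ∀ i j, i ≠ j → ∫ x in interior (cell h c), D [i, j] x = 4 * h ^ 2 * e := by
    intro i j hij
    rw [H.integral_hessian_mixed hh hD hij.symm, he]
    field_simp
    fin_cases i <;> fin_cases j <;> first | exact absurd rfl hij | (simp [e2]; try ring)
  -- The mixed derivative of the interpolant is the constant e, which is the mean of D [i, j].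
  have hoff : ∀ i j, i ≠ j → ∫ x in interior (cell h c),
      (D [i, j] x - morleyHess c e b d i j x) * morleyHess c e b d i j x = 0 := by
    intro i j hij
    rw [hT]
    simp only [morleyHess, hij, if_false]
    rw [integral_mul_const, hmix i j hij, hconst]
    ring
  -- Let A and B be the bubble integrals of D [i, i, i] and D [j, j, i]. The mean of D [i, i] is 2 b
  -- i, its first moment is A, and 8h⁴ d i = A − B; the term is therefore 6 d i (A − 8h⁴ d i) = 6 d
  -- i B.
  have hdiag : ∀ i, ∫ x in interior (cell h c),
      (D [i, i] x - morleyHess c e b d i i x) * morleyHess c e b d i i x =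
      3 / (4 * h ^ 4) *
      ((∫ x in interior (cell h c), bubble h c (1 - i) x * D [1 - i, 1 - i, i] x) *
        ((∫ x in interior (cell h c), bubble h c i x * D [i, i, i] x) -
          ∫ x in interior (cell h c), bubble h c (1 - i) x * D [1 - i, 1 - i, i] x)) := by
    intro i
    obtain ⟨j, hij⟩ := exists_other i
    rw [one_sub_eq_of_ne hij, H.integral_bubble_mixed hh hD hij, hT]
    have hlin : ∫ x in interior (cell h c), (x i - c i) * D [i, i] x =
        ∫ x in interior (cell h c), bubble h c i x * D [i, i, i] x :=
      (hD.integral_bubble_mul hh i i).symm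
    have e3 : ∀ x, D [i, i] x * morleyHess c e b d i i x =
        2 * b i * D [i, i] x + 6 * d i * ((x i - c i) * D [i, i] x) := fun x => by
      simp only [morleyHess, if_true]; ring
    have e4 : ∀ x, morleyHess c e b d i i x * morleyHess c e b d i i x =
        (2 * b i) ^ 2 + 24 * b i * d i * (x i - c i) + 36 * d i ^ 2 * (x i - c i) ^ 2 := fun x => by
      simp only [morleyHess, if_true]; ring
    simp only [e3, e4]
    rw [setIntegral_interior_cell_quadratic hh, integral_add ((iD i i).const_mul _)
      (((iD i i).mul_continuous_cell (ρ := fun x => x i - c i) (by fun_prop)).const_mul _),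
      integral_const_mul, integral_const_mul, hlin, H.integral_hessian_diag hh hD,
      H.integral_bubble_third hh hD, hb, hd]
    field_simp
    ring
  have h01 : (0 : Fin 2) ≠ 1 := by decide
  simp only [Fin.sum_univ_two]
  have s1 : IntegrableOn (fun x => (D [0, 0] x - morleyHess c e b d 0 0 x) *
      morleyHess c e b d 0 0 x + (D [0, 1] x - morleyHess c e b d 0 1 x) *
      morleyHess c e b d 0 1 x) (interior (cell h c)) := (iT 0 0).add (iT 0 1)
  have s2 : IntegrableOn (fun x => (D [1, 0] x - morleyHess c e b d 1 0 x) *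
      morleyHess c e b d 1 0 x + (D [1, 1] x - morleyHess c e b d 1 1 x) *
      morleyHess c e b d 1 1 x) (interior (cell h c)) := (iT 1 0).add (iT 1 1)
  rw [integral_add s1 s2, integral_add (iT 0 0) (iT 0 1), integral_add (iT 1 0) (iT 1 1),
    hoff 0 1 h01, hoff 1 0 h01.symm, hdiag, hdiag]
  ring

end CellFormula

/-! ### From cells to the mesh. -/

section Mesh

open Set

variable {Ω : Set (Fin 2 → ℝ)} {h : ℝ} {T : Finset (Fin 2 → ℝ)} {w : (Fin 2 → ℝ) → ℝ}

/-- An open set allows small moves in both coordinate directions, while points of a segment differ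
by multiples of one vector. Conformity thereby yields disjoint interiors. -/
theorem not_isOpen_subset_segment {O : Set (Fin 2 → ℝ)} (hO : IsOpen O) (hne : O.Nonempty)
    (P Q : Fin 2 → ℝ) : ¬ O ⊆ segment ℝ P Q := by
  intro hsub
  obtain ⟨x, hx⟩ := hne
  have hmem : ∀ i : Fin 2, ∃ δ > 0, x + Pi.single i δ ∈ O := by
    intro i
    have hc : Continuous fun s : ℝ => x + Pi.single i s :=
      continuous_const.add (continuous_single (A := fun _ : Fin 2 => ℝ) i)
    have : ∀ᶠ s in 𝓝 (0 : ℝ), x + Pi.single i s ∈ O :=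
      hc.continuousAt.eventually (hO.mem_nhds (by simpa using hx))
    obtain ⟨δ, h1, h2⟩ := ((this.filter_mono nhdsWithin_le_nhds).and
      (self_mem_nhdsWithin : ∀ᶠ s in 𝓝[>] (0 : ℝ), s ∈ Ioi 0)).exists
    exact ⟨δ, h2, h1⟩
  have hseg : ∀ y ∈ O, ∃ t : ℝ, ∀ k, y k = P k + t * (Q k - P k) := by
    intro y hy
    have := hsub hy
    rw [segment_eq_image'] at this
    obtain ⟨t, _, rfl⟩ := this
    exact ⟨t, fun k => by simp⟩
  obtain ⟨δ, hδ, h0⟩ := hmem 0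
  obtain ⟨δ', hδ', h1⟩ := hmem 1
  obtain ⟨t, ht⟩ := hseg x hx
  obtain ⟨t₀, ht₀⟩ := hseg _ h0
  obtain ⟨t₁, ht₁⟩ := hseg _ h1
  have a0 := ht 0
  have a1 := ht 1
  have b0 := ht₀ 0
  have c0 := ht₁ 0
  have c1 := ht₁ 1
  simp at b0 c0 c1
  have e1 : (t₁ - t) * (Q 0 - P 0) = 0 := by linarith
  have e2 : (t₁ - t) * (Q 1 - P 1) = δ' := by linarith
  have e3 : (t₀ - t) * (Q 0 - P 0) = δ := by linarith
  rcases mul_eq_zero.1 e1 with h | h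
  · rw [h] at e2; linarith
  · rw [h] at e3; linarith

theorem IsUniformMesh.pairwiseDisjoint (hT : IsUniformMesh Ω h T) :
    (T : Set (Fin 2 → ℝ)).PairwiseDisjoint fun c => interior (cell h c) := by
  intro c hc c' hc' hne
  rw [Function.onFun, disjoint_iff_inter_eq_empty]
  by_contra hn
  have hn' := nonempty_iff_ne_empty.2 hn
  have hsub : interior (cell h c) ∩ interior (cell h c') ⊆ cell h c ∩ cell h c' :=
    inter_subset_inter _root_.interior_subset _root_.interior_subset
  rcases hT.conforming c hc c' hc' hne with h1 | ⟨P, _, Q, _, h1⟩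
  · rw [h1] at hsub
    exact hn (subset_empty_iff.1 hsub)
  · rw [h1] at hsub
    exact not_isOpen_subset_segment (isOpen_interior.inter isOpen_interior) hn' P Q hsub

/-- Ω lies between the union of the open cells and that of the closed cells, which differ by a null
set. -/
theorem IsUniformMesh.ae_eq (hT : IsUniformMesh Ω h T) :
    (Ω : Set (Fin 2 → ℝ)) =ᵐ[volume] ⋃ c ∈ T, interior (cell h c) := by
  have h1 : (⋃ c ∈ T, interior (cell h c) : Set (Fin 2 → ℝ)) ⊆ Ω :=
    iUnion₂_subset hT.interior_subset
  have h2 : Ω ⊆ ⋃ c ∈ T, cell h c := hT.closure_eq ▸ subset_closure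
  have h3 : (⋃ c ∈ T, interior (cell h c) : Set (Fin 2 → ℝ)) =ᵐ[volume] ⋃ c ∈ T, cell h c :=
    Filter.EventuallyEq.countable_bUnion (T.countable_toSet) fun c _ => interior_cell_ae_eq h c
  refine Filter.EventuallyLE.antisymm ?_ h1.eventuallyLE
  exact h2.eventuallyLE.trans h3.symm.le

theorem IsUniformMesh.setIntegral_eq_sum (hT : IsUniformMesh Ω h T) {F : (Fin 2 → ℝ) → ℝ}
    (hF : IntegrableOn F Ω) : ∫ x in Ω, F x = ∑ c ∈ T, ∫ x in interior (cell h c), F x := by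
  rw [setIntegral_congr_set hT.ae_eq, integral_biUnion_finset T
    (fun c _ => isOpen_interior.measurableSet) hT.pairwiseDisjoint
    fun c hc => hF.mono_set (hT.interior_subset c hc)]

theorem IsUniformMesh.volume_lt_top (hT : IsUniformMesh Ω h T) : volume Ω < ⊤ := by
  have h2 : Ω ⊆ ⋃ c ∈ T, cell h c := hT.closure_eq ▸ subset_closure
  refine (measure_mono h2).trans_lt ((measure_biUnion_finset_le T _).trans_lt ?_)
  exact ENNReal.sum_lt_top.2 fun c _ => (isCompact_cell h c).measure_lt_top

theorem IsUniformMesh.integrableOn_of_memLp (hT : IsUniformMesh Ω h T) {F : (Fin 2 → ℝ) → ℝ}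
    (hF : MemLp F 2 (volume.restrict Ω)) : IntegrableOn F Ω := by
  have : IsFiniteMeasure (volume.restrict Ω) := ⟨by simpa using hT.volume_lt_top⟩
  exact hF.integrable (by norm_num)

theorem IsUniformMesh.card_mul (hT : IsUniformMesh Ω h T) :
    (T.card : ℝ) * (4 * h ^ 2) = (volume Ω).toReal := by
  have := hT.setIntegral_eq_sum (F := fun _ => 1) (by
    rw [integrableOn_const_iff]; right; exact hT.volume_lt_top)
  simp only [integral_const, smul_eq_mul, mul_one, measureReal_restrict_apply_univ] at this
  rw [Measure.real] at this
  rw [this, Finset.sum_congr rfl fun c _ => by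
    rw [Measure.real, volume_interior_cell hT.pos c, ENNReal.toReal_ofReal (by positivity)]]
  simp

theorem IsUniformMesh.isDerivFamily (hT : IsUniformMesh Ω h T) (hw : MemSobolev 4 Ω w)
    {c : Fin 2 → ℝ} (hc : c ∈ T) : IsDerivFamily h c fun l => weakDeriv Ω l w :=
  ⟨fun l hl => (hT.integrableOn_of_memLp (hw.1 l hl)).mono_set (hT.interior_subset c hc),
    fun l i hl => (hw.2 l i hl).mono (hT.interior_subset c hc)⟩

theorem IsUniformMesh.existsUnique_interpolant (hT : IsUniformMesh Ω h T)
    (hw : MemSobolev 4 Ω w) {c : Fin 2 → ℝ} (hc : c ∈ T) :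
    ∃! p, IsMorleyInterpolant h c w p := by
  obtain ⟨f, f', H⟩ := (hT.isDerivFamily hw hc).exists_isCellRep hT.pos
  exact existsUnique_isMorleyInterpolant hT.pos H

theorem IsUniformMesh.globalInterpolant_eq (hT : IsUniformMesh Ω h T) (v : (Fin 2 → ℝ) → ℝ)
    {c : Fin 2 → ℝ} (hc : c ∈ T) {x : Fin 2 → ℝ} (hx : x ∈ interior (cell h c)) :
    globalInterpolant h T v x = MvPolynomial.eval x (localInterpolant h c v) := by
  rw [globalInterpolant, Finset.sum_eq_single_of_mem c hc, indicator_of_mem hx]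
  intro c' hc' hne
  exact indicator_of_notMem (fun hx' =>
    (hT.pairwiseDisjoint hc' hc hne).le_bot ⟨hx', hx⟩) _

/-- The sum over the mesh of products of weighted integrals of `f` and `g`. -/
noncomputable def meanForm (h : ℝ) (T : Finset (Fin 2 → ℝ)) (k l : Fin 2)
    (f g : (Fin 2 → ℝ) → ℝ) : ℝ :=
  ∑ c ∈ T, 3 / (4 * h ^ 4) * ((∫ x in interior (cell h c), bubble h c k x * f x) *
    ∫ x in interior (cell h c), bubble h c l x * g x)

/-- On an open cell the chosen weak Hessians are almost everywhere those of w on Ω and of the local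
polynomial, so `IsCellRep.integral_consistency` applies cell by cell. -/
theorem IsUniformMesh.brokenHessianInner_eq (hT : IsUniformMesh Ω h T) (hw : MemSobolev 4 Ω w) :
    brokenHessianInner h T (w - globalInterpolant h T w) (globalInterpolant h T w) =
      ∑ i : Fin 2,
        (meanForm h T (1 - i) i (weakDeriv Ω [1 - i, 1 - i, i] w) (weakDeriv Ω [i, i, i] w) -
          meanForm h T (1 - i) (1 - i) (weakDeriv Ω [1 - i, 1 - i, i] w)
            (weakDeriv Ω [1 - i, 1 - i, i] w)) := by
  have key : ∀ c ∈ T, ∫ x in interior (cell h c), ∑ i : Fin 2, ∑ j : Fin 2,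
      weakDeriv (interior (cell h c)) [i, j] (w - globalInterpolant h T w) x *
        weakDeriv (interior (cell h c)) [i, j] (globalInterpolant h T w) x =
      ∑ i, 3 / (4 * h ^ 4) *
      ((∫ x in interior (cell h c), bubble h c (1 - i) x * weakDeriv Ω [1 - i, 1 - i, i] w x) *
        ((∫ x in interior (cell h c), bubble h c i x * weakDeriv Ω [i, i, i] w x) -
          ∫ x in interior (cell h c), bubble h c (1 - i) x *
            weakDeriv Ω [1 - i, 1 - i, i] w x)) := by
    intro c hc
    have hD := hT.isDerivFamily hw hc
    obtain ⟨f, f', H⟩ := hD.exists_isCellRep hT.pos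
    have hex : ∃ p, IsMorleyInterpolant h c w p := (hT.existsUnique_interpolant hw hc).exists
    have hloc : IsMorleyInterpolant h c w (localInterpolant h c w) := by
      rw [localInterpolant, dif_pos hex]; exact hex.choose_spec
    obtain ⟨a₀, e, a, b, d, hp, hE⟩ := (isMorleyInterpolant_iff hT.pos H).1 hloc
    rw [← H.integral_consistency hT.pos hD hE]
    have hglob : (fun x => MvPolynomial.eval x (morleyPoly c a₀ e a b d))
        =ᵐ[volume.restrict (interior (cell h c))] globalInterpolant h T w := by
      filter_upwards [ae_restrict_mem isOpen_interior.measurableSet] with x hx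
      rw [hT.globalInterpolant_eq w hc hx, hp]
    have hgrad : ∀ j, HasWeakPartial (interior (cell h c)) j (globalInterpolant h T w)
        (morleyGrad c e a b d j) := fun j =>
      (hasWeakPartial_eval_morleyPoly _ c a₀ e a b d j).congr isOpen_interior hglob (ae_eq_refl _)
    have h2 : ∀ i j, weakDeriv (interior (cell h c)) [i, j] (globalInterpolant h T w)
        =ᵐ[volume.restrict (interior (cell h c))] morleyHess c e b d i j := fun i j =>
      weakDeriv_pair_ae_eq isOpen_interior (hgrad j) (hasWeakPartial_morleyGrad _ c e a b d i j)
    have h1 : ∀ i j, weakDeriv (interior (cell h c)) [i, j] (w - globalInterpolant h T w)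
        =ᵐ[volume.restrict (interior (cell h c))]
          weakDeriv Ω [i, j] w - morleyHess c e b d i j := fun i j =>
      weakDeriv_pair_ae_eq isOpen_interior ((hD.hasWeakPartial [] j (by simp)).sub (hgrad j))
        ((hD.hasWeakPartial [j] i (by simp)).sub (hasWeakPartial_morleyGrad _ c e a b d i j))
    refine integral_congr_ae ?_
    filter_upwards [h1 0 0, h1 0 1, h1 1 0, h1 1 1, h2 0 0, h2 0 1, h2 1 0, h2 1 1]
      with x e1 e2 e3 e4 e5 e6 e7 e8
    simp only [Fin.sum_univ_two, e1, e2, e3, e4, e5, e6, e7, e8, Pi.sub_apply]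
  rw [brokenHessianInner, Finset.sum_congr rfl key, Finset.sum_comm]
  refine Finset.sum_congr rfl fun i _ => ?_
  rw [meanForm, meanForm, ← Finset.sum_sub_distrib]
  refine Finset.sum_congr rfl fun c _ => ?_
  ring

end Mesh

/-! ### Asymptotics of the bilinear forms of bubble means. -/

section MeanForm

open Set

variable {Ω : Set (Fin 2 → ℝ)} {h : ℝ} {T : Finset (Fin 2 → ℝ)} {k l : Fin 2}
  {f f₁ f₂ g g₁ g₂ : (Fin 2 → ℝ) → ℝ}

theorem sq_integral_mul_le {α : Type*} [MeasurableSpace α] {μ : Measure α} {f g : α → ℝ}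
    (hf : MemLp f 2 μ) (hg : MemLp g 2 μ) :
    (∫ x, f x * g x ∂μ) ^ 2 ≤ (∫ x, f x ^ 2 ∂μ) * ∫ x, g x ^ 2 ∂μ := by
  have hfg : Integrable (fun x => f x * g x) μ := hf.integrable_mul hg
  have key : ∀ t : ℝ, 0 ≤ (∫ x, f x ^ 2 ∂μ) * (t * t) + (2 * ∫ x, f x * g x ∂μ) * t +
      ∫ x, g x ^ 2 ∂μ := by
    intro t
    have e : ∫ x, (t * f x + g x) ^ 2 ∂μ = (∫ x, f x ^ 2 ∂μ) * (t * t) +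
        (2 * ∫ x, f x * g x ∂μ) * t + ∫ x, g x ^ 2 ∂μ := by
      have e1 : ∀ x, (t * f x + g x) ^ 2 = (t * t) * f x ^ 2 + (2 * t) * (f x * g x) + g x ^ 2 :=
        fun x => by ring
      simp only [e1]
      have i1 : Integrable (fun x => (t * t) * f x ^ 2 + (2 * t) * (f x * g x)) μ :=
        (hf.integrable_sq.const_mul _).add (hfg.const_mul _)
      rw [integral_add i1 hg.integrable_sq,
        integral_add (hf.integrable_sq.const_mul _) (hfg.const_mul _), integral_const_mul,
        integral_const_mul]
      ring
    rw [← e]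
    exact integral_nonneg fun x => sq_nonneg _
  have := discrim_le_zero key
  rw [discrim] at this
  linarith

theorem abs_integral_mul_le {α : Type*} [MeasurableSpace α] {μ : Measure α} {f g : α → ℝ}
    (hf : MemLp f 2 μ) (hg : MemLp g 2 μ) :
    |∫ x, f x * g x ∂μ| ≤ √(∫ x, f x ^ 2 ∂μ) * √(∫ x, g x ^ 2 ∂μ) := by
  rw [← Real.sqrt_mul (integral_nonneg fun x => sq_nonneg _)]
  exact Real.abs_le_sqrt (sq_integral_mul_le hf hg)

theorem IsUniformMesh.memLp_cell (hT : IsUniformMesh Ω h T) (hf : MemLp f 2 (volume.restrict Ω))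
    {c : Fin 2 → ℝ} (hc : c ∈ T) : MemLp f 2 (volume.restrict (interior (cell h c))) :=
  hf.mono_measure (Measure.restrict_mono (hT.interior_subset c hc) le_rfl)

theorem bubble_nonneg_le {c x : Fin 2 → ℝ} (hx : x ∈ interior (cell h c)) (k : Fin 2) :
    0 ≤ bubble h c k x ∧ bubble h c k x ≤ h ^ 2 / 2 := by
  have := mem_interior_cell.1 hx k
  rw [bubble]
  constructor
  · nlinarith
  · nlinarith [sq_nonneg (x k - c k)]

theorem memLp_bubble (c : Fin 2 → ℝ) (k : Fin 2) :
    MemLp (bubble h c k) 2 (volume.restrict (interior (cell h c))) := by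
  have : IsFiniteMeasure (volume.restrict (interior (cell h c))) :=
    ⟨by simpa using (measure_mono interior_subset).trans_lt (isCompact_cell h c).measure_lt_top⟩
  refine MemLp.of_bound (continuous_bubble h c k).aestronglyMeasurable (h ^ 2 / 2) ?_
  filter_upwards [ae_restrict_mem isOpen_interior.measurableSet] with x hx
  rw [Real.norm_eq_abs, abs_of_nonneg (bubble_nonneg_le hx k).1]
  exact (bubble_nonneg_le hx k).2

/-- Cauchy–Schwarz with the bubble at most h²/2 on a cell of area 4h²: (h²/2)²·4h² = h⁶. -/
theorem sq_integral_bubble_mul_le (hh : 0 < h) {c : Fin 2 → ℝ}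
    (hf : MemLp f 2 (volume.restrict (interior (cell h c)))) :
    (∫ x in interior (cell h c), bubble h c k x * f x) ^ 2 ≤
      h ^ 6 * ∫ x in interior (cell h c), f x ^ 2 := by
  refine (sq_integral_mul_le (memLp_bubble c k) hf).trans ?_
  refine mul_le_mul_of_nonneg_right ?_ (integral_nonneg fun x => sq_nonneg _)
  have hc : ∫ x in interior (cell h c), (h ^ 2 / 2) ^ 2 = h ^ 6 := by
    have := setIntegral_interior_cell_quadratic (c := c) hh 0 ((h ^ 2 / 2) ^ 2) 0 0
    simp only [zero_mul, add_zero, mul_zero] at this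
    rw [this]; ring
  rw [← hc]
  refine setIntegral_mono_on (memLp_bubble c k).integrable_sq
    continuous_const.integrableOn_interior_cell isOpen_interior.measurableSet fun x hx => ?_
  obtain ⟨h1, h2⟩ := bubble_nonneg_le hx k
  gcongr

/-- Cauchy–Schwarz over the cells, with constant 3/(4h⁴)·h⁶ ≤ h². This L² bound, uniform in the
mesh, is what the density argument needs. -/
theorem IsUniformMesh.abs_meanForm_le (hT : IsUniformMesh Ω h T)
    (hf : MemLp f 2 (volume.restrict Ω)) (hg : MemLp g 2 (volume.restrict Ω)) :
    |meanForm h T k l f g| ≤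
      h ^ 2 * (√(∫ x in Ω, f x ^ 2) * √(∫ x in Ω, g x ^ 2)) := by
  have hh := hT.pos
  have hF : 0 ≤ ∫ x in Ω, f x ^ 2 := integral_nonneg fun x => sq_nonneg _
  have hG : 0 ≤ ∫ x in Ω, g x ^ 2 := integral_nonneg fun x => sq_nonneg _
  have key : ∀ (k : Fin 2) {f : (Fin 2 → ℝ) → ℝ}, MemLp f 2 (volume.restrict Ω) →
      ∑ c ∈ T, (∫ x in interior (cell h c), bubble h c k x * f x) ^ 2 ≤
        h ^ 6 * ∫ x in Ω, f x ^ 2 := by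
    intro k f hf
    rw [hT.setIntegral_eq_sum hf.integrable_sq, Finset.mul_sum]
    exact Finset.sum_le_sum fun c hc => sq_integral_bubble_mul_le hh (hT.memLp_cell hf hc)
  have h1 := (Finset.sum_mul_sq_le_sq_mul_sq T
    (fun c => ∫ x in interior (cell h c), bubble h c k x * f x)
    (fun c => ∫ x in interior (cell h c), bubble h c l x * g x)).trans
    (mul_le_mul (key k hf) (key l hg) (Finset.sum_nonneg fun c _ => sq_nonneg _) (by positivity))
  have h2 := Real.abs_le_sqrt h1
  rw [meanForm, ← Finset.mul_sum, abs_mul, abs_of_pos (by positivity)]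
  have e : √(h ^ 6 * (∫ x in Ω, f x ^ 2) * (h ^ 6 * ∫ x in Ω, g x ^ 2)) =
      h ^ 6 * (√(∫ x in Ω, f x ^ 2) * √(∫ x in Ω, g x ^ 2)) := by
    rw [← Real.sqrt_mul hF, ← Real.sqrt_sq (by positivity : 0 ≤ h ^ 6),
      ← Real.sqrt_mul (by positivity)]
    congr 1
    rw [Real.sqrt_sq (by positivity)]
    ring
  rw [e] at h2
  have h3 : 0 ≤ h ^ 2 * (√(∫ x in Ω, f x ^ 2) * √(∫ x in Ω, g x ^ 2)) := by positivity
  calc _ ≤ 3 / (4 * h ^ 4) * (h ^ 6 * (√(∫ x in Ω, f x ^ 2) * √(∫ x in Ω, g x ^ 2))) := by gcongr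
    _ = 3 / 4 * (h ^ 2 * (√(∫ x in Ω, f x ^ 2) * √(∫ x in Ω, g x ^ 2))) := by field_simp
    _ ≤ _ := by linarith

theorem IsUniformMesh.integral_bubble_sub (hT : IsUniformMesh Ω h T)
    (hf₁ : MemLp f₁ 2 (volume.restrict Ω)) (hf₂ : MemLp f₂ 2 (volume.restrict Ω))
    {c : Fin 2 → ℝ} (hc : c ∈ T) :
    ∫ x in interior (cell h c), bubble h c k x * (f₁ x - f₂ x) =
      (∫ x in interior (cell h c), bubble h c k x * f₁ x) -
        ∫ x in interior (cell h c), bubble h c k x * f₂ x := by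
  simp only [mul_sub]
  exact integral_sub ((memLp_bubble c k).integrable_mul (hT.memLp_cell hf₁ hc))
    ((memLp_bubble c k).integrable_mul (hT.memLp_cell hf₂ hc))

theorem IsUniformMesh.meanForm_sub_left (hT : IsUniformMesh Ω h T)
    (hf₁ : MemLp f₁ 2 (volume.restrict Ω)) (hf₂ : MemLp f₂ 2 (volume.restrict Ω)) :
    meanForm h T k l (fun x => f₁ x - f₂ x) g = meanForm h T k l f₁ g - meanForm h T k l f₂ g := by
  rw [meanForm, meanForm, meanForm, ← Finset.sum_sub_distrib]
  refine Finset.sum_congr rfl fun c hc => ?_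
  rw [hT.integral_bubble_sub hf₁ hf₂ hc]
  ring

theorem IsUniformMesh.meanForm_sub_right (hT : IsUniformMesh Ω h T)
    (hg₁ : MemLp g₁ 2 (volume.restrict Ω)) (hg₂ : MemLp g₂ 2 (volume.restrict Ω)) :
    meanForm h T k l f (fun x => g₁ x - g₂ x) = meanForm h T k l f g₁ - meanForm h T k l f g₂ := by
  rw [meanForm, meanForm, meanForm, ← Finset.sum_sub_distrib]
  refine Finset.sum_congr rfl fun c hc => ?_
  rw [hT.integral_bubble_sub hg₁ hg₂ hc]
  ring

theorem integral_bubble (hh : 0 < h) (c : Fin 2 → ℝ) (k : Fin 2) :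
    ∫ x in interior (cell h c), bubble h c k x = 4 / 3 * h ^ 4 := by
  have := setIntegral_interior_cell_quadratic (c := c) hh k (h ^ 2 / 2) 0 (-1 / 2)
  rw [← sub_eq_zero] at this ⊢
  rw [← this]
  have e : ∀ x, bubble h c k x = h ^ 2 / 2 + 0 * (x k - c k) + -1 / 2 * (x k - c k) ^ 2 :=
    fun x => by rw [bubble]; ring
  simp only [e]
  ring

/-- For constants the two terms agree, since 3/(4h⁴)·(4h⁴/3)² = (h²/3)·4h² = 4h⁴/3. Oscillation τ ≤
1 perturbs a product of values by at most 2Mτ + τ² ≤ τ(2M + 1) in each of the two terms, and 2·4h⁴/3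
≤ 4h⁴. -/
theorem abs_meanForm_cell_sub_le (hh : 0 < h) {c : Fin 2 → ℝ} {φ γ : (Fin 2 → ℝ) → ℝ} {τ M : ℝ}
    (hφ : Continuous φ) (hγ : Continuous γ) (hτ : 0 ≤ τ) (hτ1 : τ ≤ 1)
    (hφτ : ∀ x ∈ interior (cell h c), |φ x - φ c| ≤ τ)
    (hγτ : ∀ x ∈ interior (cell h c), |γ x - γ c| ≤ τ) (hφM : |φ c| ≤ M) (hγM : |γ c| ≤ M) :
    |3 / (4 * h ^ 4) * ((∫ x in interior (cell h c), bubble h c k x * φ x) *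
      ∫ x in interior (cell h c), bubble h c l x * γ x) -
      h ^ 2 / 3 * ∫ x in interior (cell h c), φ x * γ x| ≤
        h ^ 2 * (4 * h ^ 2) * (τ * (2 * M + 1)) := by
  set Q := interior (cell h c) with hQ
  have hM : 0 ≤ M := (abs_nonneg _).trans hφM
  have hmean : ∀ (k : Fin 2) {φ : (Fin 2 → ℝ) → ℝ}, Continuous φ →
      (∀ x ∈ Q, |φ x - φ c| ≤ τ) →
      |(∫ x in Q, bubble h c k x * φ x) - 4 / 3 * h ^ 4 * φ c| ≤ 4 / 3 * h ^ 4 * τ := by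
    intro k φ hφ hφτ
    have hb := continuous_bubble h c k
    have i1 : IntegrableOn (fun x => bubble h c k x * φ x) Q :=
      (hb.mul hφ).integrableOn_interior_cell
    have i2 : IntegrableOn (fun x => bubble h c k x * φ c) Q :=
      (hb.mul continuous_const).integrableOn_interior_cell
    rw [← integral_bubble hh c k, ← integral_mul_const, ← integral_sub i1 i2,
      ← integral_mul_const, ← Real.norm_eq_abs]
    refine norm_integral_le_of_norm_le (hb.mul continuous_const).integrableOn_interior_cell ?_
    filter_upwards [ae_restrict_mem isOpen_interior.measurableSet] with x hx
    rw [← mul_sub, norm_mul, Real.norm_eq_abs, Real.norm_eq_abs,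
      abs_of_nonneg (bubble_nonneg_le hx k).1]
    exact mul_le_mul_of_nonneg_left (hφτ x hx) (bubble_nonneg_le hx k).1
  have hprod : |(∫ x in Q, φ x * γ x) - 4 * h ^ 2 * (φ c * γ c)| ≤
      4 * h ^ 2 * (τ * (2 * M + 1)) := by
    have hconst : ∀ r : ℝ, ∫ x in Q, r = 4 * h ^ 2 * r := fun r => by
      simpa using setIntegral_interior_cell_quadratic (c := c) hh 0 r 0 0
    have i1 : IntegrableOn (fun x => φ x * γ x) Q := (hφ.mul hγ).integrableOn_interior_cell
    have i2 : IntegrableOn (fun _ => φ c * γ c) Q := continuous_const.integrableOn_interior_cell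
    rw [← hconst, ← hconst, ← integral_sub i1 i2, ← Real.norm_eq_abs]
    refine norm_integral_le_of_norm_le continuous_const.integrableOn_interior_cell ?_
    filter_upwards [ae_restrict_mem isOpen_interior.measurableSet] with x hx
    have e : φ x * γ x - φ c * γ c = (φ x - φ c) * γ c + φ c * (γ x - γ c) +
        (φ x - φ c) * (γ x - γ c) := by ring
    rw [e, Real.norm_eq_abs]
    refine (abs_add_three _ _ _).trans ?_
    rw [abs_mul, abs_mul, abs_mul]
    have h1 := mul_le_mul (hφτ x hx) hγM (abs_nonneg _) hτ
    have h2 := mul_le_mul hφM (hγτ x hx) (abs_nonneg _) hM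
    have h3 := mul_le_mul (hφτ x hx) ((hγτ x hx).trans hτ1) (abs_nonneg _) hτ
    linarith
  have hA := hmean k hφ hφτ
  have hB := hmean l hγ hγτ
  set A := ∫ x in Q, bubble h c k x * φ x
  set B := ∫ x in Q, bubble h c l x * γ x
  set P := ∫ x in Q, φ x * γ x
  have hβ : 0 < 4 / 3 * h ^ 4 := by positivity
  obtain ⟨β, hβe⟩ : ∃ β, β = 4 / 3 * h ^ 4 := ⟨_, rfl⟩
  rw [← hβe] at hA hB hβ
  have hAB : |A * B - β ^ 2 * (φ c * γ c)| ≤ β ^ 2 * (τ * (2 * M + 1)) := by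
    have e : A * B - β ^ 2 * (φ c * γ c) = (A - β * φ c) * (β * γ c) +
        (β * φ c) * (B - β * γ c) + (A - β * φ c) * (B - β * γ c) := by ring
    rw [e]
    refine (abs_add_three _ _ _).trans ?_
    have p1 : |(A - β * φ c) * (β * γ c)| = |A - β * φ c| * (β * |γ c|) := by
      rw [abs_mul, abs_mul, abs_of_pos hβ]
    have p2 : |β * φ c * (B - β * γ c)| = β * |φ c| * |B - β * γ c| := by
      rw [abs_mul, abs_mul, abs_of_pos hβ]
    have p3 := abs_mul (A - β * φ c) (B - β * γ c)
    rw [p1, p2, p3]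
    have h1 := mul_le_mul hA (mul_le_mul_of_nonneg_left hγM hβ.le) (by positivity) (by positivity)
    have h2 := mul_le_mul (mul_le_mul_of_nonneg_left hφM hβ.le) hB (by positivity) (by positivity)
    have h3 := mul_le_mul hA (hB.trans (mul_le_mul_of_nonneg_left hτ1 hβ.le)) (by positivity)
      (by positivity)
    linear_combination h1 + h2 + h3
  have e : 3 / (4 * h ^ 4) * (A * B) - h ^ 2 / 3 * P =
      3 / (4 * h ^ 4) * (A * B - β ^ 2 * (φ c * γ c)) -
        h ^ 2 / 3 * (P - 4 * h ^ 2 * (φ c * γ c)) := by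
    rw [hβe]; field_simp; ring
  rw [e]
  refine (abs_sub _ _).trans ?_
  rw [abs_mul, abs_mul, abs_of_pos (by positivity : 0 < 3 / (4 * h ^ 4)),
    abs_of_pos (by positivity : 0 < h ^ 2 / 3)]
  calc _ ≤ 3 / (4 * h ^ 4) * (β ^ 2 * (τ * (2 * M + 1))) +
        h ^ 2 / 3 * (4 * h ^ 2 * (τ * (2 * M + 1))) := by gcongr
    _ = 8 / 12 * (h ^ 2 * (4 * h ^ 2) * (τ * (2 * M + 1))) := by
        rw [hβe]; field_simp; ring
    _ ≤ _ := by
        have : 0 ≤ h ^ 2 * (4 * h ^ 2) * (τ * (2 * M + 1)) := by positivity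
        linarith

theorem exists_continuous_approx (hΩ : MeasurableSet Ω) (hf : MemLp f 2 (volume.restrict Ω))
    {ε : ℝ} (hε : 0 < ε) :
    ∃ φ : (Fin 2 → ℝ) → ℝ, Continuous φ ∧ HasCompactSupport φ ∧
      √(∫ x in Ω, (f x - φ x) ^ 2) ≤ ε := by
  have hf' : MemLp (Ω.indicator f) (ENNReal.ofReal 2) volume := by
    rw [memLp_indicator_iff_restrict hΩ]; simpa using hf
  obtain ⟨φ, h1, h2, h3, h4⟩ := hf'.exists_hasCompactSupport_integral_rpow_sub_le
    (by norm_num) (ε := ε ^ 2) (by positivity)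
  refine ⟨φ, h3, h1, ?_⟩
  rw [Real.sqrt_le_left hε.le]
  refine le_trans ?_ h2
  have e : ∫ x in Ω, (f x - φ x) ^ 2 = ∫ x in Ω, ‖Ω.indicator f x - φ x‖ ^ (2 : ℝ) := by
    refine setIntegral_congr_fun hΩ fun x hx => ?_
    simp [indicator_of_mem hx]
  rw [e]
  refine setIntegral_le_integral ?_ (ae_of_all _ fun x => by positivity)
  have := (hf'.sub h4).integrable_norm_rpow (by norm_num) (by simp)
  simpa using this

/-- On uniform meshes the mean form tends to a multiple of the inner product of `L²(Ω)`. -/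
theorem exists_meanForm_close (hΩ : MeasurableSet Ω) (hf : MemLp f 2 (volume.restrict Ω))
    (hg : MemLp g 2 (volume.restrict Ω)) (k l : Fin 2) {ε : ℝ} (hε : 0 < ε) :
    ∃ δ > 0, ∀ h T, IsUniformMesh Ω h T → h < δ →
      |meanForm h T k l f g - h ^ 2 / 3 * ∫ x in Ω, f x * g x| ≤ ε * h ^ 2 := by
  set F := √(∫ x in Ω, f x ^ 2)
  set G := √(∫ x in Ω, g x ^ 2)
  have hF : 0 ≤ F := Real.sqrt_nonneg _
  have hG : 0 ≤ G := Real.sqrt_nonneg _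
  -- η is the L² error allowed in replacing f and g by continuous functions. The factor 2 covers the
  -- weights 1 of the mean form and 1/3 of the integral.
  obtain ⟨η, hη, hηε⟩ : ∃ η > 0, 2 * (η * G + η * F + η * η) ≤ ε / 2 := by
    refine ⟨min 1 (ε / (4 * (F + G + 1))), lt_min one_pos (by positivity), ?_⟩
    set η := min 1 (ε / (4 * (F + G + 1)))
    have h1 : η ≤ 1 := min_le_left _ _
    have h2 : η * (4 * (F + G + 1)) ≤ ε := by
      rw [← le_div_iff₀ (by positivity)]; exact min_le_right _ _
    have h0 : 0 ≤ η := le_min zero_le_one (by positivity)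
    nlinarith
  obtain ⟨φ, hφ, hφc, hφf⟩ := exists_continuous_approx hΩ hf hη
  obtain ⟨γ, hγ, hγc, hγg⟩ := exists_continuous_approx hΩ hg hη
  obtain ⟨Mφ, hMφ⟩ := hφc.exists_bound_of_continuous hφ
  obtain ⟨Mγ, hMγ⟩ := hγc.exists_bound_of_continuous hγ
  set M := max Mφ Mγ
  have hM0 : 0 ≤ M := ((norm_nonneg _).trans (hMφ 0)).trans (le_max_left _ _)
  set v := (volume Ω).toReal
  have hv : 0 ≤ v := ENNReal.toReal_nonneg
  -- τ is the oscillation allowed on a cell; the cell errors add up through the total area v.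
  obtain ⟨τ, hτ, hτ1, hτε⟩ : ∃ τ > 0, τ ≤ 1 ∧ v * (τ * (2 * M + 1)) ≤ ε / 2 := by
    refine ⟨min 1 (ε / (2 * (v * (2 * M + 1) + 1))), lt_min one_pos (by positivity),
      min_le_left _ _, ?_⟩
    set τ := min 1 (ε / (2 * (v * (2 * M + 1) + 1)))
    have h2 : τ * (2 * (v * (2 * M + 1) + 1)) ≤ ε := by
      rw [← le_div_iff₀ (by positivity)]; exact min_le_right _ _
    have h0 : 0 ≤ τ := le_min zero_le_one (by positivity)
    nlinarith
  obtain ⟨δ₁, hδ₁, H₁⟩ := Metric.uniformContinuous_iff.1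
    (hφc.uniformContinuous_of_continuous hφ) τ hτ
  obtain ⟨δ₂, hδ₂, H₂⟩ := Metric.uniformContinuous_iff.1
    (hγc.uniformContinuous_of_continuous hγ) τ hτ
  refine ⟨min δ₁ δ₂, lt_min hδ₁ hδ₂, fun h T hT hh => ?_⟩
  have hh0 := hT.pos
  have hfin : IsFiniteMeasure (volume.restrict Ω) := ⟨by simpa using hT.volume_lt_top⟩
  have hφL : MemLp φ 2 (volume.restrict Ω) :=
    MemLp.of_bound hφ.aestronglyMeasurable Mφ (ae_of_all _ hMφ)
  have hγL : MemLp γ 2 (volume.restrict Ω) :=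
    MemLp.of_bound hγ.aestronglyMeasurable Mγ (ae_of_all _ hMγ)
  have hdist : ∀ c, ∀ x ∈ interior (cell h c), dist x c < min δ₁ δ₂ := by
    intro c x hx
    refine lt_of_le_of_lt ((dist_pi_le_iff hh0.le).2 fun i => ?_) hh
    rw [Real.dist_eq, abs_le]
    have := mem_interior_cell.1 hx i
    constructor <;> linarith
  have hsmooth : |meanForm h T k l φ γ - h ^ 2 / 3 * ∫ x in Ω, φ x * γ x| ≤ ε / 2 * h ^ 2 := by
    have hi : IntegrableOn (fun x => φ x * γ x) Ω := hφL.integrable_mul hγL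
    rw [hT.setIntegral_eq_sum hi, meanForm, Finset.mul_sum,
      ← Finset.sum_sub_distrib]
    refine (Finset.abs_sum_le_sum_abs _ _).trans ?_
    refine (Finset.sum_le_sum fun c _ => abs_meanForm_cell_sub_le hh0 hφ hγ hτ.le hτ1
      (fun x hx => (H₁ ((hdist c x hx).trans_le (min_le_left _ _))).le)
      (fun x hx => (H₂ ((hdist c x hx).trans_le (min_le_right _ _))).le)
      ((hMφ c).trans (le_max_left _ _)) ((hMγ c).trans (le_max_right _ _))).trans ?_
    rw [Finset.sum_const, nsmul_eq_mul]
    have := hT.card_mul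
    calc _ = h ^ 2 * (((T.card : ℝ) * (4 * h ^ 2)) * (τ * (2 * M + 1))) := by ring
      _ = h ^ 2 * (v * (τ * (2 * M + 1))) := by rw [this]
      _ ≤ h ^ 2 * (ε / 2) := by gcongr
      _ = _ := by ring
  have hfφ : MemLp (fun x => f x - φ x) 2 (volume.restrict Ω) := hf.sub hφL
  have hgγ : MemLp (fun x => g x - γ x) 2 (volume.restrict Ω) := hg.sub hγL
  -- This splitting involves only f, g and the errors f − φ, g − γ, so no norms of φ and γ are
  -- needed.
  have hdiff : meanForm h T k l f g - meanForm h T k l φ γ =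
      meanForm h T k l (fun x => f x - φ x) g + meanForm h T k l f (fun x => g x - γ x) -
        meanForm h T k l (fun x => f x - φ x) (fun x => g x - γ x) := by
    rw [hT.meanForm_sub_left hf hφL, hT.meanForm_sub_left hf hφL, hT.meanForm_sub_right hg hγL,
      hT.meanForm_sub_right hg hγL]
    ring
  have hdiff' : (∫ x in Ω, f x * g x) - ∫ x in Ω, φ x * γ x =
      (∫ x in Ω, (f x - φ x) * g x) + (∫ x in Ω, f x * (g x - γ x)) -
        ∫ x in Ω, (f x - φ x) * (g x - γ x) := by
    have i1 : Integrable (fun x => (f x - φ x) * g x) (volume.restrict Ω) := hfφ.integrable_mul hg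
    have i2 : Integrable (fun x => f x * (g x - γ x)) (volume.restrict Ω) := hf.integrable_mul hgγ
    have i3 : Integrable (fun x => (f x - φ x) * (g x - γ x)) (volume.restrict Ω) :=
      hfφ.integrable_mul hgγ
    have i4 : Integrable (fun x => (f x - φ x) * g x + f x * (g x - γ x)) (volume.restrict Ω) :=
      i1.add i2
    have i5 : Integrable (fun x => f x * g x) (volume.restrict Ω) := hf.integrable_mul hg
    have i6 : Integrable (fun x => φ x * γ x) (volume.restrict Ω) := hφL.integrable_mul hγL
    rw [← integral_add i1 i2, ← integral_sub i4 i3, ← integral_sub i5 i6]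
    congr 1; ext x; ring
  have b1 := hT.abs_meanForm_le (k := k) (l := l) hfφ hg
  have b2 := hT.abs_meanForm_le (k := k) (l := l) hf hgγ
  have b3 := hT.abs_meanForm_le (k := k) (l := l) hfφ hgγ
  have b1' := abs_integral_mul_le hfφ hg
  have b2' := abs_integral_mul_le hf hgγ
  have b3' := abs_integral_mul_le hfφ hgγ
  have c1 : √(∫ x in Ω, (f x - φ x) ^ 2) * √(∫ x in Ω, g x ^ 2) ≤ η * G := by gcongr
  have c2 : √(∫ x in Ω, f x ^ 2) * √(∫ x in Ω, (g x - γ x) ^ 2) ≤ η * F := by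
    rw [mul_comm]; gcongr
  have c3 : √(∫ x in Ω, (f x - φ x) ^ 2) * √(∫ x in Ω, (g x - γ x) ^ 2) ≤ η * η := by gcongr
  have hB : |meanForm h T k l f g - meanForm h T k l φ γ| ≤ h ^ 2 * (η * G + η * F + η * η) := by
    rw [hdiff]
    refine (abs_sub _ _).trans ((add_le_add_left (abs_add_le _ _) _).trans ?_)
    have hh2 : 0 ≤ h ^ 2 := by positivity
    nlinarith [mul_le_mul_of_nonneg_left c1 hh2, mul_le_mul_of_nonneg_left c2 hh2,
      mul_le_mul_of_nonneg_left c3 hh2]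
  have hI : |(∫ x in Ω, f x * g x) - ∫ x in Ω, φ x * γ x| ≤ η * G + η * F + η * η := by
    rw [hdiff']
    refine (abs_sub _ _).trans ((add_le_add_left (abs_add_le _ _) _).trans ?_)
    linarith
  have e : meanForm h T k l f g - h ^ 2 / 3 * ∫ x in Ω, f x * g x =
      (meanForm h T k l f g - meanForm h T k l φ γ) +
      (meanForm h T k l φ γ - h ^ 2 / 3 * ∫ x in Ω, φ x * γ x) +
      -(h ^ 2 / 3 * ((∫ x in Ω, f x * g x) - ∫ x in Ω, φ x * γ x)) := by ring
  rw [e]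
  refine (abs_add_three _ _ _).trans ?_
  rw [abs_neg, abs_mul, abs_of_nonneg (by positivity : 0 ≤ h ^ 2 / 3)]
  have hh2 : 0 ≤ h ^ 2 := by positivity
  have d1 := mul_le_mul_of_nonneg_left hI (by positivity : 0 ≤ h ^ 2 / 3)
  have d2 := mul_le_mul_of_nonneg_left hηε hh2
  have d3 : 0 ≤ h ^ 2 * (η * G + η * F + η * η) := by positivity
  linarith

end MeanForm

/-! ### Integration by parts across the mesh, without traces. -/

section Gradient

open Set

variable {U Ω : Set (Fin 2 → ℝ)} {h : ℝ} {T : Finset (Fin 2 → ℝ)} {c : Fin 2 → ℝ} {i j : Fin 2}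
  {u v g w : (Fin 2 → ℝ) → ℝ}

theorem HasWeakPartial.smooth_mul (hu : HasWeakPartial U i u g) {η : (Fin 2 → ℝ) → ℝ}
    (hη : ContDiff ℝ ∞ η) (hU : IsOpen U) :
    HasWeakPartial U i (fun x => η x * u x)
      (fun x => fderiv ℝ η x (Pi.single i 1) * u x + η x * g x) := by
  have hη' : ContDiff ℝ ∞ fun x => fderiv ℝ η x (Pi.single i 1) :=
    (hη.fderiv_right (m := ∞) (by simp)).clm_apply contDiff_const
  have hl : ∀ {ρ f : (Fin 2 → ℝ) → ℝ}, Continuous ρ → LocallyIntegrableOn f U →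
      LocallyIntegrableOn (fun x => ρ x * f x) U := by
    intro ρ f hρ hf
    exact hf.continuousOn_mul hρ.continuousOn hU.isLocallyClosed
  refine ⟨hl hη.continuous hu.1, (hl hη'.continuous hu.1).add (hl hη.continuous hu.2.1),
    fun φ hφ => ?_⟩
  have h1 := hu.2.2 _ (hφ.smooth_mul hη)
  have e : ∀ x, fderiv ℝ (fun x => η x * φ x) x (Pi.single i 1) =
      η x * fderiv ℝ φ x (Pi.single i 1) + φ x * fderiv ℝ η x (Pi.single i 1) := by
    intro x
    rw [fderiv_fun_mul (hη.differentiable (by simp) x) (hφ.1.differentiable (by simp) x)]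
    simp
  have i1 : IntegrableOn (fun x => u x * (η x * fderiv ℝ φ x (Pi.single i 1))) U :=
    hu.1.integrable_mul_test ((hφ.partial _).smooth_mul hη)
  have i2 : IntegrableOn (fun x => u x * (fderiv ℝ η x (Pi.single i 1) * φ x)) U :=
    hu.1.integrable_mul_test (hφ.smooth_mul hη')
  have i3 : IntegrableOn (fun x => g x * (η x * φ x)) U :=
    hu.2.1.integrable_mul_test (hφ.smooth_mul hη)
  have e1 : ∫ x in U, u x * fderiv ℝ (fun x => η x * φ x) x (Pi.single i 1) =
      (∫ x in U, u x * (η x * fderiv ℝ φ x (Pi.single i 1))) +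
        ∫ x in U, u x * (fderiv ℝ η x (Pi.single i 1) * φ x) := by
    rw [← integral_add i1 i2]
    congr 1; ext x; rw [e]; ring
  have e2 : ∫ x in U, (fderiv ℝ η x (Pi.single i 1) * u x + η x * g x) * φ x =
      (∫ x in U, u x * (fderiv ℝ η x (Pi.single i 1) * φ x)) + ∫ x in U, g x * (η x * φ x) := by
    rw [← integral_add i2 i3]
    congr 1; ext x; ring
  have e3 : ∫ x in U, η x * u x * fderiv ℝ φ x (Pi.single i 1) =
      ∫ x in U, u x * (η x * fderiv ℝ φ x (Pi.single i 1)) := by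
    congr 1; ext x; ring
  rw [e2, e3]
  linarith

/-- `u ∈ L²(U)` has the weak gradient `G`, with components in `L²(U)`. -/
structure HasL2Gradient (U : Set (Fin 2 → ℝ)) (u : (Fin 2 → ℝ) → ℝ)
    (G : Fin 2 → (Fin 2 → ℝ) → ℝ) : Prop where
  memLp : MemLp u 2 (volume.restrict U)
  memLp_grad : ∀ i, MemLp (G i) 2 (volume.restrict U)
  hasWeakPartial : ∀ i, HasWeakPartial U i u (G i)

theorem HasL2Gradient.mono {G : Fin 2 → (Fin 2 → ℝ) → ℝ} {V : Set (Fin 2 → ℝ)}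
    (hu : HasL2Gradient V u G) (hUV : U ⊆ V) : HasL2Gradient U u G :=
  ⟨hu.memLp.mono_measure (Measure.restrict_mono hUV le_rfl),
    fun i => (hu.memLp_grad i).mono_measure (Measure.restrict_mono hUV le_rfl),
    fun i => (hu.hasWeakPartial i).mono hUV⟩

theorem MemSobolev.hasL2Gradient {m : ℕ} (hw : MemSobolev m U w) {l : List (Fin 2)}
    (hl : l.length < m) : HasL2Gradient U (weakDeriv U l w) (fun i => weakDeriv U (i :: l) w) :=
  ⟨hw.1 l hl.le, fun i => hw.1 (i :: l) hl, fun i => hw.2 l i hl⟩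

theorem IsUniformMesh.memLp_mul_continuous (hT : IsUniformMesh Ω h T) (hΩ : MeasurableSet Ω)
    {ρ f : (Fin 2 → ℝ) → ℝ}
    (hρ : Continuous ρ) (hf : MemLp f 2 (volume.restrict Ω)) :
    MemLp (fun x => ρ x * f x) 2 (volume.restrict Ω) := by
  have hK : IsCompact (⋃ c ∈ T, cell h c) := T.isCompact_biUnion fun c _ => isCompact_cell h c
  obtain ⟨C, hC⟩ := hK.exists_bound_of_continuousOn hρ.continuousOn
  refine MemLp.of_le_mul (c := C) hf (hρ.aestronglyMeasurable.mul hf.1) ?_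
  filter_upwards [ae_restrict_mem hΩ] with x hx
  rw [norm_mul]
  exact mul_le_mul_of_nonneg_right (hC x (hT.closure_eq ▸ subset_closure hx)) (norm_nonneg _)

theorem IsUniformMesh.hasL2Gradient_smooth_mul (hT : IsUniformMesh Ω h T) (hΩ : IsOpen Ω)
    {η : (Fin 2 → ℝ) → ℝ} (hη : ContDiff ℝ ∞ η) {G : Fin 2 → (Fin 2 → ℝ) → ℝ}
    (hu : HasL2Gradient Ω u G) : HasL2Gradient Ω (fun x => η x * u x)
      (fun i x => fderiv ℝ η x (Pi.single i 1) * u x + η x * G i x) := by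
  have hη' : ∀ i : Fin 2, ContDiff ℝ ∞ fun x => fderiv ℝ η x (Pi.single i 1) := fun i =>
    (hη.fderiv_right (m := ∞) (by simp)).clm_apply contDiff_const
  exact ⟨hT.memLp_mul_continuous hΩ.measurableSet hη.continuous hu.memLp,
    fun i => (hT.memLp_mul_continuous hΩ.measurableSet (hη' i).continuous hu.memLp).add
      (hT.memLp_mul_continuous hΩ.measurableSet hη.continuous (hu.memLp_grad i)),
    fun i => (hu.hasWeakPartial i).smooth_mul hη hΩ⟩

theorem integral_cell_parts (hh : 0 < h) {F G : Fin 2 → (Fin 2 → ℝ) → ℝ}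
    (hu : HasL2Gradient (interior (cell h c)) u F) (hv : HasL2Gradient (interior (cell h c)) v G)
    (i : Fin 2) {ρ ρ' : ℝ → ℝ} (hρ : ∀ s, HasDerivAt ρ (ρ' s) s) (hρ' : Continuous ρ')
    (h1 : ρ (c i + h) = 0) (h2 : ρ (c i - h) = 0) :
    ∫ x in interior (cell h c),
      (ρ' (x i) * (u x * v x) + ρ (x i) * (F i x * v x + u x * G i x)) = 0 := by
  have hfin : IsFiniteMeasure (volume.restrict (interior (cell h c))) :=
    ⟨by simpa using (measure_mono interior_subset).trans_lt (isCompact_cell h c).measure_lt_top⟩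
  have hint : ∀ {f : (Fin 2 → ℝ) → ℝ}, MemLp f 2 (volume.restrict (interior (cell h c))) →
      IntegrableOn f (interior (cell h c)) := fun hf => hf.integrable (by norm_num)
  have hρc : Continuous ρ := continuous_iff_continuousAt.2 fun s => (hρ s).continuousAt
  have iuv : IntegrableOn (fun x => u x * v x) (interior (cell h c)) :=
    hu.memLp.integrable_mul hv.memLp
  have iG : IntegrableOn (fun x => F i x * v x + u x * G i x) (interior (cell h c)) :=
    ((hu.memLp_grad i).integrable_mul hv.memLp).add (hu.memLp.integrable_mul (hv.memLp_grad i))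
  have i1 : IntegrableOn (fun x => ρ' (x i) * (u x * v x) +
      ρ (x i) * (F i x * v x + u x * G i x)) (interior (cell h c)) :=
    (iuv.mul_continuous_cell (ρ := fun x => ρ' (x i)) (by fun_prop)).add
      (iG.mul_continuous_cell (ρ := fun x => ρ (x i)) (by fun_prop))
  rw [setIntegral_interior_cell _ i, setIntegral_square (i1.comp_cellPoint i)]
  rw [← integral_zero ℝ ℝ (μ := volume.restrict (Ioo (-h) h))]
  refine integral_congr_ae ?_
  filter_upwards [(hu.hasWeakPartial i).ae_exists_hasACDeriv hh (hint hu.memLp)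
    (hint (hu.memLp_grad i)), (hv.hasWeakPartial i).ae_exists_hasACDeriv hh (hint hv.memLp)
    (hint (hv.memLp_grad i))] with t ⟨W, hW, eW⟩ ⟨Z, hZ, eZ⟩
  have hr : HasACDeriv h (fun s => ρ (c i + s)) (fun s => ρ' (c i + s)) :=
    HasACDeriv.of_hasDerivAt (fun s => (hρ (c i + s)).comp_const_add (c i) s) (by fun_prop)
  have := (hr.mul hh (hW.mul hh hZ)).integral_eq hh
  rw [h1, ← sub_eq_add_neg, h2, zero_mul, zero_mul, sub_zero] at this
  rw [← this]
  refine integral_congr_ae ?_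
  filter_upwards [eW, eZ] with s e1 e2
  simp only [cellPoint_self, e1, e2]

/-- ρ vanishes on every cell edge normal to direction i, so no edge terms appear, whether the edge
is interior or on the boundary of Ω. -/
theorem IsUniformMesh.integral_parts (hT : IsUniformMesh Ω h T) (hΩ : IsOpen Ω)
    {F G : Fin 2 → (Fin 2 → ℝ) → ℝ} (hu : HasL2Gradient Ω u F) (hv : HasL2Gradient Ω v G)
    (i : Fin 2) {ρ ρ' : ℝ → ℝ} (hρ : ∀ s, HasDerivAt ρ (ρ' s) s) (hρ' : Continuous ρ')
    (h0 : ∀ c ∈ T, ρ (c i + h) = 0 ∧ ρ (c i - h) = 0) :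
    ∫ x in Ω, (ρ' (x i) * (u x * v x) + ρ (x i) * (F i x * v x + u x * G i x)) = 0 := by
  have hρc : Continuous ρ := continuous_iff_continuousAt.2 fun s => (hρ s).continuousAt
  have hm : ∀ {η f : (Fin 2 → ℝ) → ℝ}, Continuous η → MemLp f 2 (volume.restrict Ω) →
      MemLp (fun x => η x * f x) 2 (volume.restrict Ω) :=
    fun hη hf => hT.memLp_mul_continuous hΩ.measurableSet hη hf
  have c1 : Continuous fun x : Fin 2 → ℝ => ρ' (x i) := by fun_prop
  have c2 : Continuous fun x : Fin 2 → ℝ => ρ (x i) := by fun_prop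
  have i1 : IntegrableOn (fun x => ρ' (x i) * (u x * v x) +
      ρ (x i) * (F i x * v x + u x * G i x)) Ω := by
    have : IntegrableOn (fun x => ρ' (x i) * u x * v x +
      (ρ (x i) * F i x * v x + ρ (x i) * u x * G i x)) Ω :=
      ((hm c1 hu.memLp).integrable_mul hv.memLp).add
        (((hm c2 (hu.memLp_grad i)).integrable_mul hv.memLp).add
          ((hm c2 hu.memLp).integrable_mul (hv.memLp_grad i)))
    refine this.congr_fun (fun x _ => ?_) hΩ.measurableSet
    ring
  rw [hT.setIntegral_eq_sum i1]
  exact Finset.sum_eq_zero fun c hc => integral_cell_parts hT.pos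
    (hu.mono (hT.interior_subset c hc)) (hv.mono (hT.interior_subset c hc)) i hρ hρ'
    (h0 c hc).1 (h0 c hc).2

theorem sqrt_integral_sq {α : Type*} [MeasurableSpace α] {μ : Measure α} {f : α → ℝ}
    (hf : MemLp f 2 μ) : √(∫ x, f x ^ 2 ∂μ) = (eLpNorm f 2 μ).toReal := by
  rw [hf.eLpNorm_eq_integral_rpow_norm (by simp) (by simp), ENNReal.toReal_ofReal (by positivity),
    Real.sqrt_eq_rpow]
  simp

theorem MemSobolev.weakDeriv_mixed_ae_eq {m : ℕ} (hw : MemSobolev m U w) (hU : IsOpen U)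
    {l : List (Fin 2)} (hl : l.length + 1 < m) (i j : Fin 2) :
    weakDeriv U (i :: j :: l) w =ᵐ[volume.restrict U] weakDeriv U (j :: i :: l) w := by
  have h1 := hw.2 l i (by omega)
  have h2 := hw.2 (i :: l) j (by simpa using hl)
  have h3 := hw.2 l j (by omega)
  exact (hw.2 (j :: l) i (by simpa using hl)).unique hU (h1.symm_mixed h2 h3 h3.2.1)

/-- With a test function φ in place of w, both sides equal −∫ u ∂_a²∂_b φ. Both are continuous in w
for the H² norm, and w is a limit of test functions. This is where the boundary condition on w
enters. -/
theorem MemSobolevZero.integral_mixed_eq (hw : MemSobolevZero 2 Ω w) (hΩ : IsOpen Ω)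
    {G : Fin 2 → (Fin 2 → ℝ) → ℝ} (hu : HasL2Gradient Ω u G) (a b : Fin 2) :
    ∫ x in Ω, G a x * weakDeriv Ω [b, a] w x = ∫ x in Ω, G b x * weakDeriv Ω [a, a] w x := by
  obtain ⟨hw, φ, hφ, hlim⟩ := hw
  have hsmooth : ∀ n i, ContDiff ℝ ∞ fun x => fderiv ℝ (φ n) x (Pi.single i 1) := fun n i =>
    ((hφ n).1.fderiv_right (m := ∞) (by simp)).clm_apply contDiff_const
  have herr : ∀ n i j, weakDeriv Ω [i, j] (w - φ n) =ᵐ[volume.restrict Ω]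
      weakDeriv Ω [i, j] w -
        fun x => fderiv ℝ (fun y => fderiv ℝ (φ n) y (Pi.single j 1)) x (Pi.single i 1) :=
    fun n i j => weakDeriv_pair_ae_eq hΩ
      ((hw.2 [] j (by simp)).sub (hasWeakPartial_of_contDiff (hφ n).1 j))
      ((hw.2 [j] i (by simp)).sub (hasWeakPartial_of_contDiff (hsmooth n j) i))
  have htest : ∀ n i j, IsTestFunction Ω
      fun x => fderiv ℝ (fun y => fderiv ℝ (φ n) y (Pi.single j 1)) x (Pi.single i 1) :=
    fun n i j => ((hφ n).partial _).partial _
  have hmt : ∀ n i j, MemLp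
      (fun x => fderiv ℝ (fun y => fderiv ℝ (φ n) y (Pi.single j 1)) x (Pi.single i 1)) 2
      (volume.restrict Ω) := fun n i j =>
    ((htest n i j).1.continuous.memLp_of_hasCompactSupport (htest n i j).2.1).restrict _
  have hme : ∀ n i j, MemLp (weakDeriv Ω [i, j] (w - φ n)) 2 (volume.restrict Ω) :=
    fun n i j => (memLp_congr_ae (herr n i j)).2 ((hw.1 [i, j] (by simp)).sub (hmt n i j))
  have key : ∀ n, (∫ x in Ω, G a x * fderiv ℝ (fun y => fderiv ℝ (φ n) y (Pi.single a 1)) x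
      (Pi.single b 1)) =
      ∫ x in Ω, G b x * fderiv ℝ (fun y => fderiv ℝ (φ n) y (Pi.single a 1)) x
      (Pi.single a 1) := by
    intro n
    have e1 := (hu.hasWeakPartial a).2.2 _ (htest n b a)
    have e2 := (hu.hasWeakPartial b).2.2 _ (htest n a a)
    simp only [fderiv_fderiv_comm (hsmooth n a) (Pi.single b 1) (Pi.single a 1)] at e1
    linarith
  have hsplit : ∀ n (i j k : Fin 2), ∫ x in Ω, G k x * weakDeriv Ω [i, j] (w - φ n) x =
      (∫ x in Ω, G k x * weakDeriv Ω [i, j] w x) - ∫ x in Ω, G k x *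
        fderiv ℝ (fun y => fderiv ℝ (φ n) y (Pi.single j 1)) x (Pi.single i 1) := by
    intro n i j k
    have i1 : IntegrableOn (fun x => G k x * weakDeriv Ω [i, j] w x) Ω :=
      (hu.memLp_grad k).integrable_mul (hw.1 [i, j] (by simp))
    have i2 : IntegrableOn (fun x => G k x *
        fderiv ℝ (fun y => fderiv ℝ (φ n) y (Pi.single j 1)) x (Pi.single i 1)) Ω :=
      (hu.memLp_grad k).integrable_mul (hmt n i j)
    rw [← integral_sub i1 i2]
    refine integral_congr_ae ?_
    filter_upwards [herr n i j] with x hx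
    rw [hx, Pi.sub_apply]; ring
  have hzero : ∀ i j k : Fin 2, Tendsto
      (fun n => ∫ x in Ω, G k x * weakDeriv Ω [i, j] (w - φ n) x) atTop (𝓝 0) := by
    intro i j k
    have ht := ((ENNReal.tendsto_toReal ENNReal.zero_ne_top).comp
      (hlim [i, j] (by simp))).const_mul √(∫ x in Ω, G k x ^ 2)
    rw [ENNReal.toReal_zero, mul_zero] at ht
    refine squeeze_zero_norm (fun n => ?_) ht
    rw [Real.norm_eq_abs, Function.comp_apply, ← sqrt_integral_sq (hme n i j)]
    exact abs_integral_mul_le (hu.memLp_grad k) (hme n i j)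
  have := (hzero b a a).sub (hzero a a b)
  simp only [hsplit, key, sub_sub_sub_cancel_right, sub_zero] at this
  exact sub_eq_zero.1 (tendsto_nhds_unique tendsto_const_nhds this)

theorem fderiv_comp_coord {χ χ' : ℝ → ℝ} (hχ : ∀ s, HasDerivAt χ (χ' s) s) (a i : Fin 2)
    (x : Fin 2 → ℝ) : fderiv ℝ (fun x : Fin 2 → ℝ => χ (x a)) x (Pi.single i 1) =
      χ' (x a) * (Pi.single i 1 : Fin 2 → ℝ) a := by
  have h := (hχ (x a)).comp_hasFDerivAt x (hasFDerivAt_apply (𝕜 := ℝ) a x)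
  have h' : HasFDerivAt (fun x : Fin 2 → ℝ => χ (x a))
    (χ' (x a) • ContinuousLinearMap.proj (R := ℝ) (φ := fun _ : Fin 2 => ℝ) a) x := h
  rw [h'.fderiv]
  simp

/-- Cutting off near the grid lines, up to the corners of the mesh. -/
theorem IsUniformMesh.integral_eq_corner (hT : IsUniformMesh Ω h T) (hΩ : IsOpen Ω)
    (hw0 : MemSobolevZero 2 Ω w) (hw : MemSobolev 4 Ω w) {G : Fin 2 → (Fin 2 → ℝ) → ℝ}
    (hu : HasL2Gradient Ω u G) {a b : Fin 2} (hab : a ≠ b) {χ χ' : ℝ → ℝ}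
    (hχ : ContDiff ℝ ∞ χ) (hχ' : ∀ s, HasDerivAt χ (χ' s) s) (hc' : Continuous χ')
    (h0 : ∀ c ∈ T, ∀ i, χ (c i + h) = 0 ∧ χ (c i - h) = 0) :
    ∫ x in Ω, (G a x * weakDeriv Ω [b, a] w x + u x * weakDeriv Ω [a, b, a] w x) =
      ∫ x in Ω, ((1 - χ (x a)) * (1 - χ (x b)) *
        (G a x * weakDeriv Ω [b, a] w x + u x * weakDeriv Ω [a, b, a] w x) -
          χ' (x a) * (1 - χ (x b)) * (u x * weakDeriv Ω [b, a] w x)) := by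
  have hz := hw.hasL2Gradient (l := [b, a]) (by simp)
  have hz' := hw.hasL2Gradient (l := [a, a]) (by simp)
  -- With χ_a = χ(x a) and χ_b = χ(x b), split 1 = χ_a + (1 − χ_a)χ_b + (1 − χ_a)(1 − χ_b). The
  -- first part is integrated by parts in direction a.
  have p1 := hT.integral_parts hΩ hu hz a hχ' hc' fun c hc => h0 c hc a
  have sχ : ∀ i : Fin 2, ContDiff ℝ ∞ fun x : Fin 2 → ℝ => χ (x i) := fun i =>
    hχ.comp (contDiff_apply ℝ ℝ i)
  have p2 := hT.integral_parts hΩ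
    (hT.hasL2Gradient_smooth_mul hΩ (contDiff_const.sub (sχ a) : ContDiff ℝ ∞ fun x => 1 - χ (x a))
      hu) hz' b hχ' hc' fun c hc => h0 c hc b
  have hcut : ContDiff ℝ ∞ fun x : Fin 2 → ℝ => (1 - χ (x a)) * χ (x b) :=
    (contDiff_const.sub (sχ a)).mul (sχ b)
  -- For the second part let v = (1 − χ_a)χ_b u. This replaces ∫ ∂_a v ∂_b∂_a w by ∫ ∂_b v ∂_a²w,
  -- and `p2` integrates the latter by parts in direction b, where χ_b removes the edges. The third
  -- part remains, with the leftover χ'(x a)(1 − χ_b) from differentiating the cutoffs.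
  have p3 := hw0.integral_mixed_eq hΩ (hT.hasL2Gradient_smooth_mul hΩ hcut hu) a b
  have hD : ∀ j : Fin 2, ∀ x, DifferentiableAt ℝ (fun x : Fin 2 → ℝ => χ (x j)) x := fun j x =>
    (sχ j).differentiable (by simp) x
  have d1 : ∀ i x, fderiv ℝ (fun x : Fin 2 → ℝ => 1 - χ (x a)) x (Pi.single i 1) =
      -(χ' (x a) * (Pi.single i 1 : Fin 2 → ℝ) a) := by
    intro i x
    rw [fderiv_const_sub, neg_apply, fderiv_comp_coord hχ']
  have d2 : ∀ i x, fderiv ℝ (fun x : Fin 2 → ℝ => (1 - χ (x a)) * χ (x b)) x (Pi.single i 1) =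
      (1 - χ (x a)) * (χ' (x b) * (Pi.single i 1 : Fin 2 → ℝ) b) +
        χ (x b) * -(χ' (x a) * (Pi.single i 1 : Fin 2 → ℝ) a) := by
    intro i x
    have hd : DifferentiableAt ℝ (fun x : Fin 2 → ℝ => 1 - χ (x a)) x :=
      (hD a x).const_sub 1
    rw [fderiv_fun_mul hd (hD b x), add_apply, smul_apply, smul_apply, d1,
      fderiv_comp_coord hχ']
    simp
  have hm : ∀ {η f : (Fin 2 → ℝ) → ℝ}, Continuous η → MemLp f 2 (volume.restrict Ω) →
      MemLp (fun x => η x * f x) 2 (volume.restrict Ω) :=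
    fun hη hf => hT.memLp_mul_continuous hΩ.measurableSet hη hf
  have hm2 : ∀ {η f g : (Fin 2 → ℝ) → ℝ}, Continuous η → MemLp f 2 (volume.restrict Ω) →
      MemLp g 2 (volume.restrict Ω) → IntegrableOn (fun x => η x * (f x * g x)) Ω := by
    intro η f g hη hf hg
    have : IntegrableOn (fun x => η x * f x * g x) Ω := (hm hη hf).integrable_mul hg
    simpa only [mul_assoc] using this
  have hχc := hχ.continuous
  simp only [d1, d2, Pi.single_eq_same, Pi.single_eq_of_ne hab, Pi.single_eq_of_ne hab.symm,
    mul_zero, mul_one, neg_zero, zero_mul, zero_add, add_zero] at p2 p3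
  have ha := hu.memLp_grad a
  have hb := hu.memLp_grad b
  have hψ := hu.memLp
  have h1 := hz.memLp
  have h2 := hz.memLp_grad a
  have h3 := hz'.memLp
  have h4 := hz'.memLp_grad b
  have hsym := hw.weakDeriv_mixed_ae_eq hΩ (l := [a]) (by simp) a b
  set z := weakDeriv Ω [b, a] w
  set za := weakDeriv Ω [a, b, a] w
  set y := weakDeriv Ω [a, a] w
  set yb := weakDeriv Ω [b, a, a] w
  have q1 : IntegrableOn (fun x => χ' (x a) * (u x * z x) + χ (x a) * (G a x * z x + u x * za x))
      Ω := by
    have := (hm2 (η := fun x => χ' (x a)) (by fun_prop) hψ h1).add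
      ((hm2 (η := fun x => χ (x a)) (by fun_prop) ha h1).add
        (hm2 (η := fun x => χ (x a)) (by fun_prop) hψ h2))
    refine this.congr_fun (fun x _ => ?_) hΩ.measurableSet
    simp only [Pi.add_apply]; ring
  have q2 : IntegrableOn (fun x => (1 - χ (x a)) * χ (x b) * (u x * za x)) Ω :=
    hm2 (η := fun x => (1 - χ (x a)) * χ (x b)) (by fun_prop) hψ h2
  have q3 : IntegrableOn (fun x => (χ (x b) * -χ' (x a) * u x + (1 - χ (x a)) * χ (x b) * G a x) *
      z x) Ω := by
    have := (hm2 (η := fun x => χ (x b) * -χ' (x a)) (by fun_prop) hψ h1).add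
      (hm2 (η := fun x => (1 - χ (x a)) * χ (x b)) (by fun_prop) ha h1)
    refine this.congr_fun (fun x _ => ?_) hΩ.measurableSet
    simp only [Pi.add_apply]; ring
  have q4 : IntegrableOn (fun x => ((1 - χ (x a)) * χ' (x b) * u x +
      (1 - χ (x a)) * χ (x b) * G b x) * y x) Ω := by
    have := (hm2 (η := fun x => (1 - χ (x a)) * χ' (x b)) (by fun_prop) hψ h3).add
      (hm2 (η := fun x => (1 - χ (x a)) * χ (x b)) (by fun_prop) hb h3)
    refine this.congr_fun (fun x _ => ?_) hΩ.measurableSet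
    simp only [Pi.add_apply]; ring
  have q5 : IntegrableOn (fun x => (1 - χ (x a)) * (1 - χ (x b)) * (G a x * z x + u x * za x) -
      χ' (x a) * (1 - χ (x b)) * (u x * z x)) Ω := by
    have := ((hm2 (η := fun x => (1 - χ (x a)) * (1 - χ (x b))) (by fun_prop) ha h1).add
      (hm2 (η := fun x => (1 - χ (x a)) * (1 - χ (x b))) (by fun_prop) hψ h2)).sub
      (hm2 (η := fun x => χ' (x a) * (1 - χ (x b))) (by fun_prop) hψ h1)
    refine this.congr_fun (fun x _ => ?_) hΩ.measurableSet
    simp only [Pi.add_apply, Pi.sub_apply]; ring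
  have e2 : (∫ x in Ω, ((1 - χ (x a)) * χ' (x b) * u x +
      (1 - χ (x a)) * χ (x b) * G b x) * y x) +
      ∫ x in Ω, (1 - χ (x a)) * χ (x b) * (u x * za x) = 0 := by
    rw [← integral_add q4 q2, ← p2]
    refine integral_congr_ae ?_
    filter_upwards [hsym] with x hx
    rw [hx]; ring
  have e3 : ∫ x in Ω, (G a x * z x + u x * za x) =
      (∫ x in Ω, ((1 - χ (x a)) * (1 - χ (x b)) * (G a x * z x + u x * za x) -
        χ' (x a) * (1 - χ (x b)) * (u x * z x))) +
      ((∫ x in Ω, (χ' (x a) * (u x * z x) + χ (x a) * (G a x * z x + u x * za x))) +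
      ((∫ x in Ω, (χ (x b) * -χ' (x a) * u x + (1 - χ (x a)) * χ (x b) * G a x) * z x) +
        ∫ x in Ω, (1 - χ (x a)) * χ (x b) * (u x * za x))) := by
    have q32 : IntegrableOn (fun x => (χ (x b) * -χ' (x a) * u x +
      (1 - χ (x a)) * χ (x b) * G a x) * z x + (1 - χ (x a)) * χ (x b) * (u x * za x)) Ω :=
      q3.add q2
    have q132 : IntegrableOn (fun x => (χ' (x a) * (u x * z x) +
      χ (x a) * (G a x * z x + u x * za x)) + ((χ (x b) * -χ' (x a) * u x +
      (1 - χ (x a)) * χ (x b) * G a x) * z x + (1 - χ (x a)) * χ (x b) * (u x * za x))) Ω :=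
      q1.add q32
    rw [← integral_add q3 q2, ← integral_add q1 q32, ← integral_add q5 q132]
    congr 1; ext x; ring
  rw [e3, p1]
  linarith

end Gradient

/-! ### Vanishing of the corner contributions. -/

section Corners

open Set

variable {Ω : Set (Fin 2 → ℝ)} {h : ℝ} {T : Finset (Fin 2 → ℝ)} {u w : (Fin 2 → ℝ) → ℝ}

/-- χ is a product over a ∈ X of factors 1 − β((s − a)/ε) with a fixed bump β. The factors lie in
[0, 1], so each point adds sup |β'|/ε to the derivative bound and C does not depend on ε. -/
theorem exists_cutoff (X : Finset ℝ) : ∃ C, 0 ≤ C ∧ ∀ ε > 0, ∃ χ : ℝ → ℝ, ContDiff ℝ ∞ χ ∧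
    (∀ a ∈ X, χ a = 0) ∧ (∀ s, 0 ≤ χ s ∧ χ s ≤ 1) ∧ (∀ s, |deriv χ s| ≤ C / ε) ∧
    ∀ s, (∀ a ∈ X, ε ≤ |s - a|) → χ s = 1 := by
  induction X using Finset.induction_on with
  | empty =>
    exact ⟨0, le_rfl, fun ε _ => ⟨fun _ => 1, contDiff_const, by simp, by simp, by simp, by simp⟩⟩
  | insert a X _ ih =>
    obtain ⟨C, hC, ih⟩ := ih
    let β : ContDiffBump (0 : ℝ) := ⟨1 / 2, 1, by norm_num, by norm_num⟩
    have hβ : ContDiff ℝ ∞ β := β.contDiff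
    have hβ' : Continuous (deriv β) := hβ.continuous_deriv (by simp)
    obtain ⟨B, hB⟩ := hβ'.bounded_above_of_compact_support β.hasCompactSupport.deriv
    have hB0 : 0 ≤ B := (norm_nonneg _).trans (hB 0)
    refine ⟨C + B, by positivity, fun ε hε => ?_⟩
    obtain ⟨χ, h1, h2, h3, h4, h5⟩ := ih ε hε
    have hd : ∀ s, HasDerivAt (fun s => 1 - β ((s - a) / ε)) (-(deriv β ((s - a) / ε) * (1 / ε))) s :=
      fun s => ((hβ.differentiable (by simp) _).hasDerivAt.comp s
        (((hasDerivAt_id s).sub_const a).div_const ε)).const_sub 1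
    have hb : ∀ r, 0 ≤ 1 - β r ∧ 1 - β r ≤ 1 := fun r =>
      ⟨sub_nonneg.2 β.le_one, by linarith [β.nonneg (x := r)]⟩
    refine ⟨fun s => χ s * (1 - β ((s - a) / ε)), ?_, ?_, ?_, ?_, ?_⟩
    · exact h1.mul (contDiff_const.sub
        (hβ.comp ((contDiff_id.sub contDiff_const).div_const ε)))
    · intro r hr
      rcases Finset.mem_insert.1 hr with rfl | hr
      · beta_reduce
        rw [sub_self, zero_div, β.one_of_mem_closedBall (by simp [β]), sub_self, mul_zero]
      · simp only [h2 r hr, zero_mul]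
    · exact fun s => ⟨mul_nonneg (h3 s).1 (hb _).1,
        mul_le_one₀ (h3 s).2 (hb _).1 (hb _).2⟩
    · intro s
      rw [((h1.differentiable (by simp) s).hasDerivAt.fun_mul (hd s)).deriv, add_div]
      refine (abs_add_le _ _).trans (add_le_add ?_ ?_)
      · rw [abs_mul, abs_of_nonneg (hb _).1]
        exact (mul_le_of_le_one_right (abs_nonneg _) (hb _).2).trans (h4 s)
      · rw [abs_mul, abs_neg, abs_mul, abs_of_nonneg (h3 s).1,
          abs_of_nonneg (one_div_pos.2 hε).le, mul_one_div]
        refine (mul_le_of_le_one_left (by positivity) (h3 s).2).trans ?_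
        gcongr
        exact hB _
    · intro s hs
      beta_reduce
      rw [h5 s fun b hb => hs b (Finset.mem_insert_of_mem hb), one_mul, β.zero_of_le_dist, sub_zero]
      rw [dist_zero_right, Real.norm_eq_abs, abs_div, abs_of_pos hε, le_div_iff₀ hε, one_mul]
      exact hs a (Finset.mem_insert_self a X)

/-- The points within distance `ε` of the grid `X × X`, in the maximum norm. -/
def nearGrid (X : Finset ℝ) (ε : ℝ) : Set (Fin 2 → ℝ) :=
  univ.pi fun _ => ⋃ a ∈ X, Ioo (a - ε) (a + ε)

theorem measurableSet_nearGrid (X : Finset ℝ) (ε : ℝ) : MeasurableSet (nearGrid X ε) :=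
  MeasurableSet.univ_pi fun _ => X.measurableSet_biUnion fun _ _ => measurableSet_Ioo

theorem exists_le_abs_of_notMem_nearGrid {X : Finset ℝ} {ε : ℝ} {x : Fin 2 → ℝ}
    (hx : x ∉ nearGrid X ε) : ∃ k, ∀ a ∈ X, ε ≤ |x k - a| := by
  by_contra! H
  refine hx fun k _ => ?_
  obtain ⟨a, ha, hlt⟩ := H k
  rw [abs_lt] at hlt
  exact mem_iUnion₂.2 ⟨a, ha, by linarith, by linarith⟩

theorem volume_nearGrid_le (X : Finset ℝ) {ε : ℝ} (hε : 0 < ε) :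
    volume (nearGrid X ε) ≤ ENNReal.ofReal ((X.card * (2 * ε)) ^ 2) := by
  rw [nearGrid, volume_pi_pi, Finset.prod_const, Finset.card_univ, Fintype.card_fin,
    ENNReal.ofReal_pow (by positivity)]
  gcongr
  refine (measure_biUnion_finset_le X _).trans ?_
  have e : ∀ a : ℝ, a + ε - (a - ε) = 2 * ε := fun a => by ring
  simp only [Real.volume_Ioo, e, Finset.sum_const, nsmul_eq_mul]
  rw [ENNReal.ofReal_mul (Nat.cast_nonneg _), ENNReal.ofReal_natCast]

/-- There is a continuous representative on each of finitely many compact cells. -/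
theorem IsUniformMesh.exists_ae_bound (hT : IsUniformMesh Ω h T) (hw : MemSobolev 4 Ω w)
    {l : List (Fin 2)} (hl : l.length ≤ 2) :
    ∃ M, 0 ≤ M ∧ ∀ᵐ x ∂volume.restrict Ω, |weakDeriv Ω l w x| ≤ M := by
  have : ∀ c, ∃ M, c ∈ T → ∀ᵐ x ∂volume.restrict (interior (cell h c)),
      |weakDeriv Ω l w x| ≤ M := by
    intro c
    by_cases hc : c ∈ T
    · obtain ⟨f, hf, e⟩ := (hT.isDerivFamily hw hc).exists_continuous hT.pos hl
      obtain ⟨M, hM⟩ := (isCompact_cell h c).exists_bound_of_continuousOn hf.continuousOn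
      refine ⟨M, fun _ => ?_⟩
      filter_upwards [e, ae_restrict_mem isOpen_interior.measurableSet] with x hx hxc
      rw [← hx]
      exact hM x (_root_.interior_subset hxc)
    · exact ⟨0, fun h => absurd h hc⟩
  choose M hM using this
  refine ⟨∑ c ∈ T, |M c|, Finset.sum_nonneg fun _ _ => abs_nonneg _, ?_⟩
  rw [Measure.restrict_congr_set hT.ae_eq, ae_restrict_biUnion_finset_iff]
  intro c hc
  filter_upwards [hM c hc] with x hx
  exact hx.trans ((le_abs_self _).trans
    (Finset.single_le_sum (f := fun c => |M c|) (fun _ _ => abs_nonneg _) hc))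

theorem setIntegral_abs_le_sqrt {α : Type*} [MeasurableSpace α] {μ : Measure α} {f : α → ℝ}
    (hf : MemLp f 2 μ) {S : Set α} {r : ℝ} (hr : 0 ≤ r) (hS : μ S ≤ ENNReal.ofReal (r ^ 2)) :
    ∫ x in S, |f x| ∂μ ≤ r * √(∫ x in S, f x ^ 2 ∂μ) := by
  have hfin : IsFiniteMeasure (μ.restrict S) :=
    ⟨by simpa using hS.trans_lt ENNReal.ofReal_lt_top⟩
  have hf' : MemLp (fun x => |f x|) 2 (μ.restrict S) := (hf.restrict S).abs
  have h := (le_abs_self _).trans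
    (abs_integral_mul_le (memLp_const (1 : ℝ) (μ := μ.restrict S)) hf')
  simp only [one_mul, one_pow, sq_abs, integral_const, smul_eq_mul, mul_one] at h
  refine h.trans (mul_le_mul_of_nonneg_right ?_ (Real.sqrt_nonneg _))
  rw [measureReal_restrict_apply_univ]
  refine Real.sqrt_le_iff.2 ⟨hr, ?_⟩
  exact ENNReal.toReal_le_of_le_ofReal (by positivity) hS

/-- Formally this is ∫ ∂_a(u ∂_b∂_a w) = 0, as ∂_b∂_a w vanishes on axis-parallel boundary edges.
`IsUniformMesh.integral_eq_corner` confines the integral to ε-squares about the grid points, and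
then ε → 0. -/
theorem IsUniformMesh.integral_mixed_parts (hT : IsUniformMesh Ω h T) (hΩ : IsOpen Ω)
    (hw0 : MemSobolevZero 2 Ω w) (hw : MemSobolev 4 Ω w) {G : Fin 2 → (Fin 2 → ℝ) → ℝ}
    (hu : HasL2Gradient Ω u G) {a b : Fin 2} (hab : a ≠ b) :
    ∫ x in Ω, (G a x * weakDeriv Ω [b, a] w x + u x * weakDeriv Ω [a, b, a] w x) = 0 := by
  classical
  obtain ⟨M, hM0, hM⟩ := hT.exists_ae_bound hw (l := [b, a]) (by simp)
  -- The coordinates of the grid lines of both directions are collected in one set, so a single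
  -- cutoff serves both variables.
  set X : Finset ℝ := T.biUnion fun c => Finset.univ.biUnion fun i => {c i + h, c i - h} with hX
  have hXmem : ∀ c ∈ T, ∀ i, c i + h ∈ X ∧ c i - h ∈ X := by
    intro c hc i
    constructor <;>
    · simp only [hX, Finset.mem_biUnion]
      exact ⟨c, hc, i, by simp, by simp⟩
  obtain ⟨C, hC, hcut⟩ := exists_cutoff X
  set g : (Fin 2 → ℝ) → ℝ := fun x =>
    G a x * weakDeriv Ω [b, a] w x + u x * weakDeriv Ω [a, b, a] w x with hg
  set μ := (volume : Measure (Fin 2 → ℝ)).restrict Ω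
  have hgi : Integrable g μ := ((hu.memLp_grad a).integrable_mul (hw.1 _ (by simp))).add
    (hu.memLp.integrable_mul (hw.1 _ (by simp)))
  have hui : Integrable u μ := hT.integrableOn_of_memLp hu.memLp
  -- The factor C/ε from χ' meets the L¹ norm of u on a set of measure O(ε²), which is O(ε) times an
  -- L² norm there. The powers of ε cancel, and the L² norm over the shrinking set still tends to
  -- zero.
  have hbound : ∀ ε > 0, |∫ x, g x ∂μ| ≤ (∫ x in nearGrid X ε, |g x| ∂μ) +
      C * M * (X.card * 2) * √(∫ x in nearGrid X ε, u x ^ 2 ∂μ) := by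
    intro ε hε
    obtain ⟨χ, h1, h2, h3, h4, h5⟩ := hcut ε hε
    have hd : ∀ s, HasDerivAt χ (deriv χ s) s := fun s =>
      (h1.differentiable (by simp) s).hasDerivAt
    rw [hT.integral_eq_corner hΩ hw0 hw hu hab h1 hd (h1.continuous_deriv (by simp))
      fun c hc i => ⟨h2 _ (hXmem c hc i).1, h2 _ (hXmem c hc i).2⟩]
    have hS := measurableSet_nearGrid X ε
    have hdom : Integrable ((nearGrid X ε).indicator fun x => |g x| + C / ε * M * |u x|) μ :=
      (hgi.abs.add (hui.abs.const_mul _)).indicator hS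
    have hle := norm_integral_le_of_norm_le hdom (f := fun x =>
      (1 - χ (x a)) * (1 - χ (x b)) * g x -
        deriv χ (x a) * (1 - χ (x b)) * (u x * weakDeriv Ω [b, a] w x)) (by
      filter_upwards [hM] with x hx
      rw [Real.norm_eq_abs]
      by_cases hxS : x ∈ nearGrid X ε
      · rw [indicator_of_mem hxS]
        have ha := h3 (x a)
        have hb := h3 (x b)
        have k1 : |(1 - χ (x a)) * (1 - χ (x b))| ≤ 1 := by
          rw [abs_of_nonneg (mul_nonneg (by linarith) (by linarith))]
          exact mul_le_one₀ (by linarith) (by linarith) (by linarith)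
        have k2 : |deriv χ (x a) * (1 - χ (x b))| ≤ C / ε := by
          rw [abs_mul, abs_of_nonneg (by linarith : 0 ≤ 1 - χ (x b))]
          exact (mul_le_of_le_one_right (abs_nonneg _) (by linarith)).trans (h4 _)
        refine (abs_sub _ _).trans (add_le_add ?_ ?_)
        · rw [abs_mul]
          exact mul_le_of_le_one_left (abs_nonneg _) k1
        · rw [abs_mul, abs_mul (u x), mul_assoc (C / ε), mul_comm M]
          gcongr
      · rw [indicator_of_notMem hxS]
        refine le_of_eq (abs_eq_zero.2 ?_)
        obtain ⟨k, hk⟩ := exists_le_abs_of_notMem_nearGrid hxS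
        have hχk : χ (x k) = 1 := h5 _ hk
        have hk' : k = a ∨ k = b :=
          (forall_fin_two_iff_of_ne hab (P := fun k => k = a ∨ k = b)).2
            ⟨Or.inl rfl, Or.inr rfl⟩ k
        rcases hk' with rfl | rfl
        -- Where χ attains its maximal value 1 its derivative vanishes, so the χ' term drops as
        -- well.
        · have : IsLocalMax χ (x k) := Eventually.of_forall fun s => by
            rw [hχk]; exact (h3 s).2
          rw [this.deriv_eq_zero, hχk]; ring
        · rw [hχk]; ring)
    rw [Real.norm_eq_abs, integral_indicator hS, integral_add hgi.abs.integrableOn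
      (hui.abs.const_mul _).integrableOn, integral_const_mul] at hle
    refine hle.trans (add_le_add le_rfl ?_)
    have hvol : μ (nearGrid X ε) ≤ ENNReal.ofReal ((X.card * (2 * ε)) ^ 2) :=
      (Measure.restrict_apply_le _ _).trans (volume_nearGrid_le X hε)
    calc C / ε * M * ∫ x in nearGrid X ε, |u x| ∂μ
        ≤ C / ε * M * (X.card * (2 * ε) * √(∫ x in nearGrid X ε, u x ^ 2 ∂μ)) := by
          gcongr
          exact setIntegral_abs_le_sqrt hu.memLp (by positivity) hvol
      _ = _ := by field_simp
  have hvol0 : Tendsto (fun ε => μ (nearGrid X ε)) (𝓝[>] 0) (𝓝 0) := by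
    have ht : Tendsto (fun ε : ℝ => ENNReal.ofReal ((X.card * (2 * ε)) ^ 2)) (𝓝[>] 0) (𝓝 0) := by
      have : Continuous fun ε : ℝ => ENNReal.ofReal ((X.card * (2 * ε)) ^ 2) :=
        ENNReal.continuous_ofReal.comp (by fun_prop)
      simpa using (this.tendsto 0).mono_left nhdsWithin_le_nhds
    refine tendsto_of_tendsto_of_tendsto_of_le_of_le' tendsto_const_nhds ht
      (Eventually.of_forall fun _ => zero_le) ?_
    filter_upwards [self_mem_nhdsWithin] with ε hε
    exact (Measure.restrict_apply_le _ _).trans (volume_nearGrid_le X hε)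
  have hlim : Tendsto (fun ε => (∫ x in nearGrid X ε, |g x| ∂μ) +
      C * M * (X.card * 2) * √(∫ x in nearGrid X ε, u x ^ 2 ∂μ)) (𝓝[>] 0) (𝓝 0) := by
    have t1 := hgi.abs.tendsto_setIntegral_nhds_zero hvol0
    have t2 := (hu.memLp.integrable_sq.tendsto_setIntegral_nhds_zero hvol0).sqrt
    simpa using t1.add (t2.const_mul (C * M * (X.card * 2)))
  have := ge_of_tendsto hlim (by
    filter_upwards [self_mem_nhdsWithin] with ε hε using hbound ε hε)
  exact abs_nonpos_iff.1 this

end Corners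

/-! ### Cancellation of the leading term, and the theorem. -/

section Cancellation

variable {U Ω : Set (Fin 2 → ℝ)} {h : ℝ} {T : Finset (Fin 2 → ℝ)} {w : (Fin 2 → ℝ) → ℝ}

theorem MemSobolev.weakDeriv_cons_congr {m : ℕ} (hw : MemSobolev m U w) (hU : IsOpen U)
    {l l' : List (Fin 2)} (hl : l.length < m) (hl' : l'.length < m)
    (e : weakDeriv U l w =ᵐ[volume.restrict U] weakDeriv U l' w) (k : Fin 2) :
    weakDeriv U (k :: l) w =ᵐ[volume.restrict U] weakDeriv U (k :: l') w :=
  ((hw.2 l k hl).congr hU e (ae_eq_refl _)).unique hU (hw.2 l' k hl')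

/-- Both sides equal −∫ ∂_i³∂_j w ∂_i∂_j w: one integration by parts in x_j on the left, one in x_i
on the right. -/
theorem IsUniformMesh.integral_third_derivatives (hT : IsUniformMesh Ω h T) (hΩ : IsOpen Ω)
    (hw0 : MemSobolevZero 2 Ω w) (hw : MemSobolev 4 Ω w) {i j : Fin 2} (hij : i ≠ j) :
    ∫ x in Ω, weakDeriv Ω [j, j, i] w x * weakDeriv Ω [i, i, i] w x =
      ∫ x in Ω, weakDeriv Ω [i, i, j] w x * weakDeriv Ω [i, i, j] w x := by
  have k1 := hT.integral_mixed_parts hΩ hw0 hw (hw.hasL2Gradient (l := [i, i, i]) (by simp))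
    hij.symm
  have k2 := hT.integral_mixed_parts hΩ hw0 hw (hw.hasL2Gradient (l := [i, i, j]) (by simp)) hij
  -- Iterated weak derivatives depend on the order of indices on null sets; `e0` to `e4` bring those
  -- occurring in `k1` and `k2` to a common order.
  have e0 := hw.weakDeriv_mixed_ae_eq hΩ (l := []) (by simp) i j
  have e1 := hw.weakDeriv_cons_congr hΩ (by simp) (by simp) e0 j
  have e2 := hw.weakDeriv_cons_congr hΩ (by simp) (by simp) e0 i
  have e3 := hw.weakDeriv_cons_congr hΩ (by simp) (by simp)
    ((hw.weakDeriv_mixed_ae_eq hΩ (l := [i]) (by simp) j i).trans e2.symm) i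
  have e4 := (hw.weakDeriv_mixed_ae_eq hΩ (l := [i, i]) (by simp) j i).trans e3
  have hm : ∀ l l' : List (Fin 2), l.length ≤ 4 → l'.length ≤ 4 →
      IntegrableOn (fun x => weakDeriv Ω l w x * weakDeriv Ω l' w x) Ω := fun l l' hl hl' =>
    (hw.1 l hl).integrable_mul (hw.1 l' hl')
  rw [integral_add (hm _ _ (by simp) (by simp)) (hm _ _ (by simp) (by simp))] at k1 k2
  have f1 : ∫ x in Ω, weakDeriv Ω [j, i, i, i] w x * weakDeriv Ω [i, j] w x =
      ∫ x in Ω, weakDeriv Ω [i, i, i, j] w x * weakDeriv Ω [j, i] w x := by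
    refine integral_congr_ae ?_
    filter_upwards [e0, e4] with x h1 h2
    rw [h1, h2]
  have f2 : ∫ x in Ω, weakDeriv Ω [i, i, i] w x * weakDeriv Ω [j, i, j] w x =
      ∫ x in Ω, weakDeriv Ω [j, j, i] w x * weakDeriv Ω [i, i, i] w x := by
    refine integral_congr_ae ?_
    filter_upwards [e1] with x h1
    rw [h1, mul_comm]
  have f3 : ∫ x in Ω, weakDeriv Ω [i, i, j] w x * weakDeriv Ω [i, j, i] w x =
      ∫ x in Ω, weakDeriv Ω [i, i, j] w x * weakDeriv Ω [i, i, j] w x := by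
    refine integral_congr_ae ?_
    filter_upwards [e2] with x h1
    rw [h1]
  linarith

/-- The square that the identity produces for one index is the square subtracted for the other, so
the cancellation occurs only in the sum over both directions. -/
theorem IsUniformMesh.sum_integral_third_derivatives (hT : IsUniformMesh Ω h T) (hΩ : IsOpen Ω)
    (hw0 : MemSobolevZero 2 Ω w) (hw : MemSobolev 4 Ω w) :
    ∑ i : Fin 2, ((∫ x in Ω, weakDeriv Ω [1 - i, 1 - i, i] w x * weakDeriv Ω [i, i, i] w x) -
      ∫ x in Ω, weakDeriv Ω [1 - i, 1 - i, i] w x * weakDeriv Ω [1 - i, 1 - i, i] w x) = 0 := by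
  have h1 := hT.integral_third_derivatives hΩ hw0 hw (show (0 : Fin 2) ≠ 1 by decide)
  have h2 := hT.integral_third_derivatives hΩ hw0 hw (show (1 : Fin 2) ≠ 0 by decide)
  simp only [Fin.sum_univ_two, sub_zero, sub_self]
  linarith

theorem exists_brokenHessianInner_le (hΩ : IsOpen Ω) (hw0 : MemSobolevZero 2 Ω w)
    (hw : MemSobolev 4 Ω w) {ε : ℝ} (hε : 0 < ε) :
    ∃ δ > 0, ∀ h T, IsUniformMesh Ω h T → h < δ →
      |brokenHessianInner h T (w - globalInterpolant h T w) (globalInterpolant h T w)| ≤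
        ε * h ^ 2 := by
  have hL : ∀ i j k : Fin 2, MemLp (weakDeriv Ω [i, j, k] w) 2 (volume.restrict Ω) :=
    fun i j k => hw.1 _ (by simp)
  have hε4 : 0 < ε / 4 := by positivity
  choose δ hδ H using fun i : Fin 2 =>
    exists_meanForm_close hΩ.measurableSet (hL (1 - i) (1 - i) i) (hL i i i) (1 - i) i hε4
  choose δ' hδ' H' using fun i : Fin 2 =>
    exists_meanForm_close hΩ.measurableSet (hL (1 - i) (1 - i) i) (hL (1 - i) (1 - i) i)
      (1 - i) (1 - i) hε4
  refine ⟨min (min (δ 0) (δ 1)) (min (δ' 0) (δ' 1)),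
    lt_min (lt_min (hδ 0) (hδ 1)) (lt_min (hδ' 0) (hδ' 1)), fun h T hT hh => ?_⟩
  simp only [lt_min_iff] at hh
  have a0 := H 0 h T hT hh.1.1
  have a1 := H 1 h T hT hh.1.2
  have b0 := H' 0 h T hT hh.2.1
  have b1 := H' 1 h T hT hh.2.2
  have e := hT.sum_integral_third_derivatives hΩ hw0 hw
  rw [hT.brokenHessianInner_eq hw]
  rw [Fin.sum_univ_two] at e ⊢
  have e' := congrArg (fun t => h ^ 2 / 3 * t) e
  simp only [mul_zero, mul_add, mul_sub] at e'
  rw [abs_le] at a0 a1 b0 b1 ⊢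
  constructor <;> linarith [a0.1, a0.2, a1.1, a1.2, b0.1, b0.2, b1.1, b1.2]

/-- Uniformity over all h and all meshes makes the supremum defining α_h finite, also for large h.
-/
theorem exists_brokenHessianInner_bound (hw : MemSobolev 4 Ω w) :
    ∃ K, ∀ h T, IsUniformMesh Ω h T →
      |brokenHessianInner h T (w - globalInterpolant h T w) (globalInterpolant h T w)| ≤
        K * h ^ 2 := by
  have hL : ∀ i j k : Fin 2, MemLp (weakDeriv Ω [i, j, k] w) 2 (volume.restrict Ω) :=
    fun i j k => hw.1 _ (by simp)
  refine ⟨∑ i : Fin 2, (√(∫ x in Ω, weakDeriv Ω [1 - i, 1 - i, i] w x ^ 2) *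
    √(∫ x in Ω, weakDeriv Ω [i, i, i] w x ^ 2) +
    √(∫ x in Ω, weakDeriv Ω [1 - i, 1 - i, i] w x ^ 2) *
    √(∫ x in Ω, weakDeriv Ω [1 - i, 1 - i, i] w x ^ 2)), fun h T hT => ?_⟩
  rw [hT.brokenHessianInner_eq hw, Finset.sum_mul]
  refine (Finset.abs_sum_le_sum_abs _ _).trans (Finset.sum_le_sum fun i _ => ?_)
  refine (abs_sub _ _).trans ?_
  rw [add_mul, mul_comm _ (h ^ 2), mul_comm _ (h ^ 2)]
  exact add_le_add (hT.abs_meanForm_le (hL _ _ _) (hL _ _ _))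
    (hT.abs_meanForm_le (hL _ _ _) (hL _ _ _))

end Cancellation

theorem lemma2p2 (Ω : Set (Fin 2 → ℝ)) (hΩ : IsOpen Ω) (w : (Fin 2 → ℝ) → ℝ)
    (hw0 : MemSobolevZero 2 Ω w) (hw4 : MemSobolev 4 Ω w) :
    ∃ α : ℝ → ℝ, Tendsto α (𝓝[>] 0) (𝓝 0) ∧
      ∀ (h : ℝ) (T : Finset (Fin 2 → ℝ)), IsUniformMesh Ω h T →
        (∀ c ∈ T, ∃! p, IsMorleyInterpolant h c w p) ∧
        |brokenHessianInner h T (w - globalInterpolant h T w) (globalInterpolant h T w)|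
          ≤ α h * h ^ 2 := by
  set B : ℝ → Finset (Fin 2 → ℝ) → ℝ := fun h T =>
    |brokenHessianInner h T (w - globalInterpolant h T w) (globalInterpolant h T w)|
  -- Taking the worst mesh of size h makes the rate depend on Ω and w only. If there is no such
  -- mesh, the value is `sSup ∅ = 0`.
  set α : ℝ → ℝ := fun h => sSup {r | ∃ T, IsUniformMesh Ω h T ∧ r = B h T / h ^ 2}
  refine ⟨α, ?_, fun h T hT => ⟨fun c hc => hT.existsUnique_interpolant hw4 hc, ?_⟩⟩
  · rw [Metric.tendsto_nhdsWithin_nhds]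
    intro ε hε
    obtain ⟨δ, hδ, H⟩ := exists_brokenHessianInner_le hΩ hw0 hw4 (half_pos hε)
    refine ⟨δ, hδ, fun {h} hh hd => ?_⟩
    rw [dist_zero_right, Real.norm_eq_abs] at hd ⊢
    have h1 : α h ≤ ε / 2 := by
      -- Nonnegativity of the bound covers the empty set.
      refine Real.sSup_le ?_ (half_pos hε).le
      rintro r ⟨T, hT, rfl⟩
      rw [div_le_iff₀ (pow_pos hT.pos 2)]
      exact H h T hT ((le_abs_self h).trans_lt hd)
    have h2 : 0 ≤ α h := by
      refine Real.sSup_nonneg ?_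
      rintro r ⟨T, hT, rfl⟩
      exact div_nonneg (abs_nonneg _) (sq_nonneg _)
    rw [abs_of_nonneg h2]
    linarith
  · have hp : 0 < h ^ 2 := pow_pos hT.pos 2
    rw [← div_le_iff₀ hp]
    refine le_csSup ?_ ⟨T, hT, rfl⟩
    obtain ⟨K, hK⟩ := exists_brokenHessianInner_bound hw4
    refine ⟨K, ?_⟩
    rintro r ⟨T', hT', rfl⟩
    rw [div_le_iff₀ (pow_pos hT'.pos 2)]
    exact hK h T' hT'
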